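/- **Theorem.** Let $\mathfrak g=\mathfrak g_0\oplus\mathfrak g_1$ be a finite-dimensional complex Lie superalgebra satisfying the following three conditions. (i) $\mathfrak g=\bigoplus_{i\in\mathbb Z}\mathfrak g(i)$ is a $\mathbb Z$-graded Lie superalgebra (each $\mathfrak g(i)$ is a $\mathbb Z_2$-graded subspace and $[\mathfrak g(i),\mathfrak g(j)]\subseteq\mathfrak g(i+j)$), and the Lie algebra $\mathfrak g_0$ is reductive. (ii) $\mathfrak h_0\subseteq\mathfrak g(0)$ is a Cartan subalgebra of $\mathfrak g_0$, and $\mathfrak g$ is a semisimple $\mathfrak h_0$-module. For $\alpha\in\mathfrak h_0^*$ put $\mathfrak g^\alpha=\{x\in\mathfrak g: [h,x]=\alpha(h)x\text{ for all }h\in\mathfrak h_0\}$, let $\mathfrak h=\mathfrak g^0$ be the centralizer of $\mathfrak h_0$, and let $\Delta=\{\alpha\ne0:\mathfrak g^\alpha\neq0\}$. Put $\mathfrak l=\mathfrak g(0)$, $\mathfrak m^+=\bigoplus_{i>0}\mathfrak g(i)$ and $\mathfrak p=\mathfrak l\oplus\mathfrak m^+$. (iii) $\Delta=\Delta^+\cup\Delta^-$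 is a disjoint union such that, for each sign, $\alpha,\beta\in\Delta^{\pm}$ implies $\alpha+\beta\in\Delta^{\pm}$ or $\mathfrak g^{\alpha+\beta}=0$, and $\mathfrak g^\alpha\cap\mathfrak g_0\subseteq\mathfrak p$ for all $\alpha\in\Delta^+$. Let $\mathfrak b=\mathfrak h\oplus\bigoplus_{\alpha\in\Delta^+}\mathfrak g^\alpha$ and $\mathfrak c=\mathfrak b\cap\mathfrak l$. Write $\mathfrak s_0=\mathfrak s\cap\mathfrak g_0$ for a subalgebra $\mathfrak s$. For $\lambda\in\mathfrak h_0^*$: * $\widehat L_S(\lambda)$ is the unique simple quotient of the Verma module over $\mathfrak l_0$ with highest weight $\lambda$ with respect to $\mathfrak c_0$, and $M_S(\lambda)=\mathrm{Ind}_{\mathfrak p_0}^{\mathfrak g_0}\widehat L_S(\lambda)$, where $\mathfrak m^+_0$ acts on $\widehat L_S(\lambda)$ by zero. * $V_\lambda$ is the graded simple $\mathfrak c$-module (unique up to isomorphism and change of parity) on which each $h\in\mathfrak h_0$ acts by $\lambda(h)$ and $\mathfrak g^\alpha\cap\mathfrak l$ acts by zero for all $\alpha\in\Delta^+$; $\widehat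 L_T(\lambda)$ is the unique simple graded quotient of $\mathrm{Ind}_{\mathfrak c}^{\mathfrak l}V_\lambda$, and $M_T(\lambda)=\mathrm{Ind}_{\mathfrak p}^{\mathfrak g}\widehat L_T(\lambda)$, where $\mathfrak m^+$ acts on $\widehat L_T(\lambda)$ by zero. Let $\Delta^+(\mathfrak l_0)=\{\alpha\in\Delta^+:\mathfrak g^\alpha\cap\mathfrak l_0\ne0\}$, let $S$ be the set of those $\alpha\in\Delta^+(\mathfrak l_0)$ that are not a sum of two elements of $\Delta^+(\mathfrak l_0)$, and let $P^{++}_S$ be the set of $\lambda\in\mathfrak h_0^*$ with $\lambda(h_\alpha)\in\mathbb N=\{0,1,2,\dots\}$ for all $\alpha\in S$, where $h_\alpha$ is the unique element of $[\mathfrak g^\alpha\cap\mathfrak g_0,\ \mathfrak g^{-\alpha}\cap\mathfrak g_0]$ with $\alpha(h_\alpha)=2$. Suppose that $\lambda\in\mathfrak h_0^*$ is such that $\dim\widehat L_T(\lambda)<\infty$, and let $c=\dim(\mathfrak g/\mathfrak p)_1$. Then $M_T(\lambda)$ has a finite filtration by $\mathfrak g_0$-submodules $$0=M_0\subset M_1\subset\dots\subset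 M_k=M_T(\lambda)$$ with all inclusions strict, such that for each $i=1,\dots,k$ there is $\lambda_i\in P^{++}_S$ with $M_i/M_{i-1}\cong M_S(\lambda_i)$ as $\mathfrak g_0$-modules. Moreover every $\widehat L_S(\lambda_i)$ is finite-dimensional, and $$\sum_{i=1}^k\dim\widehat L_S(\lambda_i)=2^c\dim\widehat L_T(\lambda).$$ -/

import Mathlib

open scoped TensorProduct

noncomputable section

/-! ### Graded subspaces -/

/-- A subspace `W` is graded (homogeneous) with respect to a family of subspaces `A` if every
element of `W` is a sum of elements of `W` that lie in the members of the family. -/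
def IsGradedSub {ι V : Type*} [AddCommGroup V] [Module ℂ V] (A : ι → Submodule ℂ V)
    (W : Submodule ℂ V) : Prop :=
  W ≤ ⨆ i, W ⊓ A i

/-- The projection onto the `i`-th summand of an internal direct sum, as an endomorphism. -/
def gradedProj {ι V : Type*} [DecidableEq ι] [AddCommGroup V] [Module ℂ V]
    (A : ι → Submodule ℂ V) (h : DirectSum.IsInternal A) (i : ι) : V →ₗ[ℂ] V :=
  (A i).subtype ∘ₗ DirectSum.component ℂ ι (fun j => A j) i ∘ₗ
    (LinearEquiv.ofBijective (DirectSum.coeLinearMap A) h).symm.toLinearMap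

section GradedProj

variable {ι V : Type*} [DecidableEq ι] [AddCommGroup V] [Module ℂ V]
  {A : ι → Submodule ℂ V} (h : DirectSum.IsInternal A)

theorem gradedProj_mem (i : ι) (x : V) : gradedProj A h i x ∈ A i :=
  Subtype.coe_prop _

theorem gradedProj_same {i : ι} {x : V} (hx : x ∈ A i) : gradedProj A h i x = x := by
  have h1 : (LinearEquiv.ofBijective (DirectSum.coeLinearMap A) h).symm x
      = DirectSum.lof ℂ ι (fun j => A j) i ⟨x, hx⟩ := by
    rw [LinearEquiv.symm_apply_eq]
    exact (DirectSum.coeLinearMap_lof A i ⟨x, hx⟩).symm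
  simp [gradedProj, h1, DirectSum.component.lof_self]

theorem gradedProj_ne {i j : ι} (hij : j ≠ i) {x : V} (hx : x ∈ A j) :
    gradedProj A h i x = 0 := by
  have h1 : (LinearEquiv.ofBijective (DirectSum.coeLinearMap A) h).symm x
      = DirectSum.lof ℂ ι (fun j => A j) j ⟨x, hx⟩ := by
    rw [LinearEquiv.symm_apply_eq]
    exact (DirectSum.coeLinearMap_lof A j ⟨x, hx⟩).symm
  simp [gradedProj, h1, DirectSum.component.of, hij]

theorem IsGradedSub.proj_mem {W : Submodule ℂ V} (hW : IsGradedSub A W) (i : ι) {x : V}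
    (hx : x ∈ W) : gradedProj A h i x ∈ W := by
  refine Submodule.iSup_induction (fun i => W ⊓ A i)
    (motive := fun x => gradedProj A h i x ∈ W) (hW hx) ?_ ?_ ?_
  · rintro j y ⟨hy, hyj⟩
    by_cases hij : j = i
    · subst hij
      rwa [gradedProj_same h hyj]
    · rw [gradedProj_ne h hij hyj]
      exact W.zero_mem
  · simp
  · intro y z hy hz
    rw [map_add]
    exact W.add_mem hy hz

theorem isGradedSub_of_proj {W : Submodule ℂ V} (hW : ∀ i, ∀ x ∈ W, gradedProj A h i x ∈ W) :
    IsGradedSub A W := by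
  intro x hx
  have hgen : ∀ y : V, y ∈ ⨆ i, A i := by
    intro y
    rw [h.submodule_iSup_eq_top]
    trivial
  obtain ⟨f, hf, rfl⟩ := (Submodule.mem_iSup_iff_exists_finsupp A x).1 (hgen x)
  have hp : ∀ j, gradedProj A h j (f.sum fun _ y => y) = f j := by
    intro j
    rw [Finsupp.sum, map_sum]
    by_cases hj : j ∈ f.support
    · rw [Finset.sum_eq_single_of_mem j hj, gradedProj_same h (hf j)]
      intro k _ hk
      exact gradedProj_ne h hk (hf k)
    · rw [Finset.sum_eq_zero]
      · exact (Finsupp.notMem_support_iff.1 hj).symm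
      · intro k hk
        refine gradedProj_ne h ?_ (hf k)
        rintro rfl
        exact hj hk
  refine Submodule.sum_mem _ fun j _ => ?_
  refine Submodule.mem_iSup_of_mem j ⟨?_, hf j⟩
  rw [← hp j]
  exact hW j _ hx

end GradedProj

/-! ### Lie superalgebras -/

/-- The sign `(-1) ^ (i j)`, for parities `i` and `j`. -/
def superSign (i j : ZMod 2) : ℂ := (-1) ^ (i.val * j.val)

/-- A complex Lie superalgebra: a `ℤ/2`-graded space `g = par 0 ⊕ par 1` with an even bilinear
bracket that is super-antisymmetric and satisfies the super Jacobi identity. -/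
class LieSuperalgebra (g : Type*) [AddCommGroup g] [Module ℂ g] where
  par : ZMod 2 → Submodule ℂ g
  par_internal : DirectSum.IsInternal par
  br : g →ₗ[ℂ] g →ₗ[ℂ] g
  br_mem : ∀ {i j : ZMod 2} {x y : g}, x ∈ par i → y ∈ par j → br x y ∈ par (i + j)
  br_skew : ∀ {i j : ZMod 2} {x y : g}, x ∈ par i → y ∈ par j →
    br x y = -(superSign i j • br y x)
  br_jacobi : ∀ {i j : ZMod 2} {x y : g}, x ∈ par i → y ∈ par j → ∀ z : g,
    br x (br y z) = br (br x y) z + superSign i j • br y (br x z)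

namespace LieSuperalgebra

section Even

variable (g : Type*) [AddCommGroup g] [Module ℂ g] [LieSuperalgebra g]

/-- The even part of a Lie superalgebra. -/
abbrev Even : Type _ := ↥(par (g := g) 0)

/-- The even part of a Lie superalgebra is a Lie algebra. -/
instance : LieRing (Even g) where
  bracket x y := ⟨br (x : g) (y : g), by simpa using br_mem x.2 y.2⟩
  add_lie x y z := by ext; simp
  lie_add x y z := by ext; simp
  lie_self x := by
    ext
    have h1 : br (x : g) (x : g) = -br (x : g) (x : g) := by
      simpa [superSign] using br_skew x.2 x.2
    have h2 : (2 : ℂ) • br (x : g) (x : g) = 0 := by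
      rw [two_smul]
      exact add_eq_zero_iff_eq_neg.2 h1
    simpa [Bracket.bracket] using h2
  leibniz_lie x y z := by
    ext
    simpa [Bracket.bracket, superSign] using br_jacobi x.2 y.2 (z : g)

instance : LieAlgebra ℂ (Even g) where
  lie_smul t x y := by ext; simp [Bracket.bracket]

end Even

end LieSuperalgebra

open LieSuperalgebra

/-- A (graded) subalgebra of a Lie superalgebra. -/
structure SubSuperalgebra (g : Type*) [AddCommGroup g] [Module ℂ g] [LieSuperalgebra g] where
  sub : Submodule ℂ g
  graded : IsGradedSub par sub
  closed : ∀ {x y : g}, x ∈ sub → y ∈ sub → br x y ∈ sub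

namespace SubSuperalgebra

variable {g : Type*} [AddCommGroup g] [Module ℂ g] [LieSuperalgebra g]

/-- The whole Lie superalgebra. -/
def whole (g : Type*) [AddCommGroup g] [Module ℂ g] [LieSuperalgebra g] : SubSuperalgebra g where
  sub := ⊤
  graded := isGradedSub_of_proj par_internal fun _ _ _ => trivial
  closed _ _ := trivial

/-- The even part, as a subalgebra. -/
def even (g : Type*) [AddCommGroup g] [Module ℂ g] [LieSuperalgebra g] : SubSuperalgebra g where
  sub := par 0
  graded x hx := Submodule.mem_iSup_of_mem 0 ⟨hx, hx⟩
  closed hx hy := by simpa using br_mem hx hy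

/-- The intersection of two subalgebras. -/
def inter (s t : SubSuperalgebra g) : SubSuperalgebra g where
  sub := s.sub ⊓ t.sub
  graded := isGradedSub_of_proj par_internal fun i _ hx =>
    ⟨s.graded.proj_mem par_internal i hx.1, t.graded.proj_mem par_internal i hx.2⟩
  closed hx hy := ⟨s.closed hx.1 hy.1, t.closed hx.2 hy.2⟩

end SubSuperalgebra

/-! ### Representations -/

section Rep

variable {g : Type*} [AddCommGroup g] [Module ℂ g] [LieSuperalgebra g]

/-- A module `V` over a subalgebra `s` of a Lie superalgebra, given by the action map. (For an
`s` contained in the even part this is a module over the Lie algebra `s`.) -/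
structure SuperRep (s : SubSuperalgebra g) (V : Type*) [AddCommGroup V] [Module ℂ V] where
  act : s.sub →ₗ[ℂ] Module.End ℂ V
  act_br : ∀ {i j : ZMod 2} (x y : s.sub), (x : g) ∈ par i → (y : g) ∈ par j →
    act ⟨br (x : g) (y : g), s.closed x.2 y.2⟩ = act x * act y - superSign i j • (act y * act x)

namespace SuperRep

variable {s t : SubSuperalgebra g} {V W : Type*} [AddCommGroup V] [Module ℂ V]
  [AddCommGroup W] [Module ℂ W]

/-- `N` is an `s`-submodule. -/
def IsStable (ρ : SuperRep s V) (N : Submodule ℂ V) : Prop :=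
  ∀ x, ∀ v ∈ N, ρ.act x v ∈ N

/-- `V = 𝒱 0 ⊕ 𝒱 1` is a `ℤ/2`-graded `s`-module. -/
def IsGradedRep (ρ : SuperRep s V) (𝒱 : ZMod 2 → Submodule ℂ V) : Prop :=
  DirectSum.IsInternal 𝒱 ∧
    ∀ (i j : ZMod 2) (x : s.sub) (v : V), (x : g) ∈ par i → v ∈ 𝒱 j → ρ.act x v ∈ 𝒱 (i + j)

/-- `V` is a graded simple `s`-module: it is graded, nonzero, and has no graded submodules other
than zero and itself. -/
def IsGradedSimple (ρ : SuperRep s V) (𝒱 : ZMod 2 → Submodule ℂ V) : Prop :=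
  ρ.IsGradedRep 𝒱 ∧ Nontrivial V ∧
    ∀ N : Submodule ℂ V, ρ.IsStable N → IsGradedSub 𝒱 N → N = ⊥ ∨ N = ⊤

/-- Isomorphism of `s`-modules. -/
def Iso (ρ : SuperRep s V) (σ : SuperRep s W) : Prop :=
  ∃ e : V ≃ₗ[ℂ] W, ∀ x v, e (ρ.act x v) = σ.act x (e v)

/-- Restriction of a module to a smaller subalgebra. -/
def res (ρ : SuperRep s V) (h : t.sub ≤ s.sub) : SuperRep t V where
  act := ρ.act ∘ₗ Submodule.inclusion h
  act_br x y hx hy :=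
    ρ.act_br (Submodule.inclusion h x) (Submodule.inclusion h y) hx hy

/-- A submodule, as a module. -/
def subRep (ρ : SuperRep s V) (N : Submodule ℂ V) (hN : ρ.IsStable N) : SuperRep s N where
  act :=
    { toFun := fun x => (ρ.act x).restrict (hN x)
      map_add' := fun x y => by ext; simp
      map_smul' := fun c x => by ext; simp }
  act_br x y hx hy := by
    ext v
    simp [ρ.act_br x y hx hy]

/-- The quotient by a submodule. -/
def quotRep (ρ : SuperRep s V) (N : Submodule ℂ V) (hN : ρ.IsStable N) : SuperRep s (V ⧸ N) where
  act :=
    { toFun := fun x => N.mapQ N (ρ.act x) (hN x)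
      map_add' := fun x y => by ext; simp
      map_smul' := fun c x => by ext; simp }
  act_br x y hx hy := by
    ext v
    simp [ρ.act_br x y hx hy]

/-- The subquotient `N / N'` for submodules `N'` and `N`, as the quotient of `N` by `N' ∩ N`. -/
def subquot (ρ : SuperRep s V) (N' N : Submodule ℂ V) (hN' : ρ.IsStable N') (hN : ρ.IsStable N) :
    SuperRep s (N ⧸ N'.submoduleOf N) :=
  (ρ.subRep N hN).quotRep (N'.submoduleOf N) fun x v hv => hN' x v hv

end SuperRep

/-! ### Enveloping algebras and induced modules -/

/-- The relations `x y = (-1) ^ (|x| |y|) y x + [x, y]`, for homogeneous `x` and `y`. -/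
inductive EnvRel (s : SubSuperalgebra g) :
    TensorAlgebra ℂ s.sub → TensorAlgebra ℂ s.sub → Prop
  | rel {i j : ZMod 2} (x y : s.sub) (hx : (x : g) ∈ par i) (hy : (y : g) ∈ par j) :
    EnvRel s (TensorAlgebra.ι ℂ x * TensorAlgebra.ι ℂ y)
      (superSign i j • (TensorAlgebra.ι ℂ y * TensorAlgebra.ι ℂ x) +
        TensorAlgebra.ι ℂ ⟨br (x : g) (y : g), s.closed x.2 y.2⟩)

/-- The universal enveloping algebra `U(s)` of a subalgebra of a Lie superalgebra. -/
def Env (s : SubSuperalgebra g) : Type _ := RingQuot (EnvRel s)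

instance (s : SubSuperalgebra g) : Ring (Env s) := inferInstanceAs (Ring (RingQuot (EnvRel s)))

instance (s : SubSuperalgebra g) : Algebra ℂ (Env s) :=
  inferInstanceAs (Algebra ℂ (RingQuot (EnvRel s)))

namespace Env

/-- The canonical map from `s` to `U(s)`. -/
def ι (s : SubSuperalgebra g) : s.sub →ₗ[ℂ] Env s :=
  (RingQuot.mkAlgHom ℂ (EnvRel s)).toLinearMap ∘ₗ TensorAlgebra.ι ℂ

theorem ι_mul_ι {s : SubSuperalgebra g} {i j : ZMod 2} (x y : s.sub) (hx : (x : g) ∈ par i)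
    (hy : (y : g) ∈ par j) :
    ι s x * ι s y = superSign i j • (ι s y * ι s x) +
      ι s ⟨br (x : g) (y : g), s.closed x.2 y.2⟩ := by
  have h1 := RingQuot.mkAlgHom_rel ℂ (EnvRel.rel x y hx hy)
  simp only [map_mul, map_add, map_smul] at h1
  exact h1

/-- Products of homogeneous elements of `s` of total parity `i`, as elements of `U(s)`. -/
inductive IsMonomial (s : SubSuperalgebra g) : ZMod 2 → Env s → Prop
  | one : IsMonomial s 0 1
  | mul {i j : ZMod 2} {x : s.sub} {u : Env s} :
    (x : g) ∈ par i → IsMonomial s j u → IsMonomial s (i + j) (ι s x * u)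

end Env

/-- A module over the ring `U(s)`, as a module over `s`. -/
def SuperRep.ofEnv (s : SubSuperalgebra g) (M : Type*) [AddCommGroup M] [Module ℂ M]
    [Module (Env s) M] [IsScalarTower ℂ (Env s) M] : SuperRep s M where
  act := (Algebra.lsmul ℂ ℂ M).toLinearMap ∘ₗ Env.ι s
  act_br x y hx hy := by
    ext m
    have h1 := congrArg (fun u => u • m) (Env.ι_mul_ι x y hx hy)
    simp only [add_smul, mul_smul, smul_assoc] at h1
    simp [h1]

section Ind

variable {s t : SubSuperalgebra g} (h : t.sub ≤ s.sub) {V : Type*} [AddCommGroup V] [Module ℂ V]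
  (ρ : SuperRep t V)

/-- The `U(s)`-submodule of `U(s) ⊗_ℂ V` generated by the elements `x ⊗ v - 1 ⊗ x v`, for `x` in
`t` and `v` in `V`. -/
def indRel : Submodule (Env s) (Env s ⊗[ℂ] V) :=
  Submodule.span (Env s)
    {z | ∃ (x : t.sub) (v : V),
      z = Env.ι s (Submodule.inclusion h x) ⊗ₜ[ℂ] v - 1 ⊗ₜ[ℂ] ρ.act x v}

/-- The induced module `U(s) ⊗_{U(t)} V`, for a `t`-module `V`, as a quotient of
`U(s) ⊗_ℂ V`. It is a `U(s)`-module. -/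
abbrev Ind : Type _ := (Env s ⊗[ℂ] V) ⧸ indRel h ρ

/-- The induced module, as an `s`-module. -/
def indRep : SuperRep s (Ind h ρ) := SuperRep.ofEnv s _

/-- The `ℤ/2`-grading of the module induced from a graded module: the component of parity `k` is
spanned by the classes of `u ⊗ v` with `u` and `v` homogeneous of total parity `k`. -/
def indGrading (𝒱 : ZMod 2 → Submodule ℂ V) (k : ZMod 2) : Submodule ℂ (Ind h ρ) :=
  Submodule.span ℂ
    {z | ∃ (i j : ZMod 2) (u : Env s) (v : V), i + j = k ∧ Env.IsMonomial s i u ∧ v ∈ 𝒱 j ∧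
      z = (indRel h ρ).mkQ (u ⊗ₜ[ℂ] v)}

end Ind

end Rep

/-! ### The setting -/

section Weights

variable {g : Type*} [AddCommGroup g] [Module ℂ g] [LieSuperalgebra g]
  (h₀ : LieSubalgebra ℂ (Even g))

/-- The weight space `g^α = {x | [h, x] = α(h) x for all h ∈ h₀}`. -/
def wtSpace (α : Module.Dual ℂ h₀) : Submodule ℂ g where
  carrier := {x | ∀ h : h₀, br ((h : Even g) : g) x = α h • x}
  add_mem' hx hy h := by simp [hx h, hy h]
  zero_mem' h := by simp
  smul_mem' c x hx h := by simp [hx h, smul_comm c]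

/-- The set `Δ` of roots: the nonzero `α` such that `g^α` is nonzero. -/
def rootSet : Set (Module.Dual ℂ h₀) := {α | α ≠ 0 ∧ wtSpace h₀ α ≠ ⊥}

end Weights

/-- A `ℤ`-graded Lie superalgebra `g` with reductive even part, a Cartan subalgebra `h₀` of the
even part lying in degree zero for whose adjoint action `g` is semisimple, and a decomposition of
the set of roots into positive and negative roots. -/
structure GradedDatum (g : Type*) [AddCommGroup g] [Module ℂ g] [LieSuperalgebra g] where
  /-- the component of degree `i` of the `ℤ`-grading -/
  gr : ℤ → Submodule ℂ g
  gr_internal : DirectSum.IsInternal gr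
  gr_graded : ∀ i, IsGradedSub par (gr i)
  gr_br : ∀ {i j : ℤ} {x y : g}, x ∈ gr i → y ∈ gr j → br x y ∈ gr (i + j)
  reductive : LieAlgebra.HasCentralRadical ℂ (Even g)
  h₀ : LieSubalgebra ℂ (Even g)
  cartan : h₀.IsCartanSubalgebra
  h₀_deg : ∀ h : h₀, ((h : Even g) : g) ∈ gr 0
  /-- every `h₀`-stable subspace of `g` has an `h₀`-stable complement -/
  semisimple : ∀ W : Submodule ℂ g, (∀ h : h₀, ∀ w ∈ W, br ((h : Even g) : g) w ∈ W) →
    ∃ W' : Submodule ℂ g, IsCompl W W' ∧ ∀ h : h₀, ∀ w ∈ W', br ((h : Even g) : g) w ∈ W'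
  /-- the positive roots `Δ⁺` -/
  pos : Set (Module.Dual ℂ h₀)
  /-- the negative roots `Δ⁻` -/
  neg : Set (Module.Dual ℂ h₀)
  root_eq : rootSet h₀ = pos ∪ neg
  pos_neg_disjoint : Disjoint pos neg
  pos_add : ∀ α ∈ pos, ∀ β ∈ pos, α + β ∈ pos ∨ wtSpace h₀ (α + β) = ⊥
  neg_add : ∀ α ∈ neg, ∀ β ∈ neg, α + β ∈ neg ∨ wtSpace h₀ (α + β) = ⊥
  pos_deg : ∀ α ∈ pos, wtSpace h₀ α ⊓ par 0 ≤ ⨆ i : {i : ℤ // 0 ≤ i}, gr i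

namespace GradedDatum

variable {g : Type*} [AddCommGroup g] [Module ℂ g] [LieSuperalgebra g] (D : GradedDatum g)

theorem graded_iSup {ι : Sort*} {W : ι → Submodule ℂ g} (hW : ∀ i, IsGradedSub par (W i)) :
    IsGradedSub par (⨆ i, W i) :=
  iSup_le fun i => (hW i).trans (iSup_mono fun _ => inf_le_inf_right _ (le_iSup W i))

theorem br_closed_of_iSup {ι κ : Type*} {W : ι → Submodule ℂ g} {Z : κ → Submodule ℂ g}
    {N : Submodule ℂ g}
    (h : ∀ i j, ∀ x ∈ W i, ∀ y ∈ Z j, br x y ∈ N) {x y : g} (hx : x ∈ ⨆ i, W i)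
    (hy : y ∈ ⨆ i, Z i) : br x y ∈ N := by
  refine Submodule.iSup_induction W (motive := fun x => br x y ∈ N) hx ?_ ?_ ?_
  · intro i a ha
    refine Submodule.iSup_induction Z (motive := fun y => br a y ∈ N) hy ?_ ?_ ?_
    · exact fun j b hb => h i j a ha b hb
    · simp
    · intro b c hb hc
      rw [map_add]
      exact N.add_mem hb hc
  · simp
  · intro a b ha hb
    rw [map_add, LinearMap.add_apply]
    exact N.add_mem ha hb

/-- The Levi subalgebra `l`, the component of degree zero. -/
def l : SubSuperalgebra g where
  sub := D.gr 0
  graded := D.gr_graded 0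
  closed hx hy := by simpa using D.gr_br hx hy

/-- The parabolic subalgebra `p`, the sum of the components of nonnegative degree. -/
def p : SubSuperalgebra g where
  sub := ⨆ i : {i : ℤ // 0 ≤ i}, D.gr i
  graded := graded_iSup fun i => D.gr_graded i
  closed hx hy := by
    refine br_closed_of_iSup (fun i j x hx y hy => ?_) hx hy
    exact (le_iSup (fun i : {i : ℤ // 0 ≤ i} => D.gr i) ⟨i + j, add_nonneg i.2 j.2⟩)
      (D.gr_br hx hy)

/-- The even part of `l`. -/
def l₀ : SubSuperalgebra g := D.l.inter (SubSuperalgebra.even g)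

/-- The even part of `p`. -/
def p₀ : SubSuperalgebra g := D.p.inter (SubSuperalgebra.even g)

theorem wt_graded (α : Module.Dual ℂ D.h₀) : IsGradedSub par (wtSpace D.h₀ α) := by
  refine isGradedSub_of_proj par_internal fun i x hx h => ?_
  have hc : ∀ z : g, gradedProj par par_internal i (br ((h : Even g) : g) z)
      = br ((h : Even g) : g) (gradedProj par par_internal i z) := by
    intro z
    have hz : z ∈ ⨆ i, par (g := g) i := by
      rw [par_internal.submodule_iSup_eq_top]
      trivial
    refine Submodule.iSup_induction par (motive := fun z =>
      gradedProj par par_internal i (br ((h : Even g) : g) z)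
      = br ((h : Even g) : g) (gradedProj par par_internal i z)) hz ?_ ?_ ?_
    · intro j y hy
      have hb : br ((h : Even g) : g) y ∈ par j := by simpa using br_mem (h : Even g).2 hy
      by_cases hij : j = i
      · subst hij
        rw [gradedProj_same _ hy, gradedProj_same _ hb]
      · rw [gradedProj_ne _ hij hy, gradedProj_ne _ hij hb, map_zero]
    · simp
    · intro a b ha hb
      simp only [map_add, ha, hb]
  rw [← hc, hx h, map_smul]

theorem wt_br {α β : Module.Dual ℂ D.h₀} {x y : g} (hx : x ∈ wtSpace D.h₀ α)
    (hy : y ∈ wtSpace D.h₀ β) : br x y ∈ wtSpace D.h₀ (α + β) := by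
  refine br_closed_of_iSup (W := fun i => wtSpace D.h₀ α ⊓ par i)
    (Z := fun i => wtSpace D.h₀ β ⊓ par i) ?_ (D.wt_graded α hx) (D.wt_graded β hy)
  rintro i j a ⟨ha, hai⟩ b ⟨hb, -⟩ h
  have h1 : ∀ z, br ((h : Even g) : g) (br a z)
      = br (br ((h : Even g) : g) a) z + br a (br ((h : Even g) : g) z) := by
    intro z
    have h2 := br_jacobi (h : Even g).2 hai z
    simpa [superSign] using h2
  rw [h1, ha h, hb h]
  simp [add_smul]

/-- Zero is not a positive root. -/
theorem zero_notMem_pos : (0 : Module.Dual ℂ D.h₀) ∉ D.pos := by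
  intro h
  have h1 : (0 : Module.Dual ℂ D.h₀) ∈ rootSet D.h₀ := by
    rw [D.root_eq]
    exact Or.inl h
  exact h1.1 rfl

/-- The Borel subalgebra `b = h ⊕ ⨁_{α ∈ Δ⁺} g^α`, where `h = g^0` is the centralizer of `h₀`. -/
def b : SubSuperalgebra g where
  sub := ⨆ α : {α : Module.Dual ℂ D.h₀ // α = 0 ∨ α ∈ D.pos}, wtSpace D.h₀ α
  graded := graded_iSup fun α => D.wt_graded α
  closed hx hy := by
    refine br_closed_of_iSup ?_ hx hy
    rintro ⟨α, hα⟩ ⟨β, hβ⟩ x hx y hy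
    have h1 : br x y ∈ wtSpace D.h₀ (α + β) := D.wt_br hx hy
    have h2 : (α + β = 0 ∨ α + β ∈ D.pos) ∨ wtSpace D.h₀ (α + β) = ⊥ := by
      rcases hα with rfl | hα
      · exact Or.inl (by simpa using hβ)
      · rcases hβ with rfl | hβ
        · exact Or.inl (Or.inr (by simpa using hα))
        · exact (D.pos_add α hα β hβ).imp_left Or.inr
    rcases h2 with h2 | h2
    · exact (le_iSup (fun α : {α : Module.Dual ℂ D.h₀ // α = 0 ∨ α ∈ D.pos} =>
        wtSpace D.h₀ α) ⟨α + β, h2⟩) h1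
    · rw [h2, Submodule.mem_bot] at h1
      rw [h1]
      exact Submodule.zero_mem _

/-- The Borel subalgebra `c = b ∩ l` of `l`. -/
def c : SubSuperalgebra g := D.b.inter D.l

/-! ### The modules -/

theorem c_le_l : D.c.sub ≤ D.l.sub := inf_le_right

theorem p₀_le_even : D.p₀.sub ≤ (SubSuperalgebra.even g).sub := inf_le_right

theorem le_whole (s : SubSuperalgebra g) : s.sub ≤ (SubSuperalgebra.whole g).sub := le_top

/-- The projection of `g` onto its component of degree zero. -/
def proj₀ : g →ₗ[ℂ] g := gradedProj D.gr D.gr_internal 0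

theorem proj₀_mem_l (x : g) : D.proj₀ x ∈ D.l.sub := gradedProj_mem D.gr_internal 0 x

theorem proj₀_par {i : ZMod 2} {x : g} (hx : x ∈ par i) : D.proj₀ x ∈ par i := by
  have hc : ∀ z : g, gradedProj par par_internal i (D.proj₀ z)
      = D.proj₀ (gradedProj par par_internal i z) := by
    intro z
    have hz : z ∈ ⨆ i, D.gr i := by
      rw [D.gr_internal.submodule_iSup_eq_top]
      trivial
    refine Submodule.iSup_induction D.gr (motive := fun z =>
      gradedProj par par_internal i (D.proj₀ z)
      = D.proj₀ (gradedProj par par_internal i z)) hz ?_ ?_ ?_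
    · intro j y hy
      have hb := (D.gr_graded j).proj_mem par_internal i hy
      by_cases hj : j = 0
      · subst hj
        rw [proj₀, gradedProj_same _ hy, gradedProj_same _ hb]
      · rw [proj₀, gradedProj_ne _ hj hy, gradedProj_ne _ hj hb, map_zero]
    · simp
    · intro a b ha hb
      simp only [map_add, ha, hb]
  have h1 := hc x
  rw [gradedProj_same _ hx] at h1
  rw [← h1]
  exact gradedProj_mem _ _ _

theorem proj₀_br {x y : g} (hx : x ∈ D.p.sub) (hy : y ∈ D.p.sub) :
    D.proj₀ (br x y) = br (D.proj₀ x) (D.proj₀ y) := by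
  refine Submodule.iSup_induction (fun i : {i : ℤ // 0 ≤ i} => D.gr i)
    (motive := fun x => D.proj₀ (br x y) = br (D.proj₀ x) (D.proj₀ y)) hx ?_ ?_ ?_
  · intro i a ha
    refine Submodule.iSup_induction (fun i : {i : ℤ // 0 ≤ i} => D.gr i)
      (motive := fun y => D.proj₀ (br a y) = br (D.proj₀ a) (D.proj₀ y)) hy ?_ ?_ ?_
    · intro j b hb
      have hab := D.gr_br ha hb
      by_cases hi : (i : ℤ) = 0
      · rw [hi] at ha hab
        by_cases hj : (j : ℤ) = 0
        · rw [hj] at hb hab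
          rw [proj₀, gradedProj_same _ ha, gradedProj_same _ hb,
            gradedProj_same _ (by simpa using hab)]
        · rw [proj₀, gradedProj_ne _ hj hb, gradedProj_ne _ (by simpa using hj) hab, map_zero]
      · have hij : (i : ℤ) + j ≠ 0 := by
          have h1 := i.2
          have h2 := j.2
          omega
        rw [proj₀, gradedProj_ne _ hi ha, gradedProj_ne _ hij hab, map_zero,
          LinearMap.zero_apply]
    · simp
    · intro b c hb hc
      simp only [map_add, hb, hc]
  · simp
  · intro a b ha hb
    simp only [map_add, LinearMap.add_apply, ha, hb]

/-- An `l`-module, regarded as a `p`-module on which the components of positive degree act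
by zero. -/
def inflate {V : Type*} [AddCommGroup V] [Module ℂ V] (ρ : SuperRep D.l V) : SuperRep D.p V where
  act := ρ.act ∘ₗ (D.proj₀ ∘ₗ D.p.sub.subtype).codRestrict D.l.sub fun x => D.proj₀_mem_l x
  act_br x y hx hy := by
    have h1 := ρ.act_br ⟨D.proj₀ x, D.proj₀_mem_l x⟩ ⟨D.proj₀ y, D.proj₀_mem_l y⟩
      (D.proj₀_par hx) (D.proj₀_par hy)
    simp only [← D.proj₀_br x.2 y.2] at h1
    exact h1

/-- An `l₀`-module, regarded as a `p₀`-module on which the components of positive degree act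
by zero. -/
def inflate₀ {V : Type*} [AddCommGroup V] [Module ℂ V] (ρ : SuperRep D.l₀ V) :
    SuperRep D.p₀ V where
  act := ρ.act ∘ₗ (D.proj₀ ∘ₗ D.p₀.sub.subtype).codRestrict D.l₀.sub
    fun x => ⟨D.proj₀_mem_l x, D.proj₀_par x.2.2⟩
  act_br x y hx hy := by
    have h1 := ρ.act_br ⟨D.proj₀ x, ⟨D.proj₀_mem_l x, D.proj₀_par x.2.2⟩⟩
      ⟨D.proj₀ y, ⟨D.proj₀_mem_l y, D.proj₀_par y.2.2⟩⟩ (D.proj₀_par hx) (D.proj₀_par hy)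
    simp only [← D.proj₀_br x.2.1 y.2.1] at h1
    exact h1

/-- The defining property of `V_λ`: a graded simple `c`-module on which `h₀` acts through `lam`
and the root vectors of `c` for the positive roots act by zero. -/
def IsHighestWeightSpace (lam : Module.Dual ℂ D.h₀) {V : Type*} [AddCommGroup V] [Module ℂ V]
    (𝒱 : ZMod 2 → Submodule ℂ V) (ρ : SuperRep D.c V) : Prop :=
  ρ.IsGradedSimple 𝒱 ∧
    (∀ (x : D.c.sub) (h : D.h₀), (x : g) = ((h : Even g) : g) → ∀ v, ρ.act x v = lam h • v) ∧
    ∀ x : D.c.sub, ∀ α ∈ D.pos, (x : g) ∈ wtSpace D.h₀ α → ρ.act x = 0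

section T

variable {V : Type*} [AddCommGroup V] [Module ℂ V] (𝒱 : ZMod 2 → Submodule ℂ V)
  (ρ : SuperRep D.c V)

/-- The sum of all proper graded `U(l)`-submodules of the `l`-module induced from `V`. -/
def maxSubT : Submodule (Env D.l) (Ind D.c_le_l ρ) :=
  sSup {N | N ≠ ⊤ ∧ IsGradedSub (indGrading D.c_le_l ρ 𝒱) (N.restrictScalars ℂ)}

/-- The simple graded `l`-module `L̂_T(λ)`, the unique simple graded quotient of the `l`-module
induced from the `c`-module `V = V_λ`. -/
abbrev LT : Type _ := Ind D.c_le_l ρ ⧸ D.maxSubT 𝒱 ρ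

/-- The action of `l` on `L̂_T(λ)`. -/
def LTrep : SuperRep D.l (D.LT 𝒱 ρ) := SuperRep.ofEnv D.l _

/-- The parabolically induced `g`-module `M_T(λ)`. -/
abbrev MT : Type _ := Ind (le_whole D.p) (D.inflate (D.LTrep 𝒱 ρ))

/-- The action of `g` on `M_T(λ)`. -/
def MTrep : SuperRep (SubSuperalgebra.whole g) (D.MT 𝒱 ρ) := indRep _ _

/-- `M_T(λ)` as a module over the even part of `g`. -/
def MTrep₀ : SuperRep (SubSuperalgebra.even g) (D.MT 𝒱 ρ) :=
  (D.MTrep 𝒱 ρ).res (le_whole _)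

end T

section S

variable (lam : Module.Dual ℂ D.h₀)

/-- The Verma module over `l₀` with highest weight `lam` for the Borel subalgebra `c ∩ l₀`: the
quotient of `U(l₀)` by the left ideal generated by the positive root vectors and by the elements
`h - lam(h)` for `h` in `h₀`. -/
abbrev Verma : Type _ :=
  Env D.l₀ ⧸ Submodule.span (Env D.l₀)
    ({u | ∃ x : D.l₀.sub, (∃ α ∈ D.pos, (x : g) ∈ wtSpace D.h₀ α) ∧ u = Env.ι D.l₀ x} ∪
      {u | ∃ h : D.h₀, u = Env.ι D.l₀ ⟨((h : Even g) : g), D.h₀_deg h, (h : Even g).2⟩ -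
        algebraMap ℂ (Env D.l₀) (lam h)})

/-- The simple highest weight `l₀`-module `L̂_S(λ)`, the unique simple quotient of the Verma
module: its quotient by the sum of all proper submodules. -/
abbrev LS : Type _ := D.Verma lam ⧸ sSup {N : Submodule (Env D.l₀) (D.Verma lam) | N ≠ ⊤}

/-- The action of `l₀` on `L̂_S(λ)`. -/
def LSrep : SuperRep D.l₀ (D.LS lam) := SuperRep.ofEnv D.l₀ _

/-- The parabolic Verma module `M_S(λ)` over the even part of `g`. -/
abbrev MS : Type _ := Ind D.p₀_le_even (D.inflate₀ (D.LSrep lam))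

/-- The action of the even part of `g` on `M_S(λ)`. -/
def MSrep : SuperRep (SubSuperalgebra.even g) (D.MS lam) := indRep _ _

end S

/-- The positive roots of `l₀`. -/
def posL₀ : Set (Module.Dual ℂ D.h₀) := {α | α ∈ D.pos ∧ wtSpace D.h₀ α ⊓ D.l₀.sub ≠ ⊥}

/-- The set `S` of indecomposable positive roots of `l₀`. -/
def S : Set (Module.Dual ℂ D.h₀) :=
  {α | α ∈ D.posL₀ ∧ ¬ ∃ β ∈ D.posL₀, ∃ γ ∈ D.posL₀, α = β + γ}

/-- `h` is the coroot of the root `α` of the even part `g₀`: the (unique) element of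
`[g₀^α, g₀^{-α}]` with `α(h) = 2`. -/
def IsCoroot (α : Module.Dual ℂ D.h₀) (h : D.h₀) : Prop :=
  ((h : Even g) : g) ∈ Submodule.span ℂ
      {z : g | ∃ x ∈ wtSpace D.h₀ α ⊓ par 0, ∃ y ∈ wtSpace D.h₀ (-α) ⊓ par 0, z = br x y} ∧
    α h = 2

/-- The set `P_S^{++}` of the weights that take values in `ℕ` on the coroots of the elements
of `S`. -/
def dominant : Set (Module.Dual ℂ D.h₀) :=
  {lam | ∀ α ∈ D.S, ∃ h : D.h₀, D.IsCoroot α h ∧ ∃ n : ℕ, lam h = n}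

/-- The dimension of the odd part of `g / p`. -/
def oddCodim : ℕ := Module.finrank ℂ ((par (g := g) 1).map D.p.sub.mkQ)

end GradedDatum

end

/-!
The module `M_T(λ)` is induced from the finite-dimensional `p`-module `W = L̂_T(λ)`. As a module over
the even part `g₀` it behaves like `U(g₀) ⊗_{U(p₀)} (Λ(g/p)₁ ⊗ W)` up to a filtration, and a
filtration of `Λ(g/p)₁ ⊗ W` with simple `p₀`-modules as subquotients induces one of `M_T(λ)` with
subquotients `M_S(μ)`.

The freeness behind this is the Poincaré–Birkhoff–Witt theorem for Lie superalgebras. It is proved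
by rewriting words in the letters of a homogeneous basis: the rewriting rules are confluent
(`HomBasis.confluent`) because their only ambiguity, the overlap of two rules, is resolved by the
super Jacobi identity (`HomBasis.overlap`). So normal words are independent
(`HomBasis.exists_envNormalForm`), and an induced module is free over the normal words in the letters
outside the subalgebra (`HomBasis.gen_eq_span`, `HomBasis.ind_independent`). For the letters in the
order "even outside `p`, odd outside `p`, in `p`", this says that `M_T(λ)` is free over the even
letters outside `p`, with generators the space `Frame.ext` of increasing products of odd letters
outside `p` with vectors of `W`, whose dimension is `2 ^ c * dim W` (`Frame.outerSpan_ext`,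
`Frame.mem_of_sum_mem`, `Frame.finrank_ext`). The space `Frame.ext` is not stable under `p₀`, but it
is so modulo the `g₀`-module generated by the products with fewer odd factors
(`Frame.act_mem_ext_sup`, `Frame.evFil_eq`).

The filtration consists of the spaces `Frame.evSpan N` for a flag of subspaces `N` of `Frame.ext`.
Given `N`, one takes a simple `p₀`-submodule of the quotient by `Frame.evSpan N` that comes from the
lowest degree in which `Frame.ext` is not yet exhausted (`Frame.exists_simple_step`). By freeness the
`g₀`-module that it generates is induced from it (`Frame.subquot_iso`), and dimensions add up
(`Frame.finrank_eq_add`).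

It remains that a finite-dimensional simple `p₀`-module is `L̂_S(μ)` with `μ` dominant
(`GradedDatum.exists_dominant_iso`). The Cartan subalgebra has a common eigenvector in it by Lie's theorem.
Nonempty sums of positive even roots do not vanish (`GradedDatum.sum_ne_zero`), so there is a maximal
weight and with it a highest weight vector (`GradedDatum.exists_isHighest`). The components of
positive degree then act by zero (`GradedDatum.act_eq_zero_of_pos`), the module is the simple
quotient of the Verma module over `l₀` (`GradedDatum.LSrep_iso`), and dominance is the integrality of
highest weights for `sl₂` (`exists_nat_eigenvalue`). The `sl₂`-triples come from the Killing form,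
whose kernel is contained in the center of the reductive Lie algebra `g₀`
(`GradedDatum.exists_sl2`).
-/


noncomputable section

open LieSuperalgebra
open scoped TensorProduct

/-! ### Universal properties of enveloping algebras and induced modules -/

section Envelope

variable {g : Type*} [AddCommGroup g] [Module ℂ g] [LieSuperalgebra g]

namespace Env

variable {s t : SubSuperalgebra g}

/-- The universal property of `U(s)`: a linear map that respects the super-commutation relations
extends to an algebra homomorphism. -/
def lift {A : Type*} [Ring A] [Algebra ℂ A] (f : s.sub →ₗ[ℂ] A)
    (hf : ∀ {i j : ZMod 2} (x y : s.sub), (x : g) ∈ par i → (y : g) ∈ par j →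
      f x * f y = superSign i j • (f y * f x) + f ⟨br (x : g) (y : g), s.closed x.2 y.2⟩) :
    Env s →ₐ[ℂ] A :=
  RingQuot.liftAlgHom ℂ ⟨TensorAlgebra.lift ℂ f, by
    intro a b hab
    induction hab with
    | rel x y hx hy => simpa using hf x y hx hy⟩

theorem lift_ι {A : Type*} [Ring A] [Algebra ℂ A] (f : s.sub →ₗ[ℂ] A)
    (hf : ∀ {i j : ZMod 2} (x y : s.sub), (x : g) ∈ par i → (y : g) ∈ par j →
      f x * f y = superSign i j • (f y * f x) + f ⟨br (x : g) (y : g), s.closed x.2 y.2⟩)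
    (x : s.sub) : lift f hf (ι s x) = f x := by
  have h1 := RingQuot.liftAlgHom_mkAlgHom_apply ℂ (TensorAlgebra.lift ℂ f) (s := EnvRel s) (by
    intro a b hab
    induction hab with
    | rel x y hx hy => simpa using hf x y hx hy) (TensorAlgebra.ι ℂ x)
  rw [TensorAlgebra.lift_ι_apply] at h1
  exact h1

/-- A subspace of `U(s)` that contains `1` and is stable under left multiplication with the elements
of `s` is everything. -/
theorem eq_top_of_ι_mul_mem {S : Submodule ℂ (Env s)} (h1 : (1 : Env s) ∈ S)
    (hS : ∀ x, ∀ u ∈ S, ι s x * u ∈ S) : S = ⊤ := by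
  rw [eq_top_iff]
  rintro u -
  let π : TensorAlgebra ℂ s.sub →ₐ[ℂ] Env s := RingQuot.mkAlgHom ℂ (EnvRel s)
  obtain ⟨a, rfl⟩ : ∃ a, π a = u := RingQuot.mkAlgHom_surjective ℂ (EnvRel s) u
  have h2 : ∀ v ∈ S, π a * v ∈ S := by
    induction a using TensorAlgebra.induction with
    | algebraMap r =>
      intro v hv
      have h3 : π (algebraMap ℂ _ r) * v = r • v := by
        rw [AlgHom.commutes]
        exact (Algebra.smul_def r v).symm
      rw [h3]
      exact S.smul_mem r hv
    | ι x => exact fun v hv => hS x v hv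
    | mul a b ha hb =>
      intro v hv
      rw [map_mul, mul_assoc]
      exact ha _ (hb v hv)
    | add a b ha hb =>
      intro v hv
      rw [map_add, add_mul]
      exact S.add_mem (ha v hv) (hb v hv)
  simpa using h2 1 h1

/-- Left induction: a property of elements of `U(s)` holds for all of them if it holds for `1` and
is preserved by linear combinations and by left multiplication with elements of `s`. -/
theorem left_induction {P : Env s → Prop} (u : Env s) (h1 : P 1)
    (hadd : ∀ u v, P u → P v → P (u + v)) (hsmul : ∀ (c : ℂ) u, P u → P (c • u))
    (hmul : ∀ x u, P u → P (ι s x * u)) : P u := by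
  let S : Submodule ℂ (Env s) :=
    { carrier := {u | P u}
      add_mem' := fun ha hb => hadd _ _ ha hb
      zero_mem' := by simpa using hsmul 0 1 h1
      smul_mem' := fun c u hu => hsmul c u hu }
  have hS : S = ⊤ := eq_top_of_ι_mul_mem h1 hmul
  have : u ∈ S := by rw [hS]; trivial
  exact this

/-- The algebra homomorphism `U(t) → U(s)` of an inclusion `t ⊆ s`. -/
def map (h : t.sub ≤ s.sub) : Env t →ₐ[ℂ] Env s :=
  lift (ι s ∘ₗ Submodule.inclusion h) fun x y hx hy =>
    ι_mul_ι (Submodule.inclusion h x) (Submodule.inclusion h y) hx hy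

@[simp]
theorem map_ι (h : t.sub ≤ s.sub) (x : t.sub) :
    map h (ι t x) = ι s (Submodule.inclusion h x) :=
  lift_ι _ (fun x y hx hy =>
    ι_mul_ι (Submodule.inclusion h x) (Submodule.inclusion h y) hx hy) x

end Env

namespace SuperRep

variable {s t : SubSuperalgebra g} {V W : Type*} [AddCommGroup V] [Module ℂ V]
  [AddCommGroup W] [Module ℂ W]

theorem act_mul_act (ρ : SuperRep s V) {i j : ZMod 2} (x y : s.sub) (hx : (x : g) ∈ par i)
    (hy : (y : g) ∈ par j) : ρ.act x * ρ.act y = superSign i j • (ρ.act y * ρ.act x) +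
      ρ.act ⟨br (x : g) (y : g), s.closed x.2 y.2⟩ := by
  rw [ρ.act_br x y hx hy]
  abel

/-- The action of `U(s)` on an `s`-module. -/
def envHom (ρ : SuperRep s V) : Env s →ₐ[ℂ] Module.End ℂ V :=
  Env.lift ρ.act fun x y => ρ.act_mul_act x y

@[simp]
theorem envHom_ι (ρ : SuperRep s V) (x : s.sub) : ρ.envHom (Env.ι s x) = ρ.act x :=
  Env.lift_ι _ (fun x y => ρ.act_mul_act x y) x

theorem envHom_map (ρ : SuperRep s V) (h : t.sub ≤ s.sub) (u : Env t) (v : V) :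
    ρ.envHom (Env.map h u) v = (ρ.res h).envHom u v := by
  induction u using Env.left_induction generalizing v with
  | h1 => simp
  | hadd a b ha hb => simp [ha, hb]
  | hsmul c a ha => simp [ha]
  | hmul x a ha => simp [ha, res]

theorem act_act (ρ : SuperRep s V) {i j : ZMod 2} (x y : s.sub) (hx : (x : g) ∈ par i)
    (hy : (y : g) ∈ par j) (v : V) :
    ρ.act x (ρ.act y v) = superSign i j • ρ.act y (ρ.act x v) +
      ρ.act ⟨br (x : g) (y : g), s.closed x.2 y.2⟩ v := by
  rw [ρ.act_br x y hx hy]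
  simp

theorem IsStable.envHom_mem {ρ : SuperRep s V} {N : Submodule ℂ V} (hN : ρ.IsStable N)
    (u : Env s) {v : V} (hv : v ∈ N) : ρ.envHom u v ∈ N := by
  induction u using Env.left_induction with
  | h1 => simpa using hv
  | hadd a b ha hb => simpa using N.add_mem ha hb
  | hsmul c a ha => simpa using N.smul_mem c ha
  | hmul x a ha => simpa using hN x _ ha

theorem envHom_comm {ρ : SuperRep s V} {σ : SuperRep s W} {f : V →ₗ[ℂ] W}
    (hf : ∀ x v, f (ρ.act x v) = σ.act x (f v)) (u : Env s) (v : V) :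
    f (ρ.envHom u v) = σ.envHom u (f v) := by
  induction u using Env.left_induction generalizing v with
  | h1 => simp
  | hadd a b ha hb => simp [ha, hb]
  | hsmul c a ha => simp [ha]
  | hmul x a ha => simp [ha, hf]

theorem ofEnv_envHom (M : Type*) [AddCommGroup M] [Module ℂ M]
    [Module (Env s) M] [IsScalarTower ℂ (Env s) M] (u : Env s) (m : M) :
    (ofEnv s M).envHom u m = u • m := by
  induction u using Env.left_induction generalizing m with
  | h1 => simp
  | hadd a b ha hb => simp [ha, hb, add_smul]
  | hsmul c a ha => simp [ha]
  | hmul x a ha => rw [map_mul, Module.End.mul_apply, ha, envHom_ι, mul_smul]; rfl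

/-- The submodule generated by a subspace. -/
def gen (ρ : SuperRep s V) (N : Submodule ℂ V) : Submodule ℂ V :=
  Submodule.span ℂ {z | ∃ (u : Env s) (n : V), n ∈ N ∧ z = ρ.envHom u n}

theorem le_gen (ρ : SuperRep s V) (N : Submodule ℂ V) : N ≤ ρ.gen N :=
  fun n hn => Submodule.subset_span ⟨1, n, hn, by simp⟩

theorem gen_stable (ρ : SuperRep s V) (N : Submodule ℂ V) : ρ.IsStable (ρ.gen N) := by
  intro x v hv
  induction hv using Submodule.span_induction with
  | mem z hz =>
    obtain ⟨u, n, hn, rfl⟩ := hz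
    exact Submodule.subset_span ⟨Env.ι s x * u, n, hn, by simp⟩
  | zero => simp
  | add a b _ _ ha hb => simpa using Submodule.add_mem _ ha hb
  | smul c a _ ha => simpa using Submodule.smul_mem _ c ha

theorem gen_le {ρ : SuperRep s V} {N M : Submodule ℂ V} (hM : ρ.IsStable M) (h : N ≤ M) :
    ρ.gen N ≤ M := by
  refine Submodule.span_le.2 ?_
  rintro _ ⟨u, n, hn, rfl⟩
  exact hM.envHom_mem u (h hn)

theorem gen_mono (ρ : SuperRep s V) {N M : Submodule ℂ V} (h : N ≤ M) : ρ.gen N ≤ ρ.gen M :=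
  gen_le (ρ.gen_stable M) (h.trans (ρ.le_gen M))

end SuperRep

section Ind

variable {s t : SubSuperalgebra g} (h : t.sub ≤ s.sub) {V M : Type*} [AddCommGroup V] [Module ℂ V]
  [AddCommGroup M] [Module ℂ M] (ρ : SuperRep t V)

/-- The canonical map `v ↦ 1 ⊗ v` from a module to the induced module. -/
def indOf : V →ₗ[ℂ] Ind h ρ :=
  ((indRel h ρ).mkQ.restrictScalars ℂ) ∘ₗ TensorProduct.mk ℂ (Env s) V 1

theorem indRep_envHom (u : Env s) (z : Ind h ρ) : (indRep h ρ).envHom u z = u • z :=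
  SuperRep.ofEnv_envHom _ u z

theorem mkQ_tmul (u : Env s) (v : V) :
    (indRel h ρ).mkQ (u ⊗ₜ[ℂ] v) = (indRep h ρ).envHom u (indOf h ρ v) := by
  rw [indRep_envHom]
  change _ = u • (indRel h ρ).mkQ (1 ⊗ₜ[ℂ] v)
  rw [← map_smul, TensorProduct.smul_tmul', smul_eq_mul, mul_one]

theorem indOf_act (x : t.sub) (v : V) :
    indOf h ρ (ρ.act x v) = (indRep h ρ).act (Submodule.inclusion h x) (indOf h ρ v) := by
  rw [← SuperRep.envHom_ι (indRep h ρ), ← mkQ_tmul, eq_comm, ← sub_eq_zero]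
  change (indRel h ρ).mkQ _ - (indRel h ρ).mkQ _ = 0
  rw [← map_sub, Submodule.mkQ_apply, Submodule.Quotient.mk_eq_zero]
  exact Submodule.subset_span ⟨x, v, rfl⟩

theorem ind_gen_range : (indRep h ρ).gen (LinearMap.range (indOf h ρ)) = ⊤ := by
  rw [eq_top_iff]
  rintro z -
  obtain ⟨z, rfl⟩ := (indRel h ρ).mkQ_surjective z
  induction z using TensorProduct.induction_on with
  | zero => simp
  | add a b ha hb => rw [map_add]; exact Submodule.add_mem _ ha hb
  | tmul u v => exact Submodule.subset_span ⟨u, _, ⟨v, rfl⟩, mkQ_tmul h ρ u v⟩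

/-- Frobenius reciprocity: a homomorphism of `t`-modules from `V` to an `s`-module extends to the
induced module. -/
theorem exists_indLift (σ : SuperRep s M) (f : V →ₗ[ℂ] M)
    (hf : ∀ x v, f (ρ.act x v) = σ.act (Submodule.inclusion h x) (f v)) :
    ∃ F : Ind h ρ →ₗ[ℂ] M, (∀ v, F (indOf h ρ v) = f v) ∧
      ∀ x z, F ((indRep h ρ).act x z) = σ.act x (F z) := by
  let F₀ : Env s ⊗[ℂ] V →ₗ[ℂ] M := TensorProduct.lift
    ((LinearMap.lcomp ℂ M f) ∘ₗ σ.envHom.toLinearMap)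
  have hF₀ : ∀ u v, F₀ (u ⊗ₜ v) = σ.envHom u (f v) := fun u v => rfl
  have hF₁ : ∀ (u : Env s) z, F₀ (u • z) = σ.envHom u (F₀ z) := by
    intro u z
    induction z using TensorProduct.induction_on with
    | zero => simp
    | add a b ha hb => rw [smul_add, map_add, ha, hb, map_add, map_add]
    | tmul a v => rw [TensorProduct.smul_tmul', hF₀, hF₀, smul_eq_mul, map_mul]; rfl
  have hker : (indRel h ρ).restrictScalars ℂ ≤ LinearMap.ker F₀ := by
    intro z hz
    replace hz : z ∈ indRel h ρ := hz
    rw [LinearMap.mem_ker]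
    induction hz using Submodule.span_induction with
    | mem z hz =>
      obtain ⟨x, v, rfl⟩ := hz
      rw [map_sub, hF₀, hF₀, hf]
      simp
    | zero => simp
    | add a b _ _ ha hb => rw [map_add, ha, hb, add_zero]
    | smul u a _ ha => rw [hF₁, ha, map_zero]
  let F : Ind h ρ →ₗ[ℂ] M := ((indRel h ρ).restrictScalars ℂ).liftQ F₀ hker
  have hF : ∀ z, F ((indRel h ρ).mkQ z) = F₀ z := fun z => rfl
  refine ⟨F, fun v => ?_, fun x z => ?_⟩
  · change F ((indRel h ρ).mkQ (1 ⊗ₜ[ℂ] v)) = _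
    rw [hF, hF₀]
    simp
  · obtain ⟨z, rfl⟩ := (indRel h ρ).mkQ_surjective z
    rw [← SuperRep.envHom_ι, indRep_envHom, ← map_smul, hF, hF, hF₁, SuperRep.envHom_ι]

end Ind

end Envelope

/-! ### The Poincaré–Birkhoff–Witt theorem: straightening words -/

section PBW

variable {g : Type*} [AddCommGroup g] [Module ℂ g] [LieSuperalgebra g]

theorem superSign_zero_left (i : ZMod 2) : superSign 0 i = 1 := by simp [superSign]

theorem superSign_zero_right (i : ZMod 2) : superSign i 0 = 1 := by simp [superSign]

theorem superSign_one_one : superSign 1 1 = -1 := by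
  have h1 : (1 : ZMod 2).val = 1 := rfl
  simp [superSign, h1]

theorem zmod_two_cases (i : ZMod 2) : i = 0 ∨ i = 1 := by
  revert i
  decide

/-- The bracket of a subalgebra. -/
def SubSuperalgebra.bra (s : SubSuperalgebra g) : s.sub →ₗ[ℂ] s.sub →ₗ[ℂ] s.sub :=
  LinearMap.mk₂ ℂ (fun x y => ⟨br (x : g) (y : g), s.closed x.2 y.2⟩)
    (fun x y z => by ext; simp) (fun c x y => by ext; simp)
    (fun x y z => by ext; simp) (fun c x y => by ext; simp)

theorem SubSuperalgebra.coe_bra (s : SubSuperalgebra g) (x y : s.sub) :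
    (s.bra x y : g) = br (x : g) (y : g) := rfl

/-- A homogeneous basis of a subalgebra `s`, indexed by the letters `B`, together with an
injective function `rank` that puts the letters into a linear order. -/
structure HomBasis (s : SubSuperalgebra g) (B : Type*) where
  basis : Module.Basis B ℂ s.sub
  parity : B → ZMod 2
  mem : ∀ b, (basis b : g) ∈ par (parity b)
  /-- The position of a letter in the order used for normal words. -/
  rank : B → ℕ
  rank_inj : Function.Injective rank

namespace HomBasis

variable {s : SubSuperalgebra g} {B : Type*} (b : HomBasis s B)

/-- The letter `i` may stand immediately to the left of `j` in a normal word: `i` is smaller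
than `j`, or `i = j` is even. -/
def Good (i j : B) : Prop := b.rank i < b.rank j ∨ (i = j ∧ b.parity i = 0)

/-- A word is normal if its letters are weakly increasing and odd letters are not repeated. -/
def Normal (w : List B) : Prop := w.IsChain b.Good

theorem normal_nil : b.Normal [] := List.isChain_nil

theorem not_good {i j : B} (h : ¬ b.Good i j) :
    b.rank j < b.rank i ∨ (i = j ∧ b.parity i = 1) := by
  rw [Good, not_or] at h
  rcases lt_trichotomy (b.rank i) (b.rank j) with h1 | h1 | h1
  · exact absurd h1 h.1
  · have h2 := b.rank_inj h1
    refine Or.inr ⟨h2, ?_⟩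
    have h3 : b.parity i ≠ 0 := fun h3 => h.2 ⟨h2, h3⟩
    generalize b.parity i = z at h3
    revert z
    decide
  · exact Or.inl h1

theorem exists_of_not_normal {w : List B} (h : ¬ b.Normal w) :
    ∃ u i j v, w = u ++ i :: j :: v ∧ ¬ b.Good i j := by
  rw [Normal, List.isChain_iff_forall_rel_of_append_cons_cons] at h
  push Not at h
  obtain ⟨i, j, u, v, h1, h2⟩ := h
  exact ⟨u, i, j, v, h1, h2⟩

/-- The sum of the ranks of the letters of a word, each multiplied by its distance from the end
of the word. Interchanging two neighbours that stand in the wrong order decreases it. -/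
def weight : List B → ℕ
  | [] => 0
  | a :: w => b.rank a * (w.length + 1) + weight w

theorem weight_swap (u v : List B) {i j : B} (h : b.rank j < b.rank i) :
    b.weight (u ++ j :: i :: v) < b.weight (u ++ i :: j :: v) := by
  induction u with
  | nil =>
    simp only [List.nil_append, weight, List.length_cons]
    nlinarith
  | cons a u ih =>
    simp only [List.cons_append, weight, List.length_append, List.length_cons]
    omega

/-- The well-founded order on words for which straightening is decreasing: by length, then by
`weight`. -/
def Below (w w' : List B) : Prop :=
  w.length < w'.length ∨ (w.length = w'.length ∧ b.weight w < b.weight w')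

theorem below_wf : WellFounded b.Below := by
  have h1 : WellFounded (Prod.Lex (· < ·) (· < ·) : ℕ × ℕ → ℕ × ℕ → Prop) :=
    WellFounded.prod_lex wellFounded_lt wellFounded_lt
  refine Subrelation.wf ?_ (InvImage.wf (fun w : List B => (w.length, b.weight w)) h1)
  intro w w' h
  rcases h with h | ⟨h, h'⟩
  · exact Prod.Lex.left _ _ h
  · change Prod.Lex _ _ (w.length, b.weight w) (w'.length, b.weight w')
    rw [h]
    exact Prod.Lex.right _ h'

theorem below_swap (u v : List B) {i j : B} (h : b.rank j < b.rank i) :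
    b.Below (u ++ j :: i :: v) (u ++ i :: j :: v) :=
  Or.inr ⟨by simp, b.weight_swap u v h⟩

theorem Below.trans {b : HomBasis s B} {w w' w'' : List B} (h : b.Below w w')
    (h' : b.Below w' w'') : b.Below w w'' := by
  rcases h with h | h <;> rcases h' with h' | h' <;> simp only [Below] <;> omega

/-- A homogeneous element is a combination of basis elements of the same parity. -/
theorem mem_span_of_par {i : ZMod 2} {z : s.sub} (hz : (z : g) ∈ par i) :
    z ∈ Submodule.span ℂ (b.basis '' {a | b.parity a = i}) := by
  classical
  let q : s.sub →ₗ[ℂ] s.sub :=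
    b.basis.constr ℂ fun a => if b.parity a = i then b.basis a else 0
  have hq : s.sub.subtype ∘ₗ q = gradedProj par par_internal i ∘ₗ s.sub.subtype := by
    refine b.basis.ext fun a => ?_
    simp only [LinearMap.comp_apply, q, Module.Basis.constr_basis, Submodule.subtype_apply]
    split_ifs with h
    · rw [gradedProj_same]
      rw [← h]
      exact b.mem a
    · rw [gradedProj_ne _ h (b.mem a)]
      rfl
  have hz' : q z = z := by
    have h1 := LinearMap.congr_fun hq z
    simp only [LinearMap.comp_apply, Submodule.subtype_apply] at h1
    rw [gradedProj_same _ hz] at h1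
    exact Subtype.ext h1
  rw [← hz', b.basis.constr_apply]
  refine Submodule.sum_mem _ fun a _ => Submodule.smul_mem _ _ ?_
  split_ifs with h
  · exact Submodule.subset_span ⟨a, h, rfl⟩
  · exact Submodule.zero_mem _

/-- Words in the letters of a basis, as elements of `U(s)`. -/
def mono (w : List B) : Env s := (w.map fun a => Env.ι s (b.basis a)).prod

@[simp] theorem mono_nil : b.mono [] = 1 := rfl

@[simp] theorem mono_cons (a : B) (w : List B) :
    b.mono (a :: w) = Env.ι s (b.basis a) * b.mono w := by simp [mono]

theorem mono_append (w w' : List B) : b.mono (w ++ w') = b.mono w * b.mono w' := by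
  simp [mono]

/-- The easy half of the Poincaré–Birkhoff–Witt theorem: the normal words span `U(s)`. -/
theorem span_normal : Submodule.span ℂ (b.mono '' {w | b.Normal w}) = ⊤ := by
  set N := Submodule.span ℂ (b.mono '' {w | b.Normal w}) with hN
  have hι : ∀ (x : s.sub) (w w' : List B), (∀ c, b.mono (w ++ c :: w') ∈ N) →
      b.mono w * Env.ι s x * b.mono w' ∈ N := by
    intro x w w' h
    have hx : x ∈ Submodule.span ℂ (Set.range b.basis) := by
      rw [b.basis.span_eq]
      trivial
    induction hx using Submodule.span_induction with
    | mem x hx =>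
      obtain ⟨c, rfl⟩ := hx
      have := h c
      rwa [mono_append, mono_cons, ← mul_assoc] at this
    | zero => simp
    | add x y _ _ hx hy => rw [map_add, mul_add, add_mul]; exact N.add_mem hx hy
    | smul c x _ hx => rw [map_smul, mul_smul_comm, smul_mul_assoc]; exact N.smul_mem c hx
  have hw : ∀ w, b.mono w ∈ N := by
    intro w
    induction w using b.below_wf.induction with
    | _ w ih =>
    by_cases hw : b.Normal w
    · exact Submodule.subset_span ⟨w, hw, rfl⟩
    obtain ⟨u, i, j, v, rfl, hij⟩ := b.exists_of_not_normal hw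
    have h1 := Env.ι_mul_ι (b.basis i) (b.basis j) (b.mem i) (b.mem j)
    have h2 : b.mono (u ++ i :: j :: v) =
        superSign (b.parity i) (b.parity j) • b.mono (u ++ j :: i :: v) +
          b.mono u * Env.ι s (s.bra (b.basis i) (b.basis j)) * b.mono v := by
      simp only [mono_append, mono_cons]
      rw [← mul_assoc (Env.ι s (b.basis i)), h1]
      simp only [mul_add, add_mul, mul_smul_comm, smul_mul_assoc, mul_assoc]
      rfl
    have h3 : b.mono u * Env.ι s (s.bra (b.basis i) (b.basis j)) * b.mono v ∈ N := by
      refine hι _ _ _ fun c => ih _ (Or.inl ?_)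
      simp
    rcases b.not_good hij with h | ⟨rfl, h⟩
    · rw [h2]
      exact N.add_mem (N.smul_mem _ (ih _ (b.below_swap u v h))) h3
    · rw [h, superSign_one_one] at h2
      have h5 : b.mono (u ++ i :: i :: v) =
          (1 / 2 : ℂ) • (b.mono u * Env.ι s (s.bra (b.basis i) (b.basis i)) * b.mono v) := by
        linear_combination (norm := module) (1 / 2 : ℂ) • h2
      rw [h5]
      exact N.smul_mem _ h3
  refine Env.eq_top_of_ι_mul_mem (Submodule.subset_span ⟨[], List.isChain_nil, rfl⟩) ?_
  intro x u hu
  induction hu using Submodule.span_induction with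
  | mem u hu =>
    obtain ⟨w, _, rfl⟩ := hu
    simpa using hι x [] w fun c => hw _
  | zero => simp
  | add x y _ _ hx hy => rw [mul_add]; exact N.add_mem hx hy
  | smul c x _ hx => rw [mul_smul_comm]; exact N.smul_mem c hx

end HomBasis

end PBW

/-! ### The Poincaré–Birkhoff–Witt theorem: independence of normal words -/

section PBWIndep

variable {g : Type*} [AddCommGroup g] [Module ℂ g] [LieSuperalgebra g]

namespace HomBasis

variable {s : SubSuperalgebra g} {B : Type*} (b : HomBasis s B)

/-- The free algebra on the letters `B`, with the words as a basis. -/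
abbrev WordAlg (B : Type*) : Type _ := MonoidAlgebra ℂ (FreeMonoid B)

/-- A word, as an element of the free algebra. -/
def word (w : List B) : WordAlg B := MonoidAlgebra.of ℂ (FreeMonoid B) (FreeMonoid.ofList w)

theorem word_nil : word ([] : List B) = 1 := map_one _

theorem word_append (u v : List B) : word (u ++ v) = word u * word v := map_mul _ _ _

theorem word_cons (a : B) (v : List B) : word (a :: v) = word [a] * word v :=
  word_append [a] v

/-- The words as a basis of the free algebra. -/
def wordBasis (B : Type*) : Module.Basis (List B) ℂ (WordAlg B) :=
  (MonoidAlgebra.basis (FreeMonoid B) ℂ).reindex FreeMonoid.toList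

theorem wordBasis_apply (w : List B) : wordBasis B w = word w := by
  simp [wordBasis, word]

/-- The elements of `s` as combinations of letters. -/
def letter : s.sub →ₗ[ℂ] WordAlg B := b.basis.constr ℂ fun a => word [a]

theorem letter_basis (a : B) : b.letter (b.basis a) = word [a] := by simp [letter]

/-- The right-hand side of the rewriting rule for the word `i j`, if it is not normal:
`± j i + [i, j]`, respectively `[i, i] / 2` if `i = j` is odd. -/
def rewrite [DecidableEq B] (i j : B) : WordAlg B :=
  if i = j then (1 / 2 : ℂ) • b.letter (s.bra (b.basis i) (b.basis i))
  else superSign (b.parity i) (b.parity j) • (word [j] * word [i]) +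
    b.letter (s.bra (b.basis i) (b.basis j))

/-- The span of the words below a given word. -/
def belowSpan (w : List B) : Submodule ℂ (WordAlg B) :=
  Submodule.span ℂ (word '' {x | b.Below x w})

theorem rewrite_mem_span [DecidableEq B] {i j : B} (h : ¬ b.Good i j) :
    b.rewrite i j ∈ Submodule.span ℂ
      (word '' {x | ∀ u v, b.Below (u ++ x ++ v) (u ++ i :: j :: v)}) := by
  have h1 : ∀ z, b.letter z ∈ Submodule.span ℂ
      (word '' {x | ∀ u v, b.Below (u ++ x ++ v) (u ++ i :: j :: v)}) := by
    intro z
    rw [letter, b.basis.constr_apply]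
    refine Submodule.sum_mem _ fun a _ => Submodule.smul_mem _ _ ?_
    refine Submodule.subset_span ⟨[a], fun u v => Or.inl ?_, rfl⟩
    simp
  rw [rewrite]
  split_ifs with hij
  · exact Submodule.smul_mem _ _ (h1 _)
  · refine Submodule.add_mem _ (Submodule.smul_mem _ _ ?_) (h1 _)
    rw [← word_append]
    refine Submodule.subset_span ⟨_, fun u v => ?_, rfl⟩
    have h2 := (b.not_good h).resolve_right fun h => hij h.1
    simpa using b.below_swap u v h2

theorem rewrite_mem_belowSpan [DecidableEq B] (u v : List B) {i j : B} (h : ¬ b.Good i j) :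
    word u * b.rewrite i j * word v ∈ b.belowSpan (u ++ i :: j :: v) := by
  have h1 := b.rewrite_mem_span h
  generalize b.rewrite i j = X at h1
  induction h1 using Submodule.span_induction with
  | mem X hX =>
    obtain ⟨x, hx, rfl⟩ := hX
    rw [← word_append, ← word_append]
    exact Submodule.subset_span ⟨_, hx u v, rfl⟩
  | zero => simp
  | add X Y _ _ hX hY => rw [mul_add, add_mul]; exact Submodule.add_mem _ hX hY
  | smul c X _ hX => rw [mul_smul_comm, smul_mul_assoc]; exact Submodule.smul_mem _ _ hX

/-- Normal forms: a linear map that fixes the normal words and is invariant under one chosen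
rewriting step of each other word. It is defined by recursion along `Below`; that it is invariant
under all rewriting steps is `confluent`. -/
theorem exists_normalForm [DecidableEq B] : ∃ L : WordAlg B →ₗ[ℂ] WordAlg B,
    (∀ w, b.Normal w → L (word w) = word w) ∧
    ∀ w, ¬ b.Normal w → ∃ u i j v, w = u ++ i :: j :: v ∧ ¬ b.Good i j ∧
      L (word w) = L (word u * b.rewrite i j * word v) := by
  classical
  have hex : ∀ w, ∃ f : WordAlg B, (b.Normal w → f = word w) ∧
      (¬ b.Normal w → f ∈ b.belowSpan w ∧ ∃ u i j v, w = u ++ i :: j :: v ∧ ¬ b.Good i j ∧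
        f = word u * b.rewrite i j * word v) := by
    intro w
    by_cases hw : b.Normal w
    · exact ⟨word w, fun _ => rfl, fun h => absurd hw h⟩
    · obtain ⟨u, i, j, v, rfl, hij⟩ := b.exists_of_not_normal hw
      exact ⟨_, fun h => absurd h hw, fun _ =>
        ⟨b.rewrite_mem_belowSpan u v hij, u, i, j, v, rfl, hij, rfl⟩⟩
  choose f hf1 hf2 using hex
  let step : ∀ w : List B, (∀ x, b.Below x w → WordAlg B) → WordAlg B := fun w rec =>
    if b.Normal w then word w
    else (wordBasis B).constr ℂ (fun x => if hx : b.Below x w then rec x hx else 0) (f w)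
  let L₀ : List B → WordAlg B := b.below_wf.fix step
  have hL₀ : ∀ w, L₀ w = step w fun x _ => L₀ x := fun w => b.below_wf.fix_eq step w
  let L : WordAlg B →ₗ[ℂ] WordAlg B := (wordBasis B).constr ℂ L₀
  have hL : ∀ w, L (word w) = L₀ w := by
    intro w
    rw [← wordBasis_apply]
    exact Module.Basis.constr_basis _ _ _ _
  refine ⟨L, fun w hw => ?_, fun w hw => ?_⟩
  · rw [hL, hL₀]
    exact if_pos hw
  · obtain ⟨hmem, u, i, j, v, h1, h2, h3⟩ := hf2 w hw
    refine ⟨u, i, j, v, h1, h2, ?_⟩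
    rw [← h3, hL, hL₀]
    refine (if_neg hw).trans ?_
    refine LinearMap.eqOn_span' (s := word '' {x | b.Below x w}) ?_ hmem
    rintro _ ⟨x, hx, rfl⟩
    rw [hL, ← wordBasis_apply, Module.Basis.constr_basis]
    exact dif_pos hx

section Confluence

variable [DecidableEq B] (L : WordAlg B →ₗ[ℂ] WordAlg B)

/-- Rewriting the word `w` at any position does not change its value under `L`. -/
def Confluent (w : List B) : Prop :=
  ∀ u i j v, w = u ++ i :: j :: v → ¬ b.Good i j →
    L (word w) = L (word u * b.rewrite i j * word v)

variable {b L}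

/-- If all words that are no longer than `u i j v` are confluent, then `L` respects the
super-commutation relation of two letters between `u` and `v`, whether or not they stand in the
order of a normal word. -/
theorem commute_letters_of_basis {u v : List B}
    (ih : ∀ w : List B, w.length < u.length + v.length + 3 → b.Confluent L w) (i j : B) :
    L (word u * (word [i] * word [j]) * word v) =
      superSign (b.parity i) (b.parity j) • L (word u * (word [j] * word [i]) * word v) +
        L (word u * b.letter (s.bra (b.basis i) (b.basis j)) * word v) := by
  have hw : ∀ i j : B, word u * (word [i] * word [j]) * word v = word (u ++ i :: j :: v) := by
    intro i j
    rw [word_append, word_cons i (j :: v), word_cons j v]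
    simp only [mul_assoc]
  have key : ∀ i j : B, ¬ b.Good i j → L (word u * (word [i] * word [j]) * word v) =
      L (word u * b.rewrite i j * word v) := by
    intro i j hij
    rw [hw]
    exact ih _ (by simp; omega) u i j v rfl hij
  have hgt : ∀ i j : B, b.rank j < b.rank i → L (word u * (word [i] * word [j]) * word v) =
      superSign (b.parity i) (b.parity j) • L (word u * (word [j] * word [i]) * word v) +
        L (word u * b.letter (s.bra (b.basis i) (b.basis j)) * word v) := by
    intro i j hij
    have hne : i ≠ j := by
      rintro rfl
      exact lt_irrefl _ hij
    have hng : ¬ b.Good i j := by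
      rintro (h | h)
      · omega
      · exact hne h.1
    rw [key i j hng, rewrite, if_neg hne]
    simp only [mul_add, add_mul, mul_smul_comm, smul_mul_assoc, map_add, map_smul]
  rcases lt_trichotomy (b.rank i) (b.rank j) with h | h | h
  · rw [hgt j i h]
    have h1 : s.bra (b.basis j) (b.basis i) =
        -(superSign (b.parity j) (b.parity i) • s.bra (b.basis i) (b.basis j)) := by
      ext
      simpa [SubSuperalgebra.coe_bra] using br_skew (b.mem j) (b.mem i)
    rw [h1, map_neg, map_smul, mul_neg, neg_mul, map_neg, mul_smul_comm, smul_mul_assoc, map_smul]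
    rcases zmod_two_cases (b.parity i) with hi | hi <;>
      rcases zmod_two_cases (b.parity j) with hj | hj <;>
      simp only [hi, hj, superSign_zero_left, superSign_zero_right, superSign_one_one] <;> module
  · obtain rfl := b.rank_inj h
    rcases zmod_two_cases (b.parity i) with hi | hi
    · have h1 : s.bra (b.basis i) (b.basis i) = 0 := by
        have h2 := br_skew (b.mem i) (b.mem i)
        rw [hi, superSign_zero_left, one_smul] at h2
        have h3 : (2 : ℂ) • br (b.basis i : g) (b.basis i : g) = 0 := by
          rw [two_smul]
          exact add_eq_zero_iff_eq_neg.2 h2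
        ext
        simpa [SubSuperalgebra.coe_bra] using h3
      rw [h1, hi, superSign_zero_left]
      simp
    · have hng : ¬ b.Good i i := by
        rintro (h | h)
        · omega
        · rw [hi] at h
          exact one_ne_zero h.2
      rw [key i i hng, rewrite, if_pos rfl, hi, superSign_one_one]
      simp only [mul_smul_comm, smul_mul_assoc, map_smul]
      module
  · exact hgt i j h

/-- The same for homogeneous elements of `s`. -/
theorem commute_letters {u v : List B}
    (ih : ∀ w : List B, w.length < u.length + v.length + 3 → b.Confluent L w)
    {k l : ZMod 2} {x y : s.sub} (hx : (x : g) ∈ par k) (hy : (y : g) ∈ par l) :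
    L (word u * (b.letter x * b.letter y) * word v) =
      superSign k l • L (word u * (b.letter y * b.letter x) * word v) +
        L (word u * b.letter (s.bra x y) * word v) := by
  replace hx := b.mem_span_of_par hx
  replace hy := b.mem_span_of_par hy
  induction hx using Submodule.span_induction with
  | mem x hx =>
    obtain ⟨i, rfl, rfl⟩ := hx
    induction hy using Submodule.span_induction with
    | mem y hy =>
      obtain ⟨j, rfl, rfl⟩ := hy
      rw [letter_basis, letter_basis]
      exact commute_letters_of_basis ih i j
    | zero => simp
    | add y z _ _ hy hz =>
      simp only [map_add, mul_add, add_mul, smul_add] at hy hz ⊢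
      rw [hy, hz]
      abel
    | smul c y _ hy =>
      simp only [map_smul, mul_smul_comm, smul_mul_assoc] at hy ⊢
      rw [hy, smul_add, smul_comm c]
  | zero => simp
  | add x z _ _ hx hz =>
    simp only [map_add, mul_add, add_mul, smul_add, LinearMap.add_apply] at hx hz ⊢
    rw [hx, hz]
    abel
  | smul c x _ hx =>
    simp only [map_smul, mul_smul_comm, smul_mul_assoc, LinearMap.smul_apply] at hx ⊢
    rw [hx, smul_add, smul_comm c]

/-- The only ambiguity of the rewriting rules: both neighbouring pairs of `i j k` can be rewritten.
The two results agree by the super Jacobi identity; the four cases are those of distinct letters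
and of a repeated odd letter at either end or at both. -/
theorem overlap {u v : List B} {i j k : B}
    (ih : ∀ w, b.Below w (u ++ i :: j :: k :: v) → b.Confluent L w) (hij : ¬ b.Good i j)
    (hjk : ¬ b.Good j k) :
    L (word u * (b.rewrite i j * word [k]) * word v) =
      L (word u * (word [i] * b.rewrite j k) * word v) := by
  have ih' : ∀ w : List B, w.length < u.length + v.length + 3 → b.Confluent L w := by
    refine fun w hw => ih w (Or.inl ?_)
    simp
    omega
  obtain ⟨ℓ, hℓ⟩ : ∃ ℓ : WordAlg B →ₗ[ℂ] WordAlg B, ∀ X, L (word u * X * word v) = ℓ X :=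
    ⟨L ∘ₗ LinearMap.mulRight ℂ (word v) ∘ₗ LinearMap.mulLeft ℂ (word u), fun X => rfl⟩
  have hw : ∀ a c d : B, word u * (word [a] * (word [c] * word [d])) * word v =
      word (u ++ a :: c :: d :: v) := by
    intro a c d
    rw [word_append, word_cons a (c :: d :: v), word_cons c (d :: v), word_cons d v]
    simp only [mul_assoc]
  have hleft : ∀ a c d : B, b.Below (u ++ a :: c :: d :: v) (u ++ i :: j :: k :: v) →
      ¬ b.Good a c → ℓ (word [a] * (word [c] * word [d])) = ℓ (b.rewrite a c * word [d]) := by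
    intro a c d hb h
    rw [← hℓ, ← hℓ, hw, ih _ hb u a c (d :: v) rfl h, word_cons d v]
    simp only [mul_assoc]
  have hright : ∀ a c d : B, b.Below (u ++ a :: c :: d :: v) (u ++ i :: j :: k :: v) →
      ¬ b.Good c d → ℓ (word [a] * (word [c] * word [d])) = ℓ (word [a] * b.rewrite c d) := by
    intro a c d hb h
    rw [← hℓ, ← hℓ, hw, ih _ hb (u ++ [a]) c d v (by simp) h, word_append]
    simp only [mul_assoc]
  have hcomm : ∀ {k l : ZMod 2} {x y : s.sub}, (x : g) ∈ par k → (y : g) ∈ par l →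
      ℓ (b.letter x * b.letter y) = superSign k l • ℓ (b.letter y * b.letter x) +
        ℓ (b.letter (s.bra x y)) := by
    intro k l x y hx hy
    simpa only [hℓ] using commute_letters ih' hx hy
  have hbr : ∀ a c : B, ((s.bra (b.basis a) (b.basis c) : s.sub) : g) ∈
      par (b.parity a + b.parity c) := fun a c => br_mem (b.mem a) (b.mem c)
  have hjac : ∀ a c d : B, s.bra (b.basis a) (s.bra (b.basis c) (b.basis d)) =
      s.bra (s.bra (b.basis a) (b.basis c)) (b.basis d) + superSign (b.parity a) (b.parity c) •
        s.bra (b.basis c) (s.bra (b.basis a) (b.basis d)) := by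
    intro a c d
    ext
    simpa [SubSuperalgebra.coe_bra] using br_jacobi (b.mem a) (b.mem c) (b.basis d : g)
  have hgood : ∀ {a c : B}, b.rank c < b.rank a → ¬ b.Good a c ∧ a ≠ c := by
    intro a c h
    refine ⟨?_, ?_⟩
    · rintro (h' | ⟨rfl, -⟩) <;> omega
    · rintro rfl
      omega
  have hsw : ∀ {a c : B}, b.rank c < b.rank a → b.rewrite a c =
      superSign (b.parity a) (b.parity c) • (word [c] * word [a]) +
        b.letter (s.bra (b.basis a) (b.basis c)) := fun h => if_neg (hgood h).2
  have hsq : ∀ a : B, b.rewrite a a = (1 / 2 : ℂ) • b.letter (s.bra (b.basis a) (b.basis a)) :=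
    fun a => if_pos rfl
  have c1 := hcomm (b.mem i) (hbr j k)
  have c2 := hcomm (hbr i j) (b.mem k)
  have J := congrArg (fun x => ℓ (b.letter x)) (hjac i j k)
  simp only [map_add, map_smul] at J
  simp only [letter_basis] at c1 c2
  rw [hℓ, hℓ]
  rcases b.not_good hij with h1 | ⟨rfl, h1⟩ <;> rcases b.not_good hjk with h2 | ⟨rfl, h2⟩
  · have h3 : b.rank k < b.rank i := h2.trans h1
    have B1 := b.below_swap u (k :: v) h1
    have B2 : b.Below (u ++ i :: k :: j :: v) (u ++ i :: j :: k :: v) := by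
      simpa using b.below_swap (u ++ [i]) v h2
    have B3 : b.Below (u ++ j :: k :: i :: v) (u ++ j :: i :: k :: v) := by
      simpa using b.below_swap (u ++ [j]) v h3
    have B4 := b.below_swap u (j :: v) h3
    have e1 := hright j i k B1 (hgood h3).1
    have e2 := hleft j k i (B3.trans B1) (hgood h2).1
    have e3 := hleft i k j B2 (hgood h3).1
    have e4 := hright k i j (B4.trans B2) (hgood h1).1
    have c3 := hcomm (b.mem j) (hbr i k)
    rw [letter_basis] at c3
    rw [hsw h1, hsw h2]
    rw [hsw h3] at e1 e3
    rw [hsw h2] at e2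
    rw [hsw h1] at e4
    simp only [mul_add, add_mul, mul_smul_comm, smul_mul_assoc, map_add, map_smul, mul_assoc]
      at e1 e2 e3 e4 ⊢
    rw [e1, e2, e3, e4, c1, c2, c3]
    rcases zmod_two_cases (b.parity i) with hi | hi <;>
      rcases zmod_two_cases (b.parity j) with hj | hj <;>
      rcases zmod_two_cases (b.parity k) with hk | hk <;>
      simp only [hi, hj, hk, superSign_zero_left, superSign_zero_right, superSign_one_one,
        CharTwo.add_self_eq_zero, add_zero, zero_add] at J ⊢ <;>
      rw [J] <;> module
  · have B1 := b.below_swap u (j :: v) h1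
    have B2 : b.Below (u ++ j :: j :: i :: v) (u ++ j :: i :: j :: v) := by
      simpa using b.below_swap (u ++ [j]) v h1
    have e1 := hright j i j B1 (hgood h1).1
    have e2 := hleft j j i (B2.trans B1) hjk
    have c3 := hcomm (b.mem j) (hbr i j)
    rw [letter_basis] at c3
    rw [hsw h1, hsq]
    rw [hsw h1] at e1
    rw [hsq] at e2
    simp only [mul_add, add_mul, mul_smul_comm, smul_mul_assoc, map_add, map_smul, mul_assoc]
      at e1 e2 ⊢
    rw [e1, e2, c1]
    rcases zmod_two_cases (b.parity i) with hi | hi <;>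
      simp only [hi, h2, superSign_zero_left, superSign_zero_right, superSign_one_one,
        CharTwo.add_self_eq_zero, zero_add] at J c2 c3 ⊢
    · linear_combination (norm := module) (1 / 2 : ℂ) • c2 + (1 / 2 : ℂ) • c3 - (1 / 2 : ℂ) • J
    · linear_combination (norm := module) (1 / 2 : ℂ) • c2 - (1 / 2 : ℂ) • c3 - (1 / 2 : ℂ) • J
  · have B1 : b.Below (u ++ i :: k :: i :: v) (u ++ i :: i :: k :: v) := by
      simpa using b.below_swap (u ++ [i]) v h2
    have B2 := b.below_swap u (i :: v) h2
    have e1 := hleft i k i B1 (hgood h2).1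
    have e2 := hright k i i (B2.trans B1) hij
    rw [hsw h2, hsq]
    rw [hsw h2] at e1
    rw [hsq] at e2
    simp only [mul_add, add_mul, mul_smul_comm, smul_mul_assoc, map_add, map_smul, mul_assoc]
      at e1 e2 ⊢
    rw [e1, e2, c1, c2]
    rcases zmod_two_cases (b.parity k) with hk | hk <;>
      simp only [hk, h1, superSign_zero_left, superSign_zero_right, superSign_one_one,
        CharTwo.add_self_eq_zero, add_zero] at J ⊢ <;>
      linear_combination (norm := module) (-1 / 2 : ℂ) • J
  · -- for a threefold odd letter `x`, the Jacobi identity gives `[x, [x, x]] = 0`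
    rw [hsq]
    simp only [mul_smul_comm, smul_mul_assoc, map_smul]
    simp only [h1, superSign_zero_left, superSign_zero_right, superSign_one_one,
      CharTwo.add_self_eq_zero] at J c1 c2 ⊢
    linear_combination (norm := module) (-1 / 3 : ℂ) • c1 + (1 / 6 : ℂ) • c2 - (1 / 6 : ℂ) • J

/-- The diamond lemma for the rewriting rules of `U(s)`. -/
theorem confluent (hnf : ∀ w, ¬ b.Normal w → ∃ u i j v, w = u ++ i :: j :: v ∧ ¬ b.Good i j ∧
    L (word w) = L (word u * b.rewrite i j * word v)) (w : List B) : b.Confluent L w := by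
  induction w using b.below_wf.induction with
  | _ w ih =>
  -- two rewritings of `w` agree if the first one is to the left of the second one
  have key : ∀ u i j v u' i' j' v', w = u ++ i :: j :: v → w = u' ++ i' :: j' :: v' →
      ¬ b.Good i j → ¬ b.Good i' j' → u.length ≤ u'.length →
      L (word u * b.rewrite i j * word v) = L (word u' * b.rewrite i' j' * word v') := by
    intro u i j v u' i' j' v' h1 h2 hij hij' hle
    have h3 := h1.symm.trans h2
    obtain ⟨t, rfl⟩ : u <+: u' :=
      List.prefix_of_prefix_length_le ⟨_, h3⟩ ⟨_, rfl⟩ hle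
    rw [List.append_assoc, List.append_cancel_left_eq] at h3
    rcases t with _ | ⟨a, _ | ⟨c, t⟩⟩
    · simp only [List.nil_append, List.cons.injEq] at h3
      obtain ⟨rfl, rfl, rfl⟩ := h3
      simp
    · simp only [List.cons_append, List.nil_append, List.cons.injEq] at h3
      obtain ⟨rfl, rfl, rfl⟩ := h3
      have := overlap (u := u) (v := v') (fun x hx => ih x (h1 ▸ hx)) hij hij'
      rw [word_append, word_cons j' v']
      simpa only [mul_assoc] using this
    · simp only [List.cons_append, List.cons.injEq] at h3
      obtain ⟨rfl, rfl, rfl⟩ := h3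
      have e1 : ∀ X ∈ Submodule.span ℂ
          (word '' {x | ∀ u v, b.Below (u ++ x ++ v) (u ++ i :: j :: v)}),
          L (word u * X * word t * (word [i'] * word [j']) * word v') =
            L (word u * X * word t * b.rewrite i' j' * word v') := by
        intro X hX
        induction hX using Submodule.span_induction with
        | mem X hX =>
          obtain ⟨x, hx, rfl⟩ := hX
          have h4 := ih (u ++ x ++ (t ++ i' :: j' :: v')) (h1 ▸ hx _ _)
            (u ++ x ++ t) i' j' v' (by simp) hij'
          simpa [word_append, word_cons i' (j' :: v'), word_cons j' v', mul_assoc] using h4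
        | zero => simp
        | add X Y _ _ hX hY => simp only [mul_add, add_mul, map_add, hX, hY]
        | smul c X _ hX => simp only [mul_smul_comm, smul_mul_assoc, map_smul, hX]
      have e2 : ∀ X ∈ Submodule.span ℂ
          (word '' {x | ∀ u v, b.Below (u ++ x ++ v) (u ++ i' :: j' :: v)}),
          L (word u * (word [i] * word [j]) * word t * X * word v') =
            L (word u * b.rewrite i j * word t * X * word v') := by
        intro X hX
        induction hX using Submodule.span_induction with
        | mem X hX =>
          obtain ⟨x, hx, rfl⟩ := hX
          have h4 := ih (u ++ (i :: j :: t) ++ x ++ v') (h2 ▸ hx _ _)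
            u i j (t ++ x ++ v') (by simp) hij
          simpa [word_append, word_cons i (j :: t), word_cons j t, word_cons i (j :: (t ++ (x ++ v'))),
            word_cons j (t ++ (x ++ v')), mul_assoc] using h4
        | zero => simp
        | add X Y _ _ hX hY => simp only [mul_add, add_mul, map_add, hX, hY]
        | smul c X _ hX => simp only [mul_smul_comm, smul_mul_assoc, map_smul, hX]
      have e3 := e1 _ (b.rewrite_mem_span hij)
      have e4 := e2 _ (b.rewrite_mem_span hij')
      rw [← e3] at e4
      simpa [word_append, word_cons i (j :: t), word_cons j t, word_cons i' (j' :: v'),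
        word_cons j' v', mul_assoc] using e4.symm
  intro u i j v h1 hij
  have hw : ¬ b.Normal w := by
    rw [Normal, List.isChain_iff_forall_rel_of_append_cons_cons]
    exact fun h => hij (h h1)
  obtain ⟨u', i', j', v', h1', hij', h2⟩ := hnf w hw
  rw [h2]
  rcases le_total u.length u'.length with h | h
  · exact (key u i j v u' i' j' v' h1 h1' hij hij' h).symm
  · exact key u' i' j' v' u i j v h1' h1 hij' hij h

end Confluence

/-- The Poincaré–Birkhoff–Witt theorem: taking normal forms is a linear map on `U(s)`. -/
theorem exists_envNormalForm : ∃ N : Env s →ₗ[ℂ] WordAlg B,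
    ∀ w, b.Normal w → N (b.mono w) = word w := by
  classical
  obtain ⟨L, hL, hnf⟩ := b.exists_normalForm
  have hconf := confluent hnf
  have hbelow : ∀ w, ∀ X ∈ b.belowSpan w, (∀ x, b.Below x w → ∀ y,
      L (word y * L (word x)) = L (word y * word x)) → ∀ y, L (word y * L X) = L (word y * X) := by
    intro w X hX h y
    induction hX using Submodule.span_induction with
    | mem X hX => obtain ⟨x, hx, rfl⟩ := hX; exact h x hx y
    | zero => simp
    | add X Y _ _ hX hY => simp only [mul_add, map_add, hX, hY]
    | smul c X _ hX => simp only [mul_smul_comm, map_smul, hX]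
  -- `L` may be applied to the right factor of a product first
  have hLL : ∀ w y, L (word y * L (word w)) = L (word y * word w) := by
    intro w
    induction w using b.below_wf.induction with
    | _ w ih =>
    intro y
    by_cases hw : b.Normal w
    · rw [hL w hw]
    · obtain ⟨u, i, j, v, rfl, hij, h1⟩ := hnf w hw
      rw [h1, hbelow _ _ (b.rewrite_mem_belowSpan u v hij) ih y, ← word_append,
        hconf _ (y ++ u) i j v (by simp) hij, word_append]
      simp only [mul_assoc]
  have hspan : ∀ X : WordAlg B, X ∈ Submodule.span ℂ (Set.range (word (B := B))) := by
    intro X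
    have h1 : Set.range (word (B := B)) = Set.range (wordBasis B) := by
      congr 1
      ext w
      rw [wordBasis_apply]
    rw [h1, (wordBasis B).span_eq]
    trivial
  have hLL' : ∀ (z : s.sub) X, L (b.letter z * L X) = L (b.letter z * X) := by
    intro z X
    have hX := hspan X
    induction hX using Submodule.span_induction with
    | mem X hX =>
      obtain ⟨w, rfl⟩ := hX
      have hz : z ∈ Submodule.span ℂ (Set.range b.basis) := by
        rw [b.basis.span_eq]
        trivial
      induction hz using Submodule.span_induction with
      | mem z hz => obtain ⟨a, rfl⟩ := hz; rw [letter_basis]; exact hLL w [a]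
      | zero => simp
      | add z z' _ _ hz hz' => simp only [add_mul, map_add, hz, hz']
      | smul c z _ hz => simp only [smul_mul_assoc, map_smul, hz]
    | zero => simp
    | add X Y _ _ hX hY => simp only [mul_add, map_add, hX, hY]
    | smul c X _ hX => simp only [mul_smul_comm, map_smul, hX]
  -- `U(s)` acts on the free algebra by multiplication from the left followed by `L`; the normal
  -- form of an element of `U(s)` is its value at `1`
  let act : s.sub →ₗ[ℂ] Module.End ℂ (WordAlg B) :=
    (LinearMap.mul ℂ (WordAlg B)).compr₂ L ∘ₗ b.letter
  have hact : ∀ z X, act z X = L (b.letter z * X) := fun z X => rfl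
  let F : Env s →ₐ[ℂ] Module.End ℂ (WordAlg B) := Env.lift act (by
    intro k l x y hx hy
    refine LinearMap.ext fun X => ?_
    have hX := hspan X
    simp only [Module.End.mul_apply, LinearMap.add_apply, LinearMap.smul_apply, hact, hLL',
      ← mul_assoc]
    induction hX using Submodule.span_induction with
    | mem X hX =>
      obtain ⟨w, rfl⟩ := hX
      have h1 := commute_letters (u := []) (v := w) (fun w _ => hconf w) hx hy
      simp only [word_nil, one_mul] at h1
      exact h1
    | zero => simp
    | add X Y _ _ hX hY => simp only [mul_add, map_add, hX, hY, smul_add]; abel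
    | smul c X _ hX => simp only [mul_smul_comm, map_smul, hX, smul_add]; rw [smul_comm c])
  have hF : ∀ z, F (Env.ι s z) = act z := fun z => Env.lift_ι _ _ z
  refine ⟨LinearMap.applyₗ (1 : WordAlg B) ∘ₗ F.toLinearMap, fun w hw => ?_⟩
  have h1 : ∀ w, F (b.mono w) 1 = L (word w) := by
    intro w
    induction w with
    | nil => rw [hL [] List.isChain_nil, mono_nil, map_one F]; rfl
    | cons a w ih =>
      rw [mono_cons, map_mul, Module.End.mul_apply, ih, hF, hact, letter_basis, hLL, ← word_cons]
  exact (h1 w).trans (hL w hw)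

end HomBasis

end PBWIndep

/-! ### Bases of induced modules -/

section RelativePBW

variable {g : Type*} [AddCommGroup g] [Module ℂ g] [LieSuperalgebra g]

namespace HomBasis

variable {s t : SubSuperalgebra g} {B : Type*} (b : HomBasis s B)

/-- The letters in the set `T` are a basis of the subalgebra `t`, and they are greater than all
other letters. -/
structure Adapted (t : SubSuperalgebra g) (T : Set B) : Prop where
  le : t.sub ≤ s.sub
  span_eq : Submodule.span ℂ ((fun i => (b.basis i : g)) '' T) = t.sub
  rank_lt : ∀ i ∉ T, ∀ j ∈ T, b.rank i < b.rank j

variable {b} {T : Set B} (hT : b.Adapted t T)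

include hT in
theorem Adapted.mem_sub {i : B} (hi : i ∈ T) : (b.basis i : g) ∈ t.sub := by
  rw [← hT.span_eq]
  exact Submodule.subset_span ⟨i, hi, rfl⟩

theorem linearIndependent_coe (b : HomBasis s B) :
    LinearIndependent ℂ fun i => (b.basis i : g) :=
  b.basis.linearIndependent.map' s.sub.subtype (Submodule.ker_subtype _)

/-- The homogeneous basis of `t` formed by the letters in `T`. -/
def restrict : HomBasis t T where
  basis := Module.Basis.mk (v := fun i : T => (⟨(b.basis i : g), hT.mem_sub i.2⟩ : t.sub))
    (by
      have h1 := b.linearIndependent_coe.comp ((↑) : T → B) Subtype.val_injective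
      exact LinearIndependent.of_comp t.sub.subtype h1)
    (by
      rintro ⟨x, hx⟩ -
      rw [← hT.span_eq] at hx
      have h1 : ∀ x ∈ Submodule.span ℂ ((fun i => (b.basis i : g)) '' T), ∀ hx : x ∈ t.sub,
          (⟨x, hx⟩ : t.sub) ∈ Submodule.span ℂ
            (Set.range fun i : T => (⟨(b.basis i : g), hT.mem_sub i.2⟩ : t.sub)) := by
        intro x hx
        induction hx using Submodule.span_induction with
        | mem x hx =>
          obtain ⟨i, hi, rfl⟩ := hx
          exact fun _ => Submodule.subset_span ⟨⟨i, hi⟩, rfl⟩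
        | zero => exact fun _ => Submodule.zero_mem _
        | add x y hx hy ihx ihy =>
          rw [hT.span_eq] at hx hy
          exact fun _ => Submodule.add_mem _ (ihx hx) (ihy hy)
        | smul c x hx ihx =>
          rw [hT.span_eq] at hx
          exact fun _ => Submodule.smul_mem _ c (ihx hx)
      exact h1 x hx _)
  parity i := b.parity i
  mem i := by rw [Module.Basis.mk_apply]; exact b.mem i
  rank i := b.rank i
  rank_inj i j h := Subtype.ext (b.rank_inj h)

theorem restrict_basis (i : T) : ((restrict hT).basis i : g) = b.basis i := by
  simp [restrict]

theorem map_ι_restrict (i : T) :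
    Env.map hT.le (Env.ι t ((restrict hT).basis i)) = Env.ι s (b.basis i) := by
  rw [Env.map_ι]
  congr 1
  ext
  exact restrict_basis hT i

theorem map_mono (w : List T) :
    Env.map hT.le ((restrict hT).mono w) = b.mono (w.map (↑)) := by
  induction w with
  | nil => simp
  | cons i w ih => rw [mono_cons, map_mul, ih, map_ι_restrict, List.map_cons, mono_cons]

variable (b T) in
/-- The normal words in the letters outside `T`. -/
abbrev Outer : Type _ := {m : List B // b.Normal m ∧ ∀ i ∈ m, i ∉ T}

theorem normal_append (m : b.Outer T) {w : List T} (hw : (restrict hT).Normal w) :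
    b.Normal (m.1 ++ w.map (↑)) := by
  refine List.isChain_append.2 ⟨m.2.1, ?_, ?_⟩
  · rw [List.isChain_map]
    refine hw.imp fun i j hij => ?_
    rcases hij with h | ⟨rfl, h⟩
    · exact Or.inl h
    · exact Or.inr ⟨rfl, h⟩
  · intro x hx y hy
    refine Or.inl (hT.rank_lt x (m.2.2 x (List.mem_of_mem_getLast? hx)) y ?_)
    have h1 := List.mem_of_mem_head? hy
    rw [List.mem_map] at h1
    obtain ⟨i, _, rfl⟩ := h1
    exact i.2

include hT in
theorem exists_split {w : List B} (hw : b.Normal w) :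
    ∃ (m : b.Outer T) (v : List T), w = m.1 ++ v.map (↑) := by
  induction w with
  | nil => exact ⟨⟨[], List.isChain_nil, by simp⟩, [], rfl⟩
  | cons i w ih =>
    obtain ⟨m, v, rfl⟩ := ih hw.tail
    by_cases hi : i ∈ T
    · refine ⟨⟨[], List.isChain_nil, by simp⟩, ?_⟩
      obtain ⟨m, hm1, hm2⟩ := m
      cases m with
      | nil => exact ⟨⟨i, hi⟩ :: v, rfl⟩
      | cons j m =>
        exfalso
        have hj := hm2 j (by simp)
        have h1 := hT.rank_lt j hj i hi
        have h2 : b.Good i j := (List.isChain_cons_cons.1 hw).1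
        rcases h2 with h2 | ⟨rfl, -⟩
        · omega
        · exact hj hi
    · refine ⟨⟨i :: m.1, ?_, ?_⟩, v, rfl⟩
      · exact List.IsChain.left_of_append (l₁ := i :: m.1) (l₂ := v.map ((↑) : T → B)) hw
      · intro j hj
        rcases List.mem_cons.1 hj with rfl | hj
        · exact hi
        · exact m.2.2 j hj

include hT in
/-- `U(s)` is spanned by the products of normal words outside `t` with elements of `U(t)`. -/
theorem span_outer : Submodule.span ℂ
    {u | ∃ (m : b.Outer T) (q : Env t), u = b.mono m.1 * Env.map hT.le q} = ⊤ := by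
  rw [eq_top_iff, ← b.span_normal, Submodule.span_le]
  rintro _ ⟨w, hw, rfl⟩
  obtain ⟨m, v, rfl⟩ := exists_split hT hw
  refine Submodule.subset_span ⟨m, (restrict hT).mono v, ?_⟩
  rw [map_mono, mono_append]

variable {V : Type*} [AddCommGroup V] [Module ℂ V]

/-- If `N` is `t`-stable, then the `s`-submodule generated by `N` is spanned by the products of
normal words outside `t` with elements of `N`. -/
theorem gen_eq_span (σ : SuperRep s V) {N : Submodule ℂ V} (hN : (σ.res hT.le).IsStable N) :
    σ.gen N = Submodule.span ℂ
      {z | ∃ (m : b.Outer T) (n : V), n ∈ N ∧ z = σ.envHom (b.mono m.1) n} := by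
  refine le_antisymm (Submodule.span_le.2 ?_) (Submodule.span_le.2 ?_)
  · rintro _ ⟨u, n, hn, rfl⟩
    have hu : u ∈ Submodule.span ℂ
        {u | ∃ (m : b.Outer T) (q : Env t), u = b.mono m.1 * Env.map hT.le q} := by
      rw [span_outer hT]
      trivial
    induction hu using Submodule.span_induction with
    | mem u hu =>
      obtain ⟨m, q, rfl⟩ := hu
      refine Submodule.subset_span ⟨m, _, hN.envHom_mem q hn, ?_⟩
      rw [map_mul, Module.End.mul_apply, SuperRep.envHom_map]
    | zero => simp
    | add u v _ _ hu hv => rw [map_add]; exact Submodule.add_mem _ hu hv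
    | smul c u _ hu => rw [map_smul]; exact Submodule.smul_mem _ c hu
  · rintro _ ⟨m, n, hn, rfl⟩
    exact Submodule.subset_span ⟨_, n, hn, rfl⟩

/-- The free half of the Poincaré–Birkhoff–Witt theorem for an induced module: products of
distinct normal words outside `t` with vectors of `V` are independent. -/
theorem ind_independent (ρ : SuperRep t V) (f : b.Outer T →₀ V)
    (hf : (f.sum fun m v => (indRep hT.le ρ).envHom (b.mono m.1) (indOf hT.le ρ v)) = 0) :
    f = 0 := by
  classical
  obtain ⟨N, hN⟩ := b.exists_envNormalForm
  -- `Ψ` reads off the part of a word outside `t` and lets the rest of the word act on `V`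
  let inner : List B → Env t := fun w =>
    (w.map fun i => if h : i ∈ T then Env.ι t ((restrict hT).basis ⟨i, h⟩) else 0).prod
  have hinner : ∀ w : List T, inner (w.map (↑)) = (restrict hT).mono w := by
    intro w
    simp only [inner, mono, List.map_map]
    congr 1
    exact List.map_congr_left fun i _ => dif_pos i.2
  let Ψ : WordAlg B →ₗ[ℂ] V →ₗ[ℂ] (List B →₀ V) := (wordBasis B).constr ℂ fun w =>
    Finsupp.lsingle (w.takeWhile fun i => decide (i ∉ T)) ∘ₗ
      ρ.envHom (inner (w.dropWhile fun i => decide (i ∉ T)))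
  have hΨ : ∀ (m : b.Outer T) (w : List T) (v : V), Ψ (word (m.1 ++ w.map (↑))) v =
      Finsupp.single m.1 (ρ.envHom ((restrict hT).mono w) v) := by
    intro m w v
    have hm : ∀ i ∈ m.1, decide (i ∉ T) = true := fun i hi => by simpa using m.2.2 i hi
    have h1 : (w.map ((↑) : T → B)).takeWhile (fun i => decide (i ∉ T)) = [] := by
      cases w with
      | nil => rfl
      | cons i w => simp
    have h2 : (w.map ((↑) : T → B)).dropWhile (fun i => decide (i ∉ T)) = w.map (↑) := by
      cases w with
      | nil => rfl
      | cons i w => simp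
    rw [← wordBasis_apply, Module.Basis.constr_basis, List.takeWhile_append_of_pos hm,
      List.dropWhile_append_of_pos hm, h1, h2, hinner, List.append_nil]
    rfl
  have hA : ∀ (m : b.Outer T) (q : Env t) (v : V), Ψ (N (b.mono m.1 * Env.map hT.le q)) v =
      Finsupp.single m.1 (ρ.envHom q v) := by
    intro m q v
    have hq : q ∈ Submodule.span ℂ ((restrict hT).mono '' {w | (restrict hT).Normal w}) := by
      rw [(restrict hT).span_normal]
      trivial
    induction hq using Submodule.span_induction with
    | mem q hq =>
      obtain ⟨w, hw, rfl⟩ := hq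
      rw [map_mono, ← mono_append, hN _ (normal_append hT m hw), hΨ]
    | zero => simp
    | add q q' _ _ h h' =>
      simp only [map_add, mul_add, LinearMap.add_apply, h, h', Finsupp.single_add]
    | smul c q _ h =>
      simp only [map_smul, mul_smul_comm, LinearMap.smul_apply, h, Finsupp.smul_single]
  let Θ : Env s ⊗[ℂ] V →ₗ[ℂ] (List B →₀ V) := TensorProduct.lift (Ψ ∘ₗ N)
  have hΘ : ∀ u v, Θ (u ⊗ₜ v) = Ψ (N u) v := fun u v => rfl
  have hker : ∀ z ∈ indRel hT.le ρ, ∀ u : Env s, Θ (u • z) = 0 := by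
    intro z hz
    induction hz using Submodule.span_induction with
    | mem z hz =>
      obtain ⟨x, v, rfl⟩ := hz
      intro u
      have hu : u ∈ Submodule.span ℂ
          {u | ∃ (m : b.Outer T) (q : Env t), u = b.mono m.1 * Env.map hT.le q} := by
        rw [span_outer hT]
        trivial
      induction hu using Submodule.span_induction with
      | mem u hu =>
        obtain ⟨m, q, rfl⟩ := hu
        rw [smul_sub, TensorProduct.smul_tmul', TensorProduct.smul_tmul', map_sub, hΘ, hΘ,
          smul_eq_mul, smul_eq_mul, mul_one, mul_assoc, ← Env.map_ι hT.le, ← map_mul, hA, hA]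
        simp
      | zero => simp
      | add u v _ _ hu hv => rw [add_smul, map_add, hu, hv, add_zero]
      | smul c u _ hu => rw [smul_assoc, map_smul, hu, smul_zero]
    | zero => simp
    | add a c _ _ ha hc => intro u; rw [smul_add, map_add, ha, hc, add_zero]
    | smul u' a _ ha => intro u; rw [← mul_smul, ha]
  have h0 : (indRel hT.le ρ).mkQ (f.sum fun m v => b.mono m.1 ⊗ₜ[ℂ] v) = 0 := by
    rw [← hf, Finsupp.sum, Finsupp.sum, map_sum]
    exact Finset.sum_congr rfl fun m _ => mkQ_tmul _ _ _ _
  rw [Submodule.mkQ_apply, Submodule.Quotient.mk_eq_zero] at h0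
  have h1 := hker _ h0 1
  rw [one_smul, Finsupp.sum, map_sum] at h1
  have h2 : ∀ m : b.Outer T, ∀ v, Θ (b.mono m.1 ⊗ₜ v) = Finsupp.single m.1 v := by
    intro m v
    have := hA m 1 v
    rwa [map_one, mul_one, map_one] at this
  simp only [h2] at h1
  have h3 : Finsupp.mapDomain Subtype.val f = 0 := h1
  exact Finsupp.mapDomain_injective Subtype.val_injective (h3.trans Finsupp.mapDomain_zero.symm)

end HomBasis

end RelativePBW

/-! ### Bases adapted to a parabolic subalgebra -/

section Frames

variable {g : Type*} [AddCommGroup g] [Module ℂ g] [LieSuperalgebra g]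

/-- A homogeneous basis of a subalgebra, from an independent family of homogeneous elements. -/
def HomBasis.ofFamily (s : SubSuperalgebra g) {B : Type*} (v : B → g) (hv : LinearIndependent ℂ v)
    (hs : Submodule.span ℂ (Set.range v) = s.sub) (parity : B → ZMod 2)
    (mem : ∀ i, v i ∈ par (parity i)) (rank : B → ℕ) (rank_inj : Function.Injective rank) :
    HomBasis s B where
  basis := (Module.Basis.span hv).map (LinearEquiv.ofEq _ _ hs)
  parity := parity
  mem i := by simpa [Module.Basis.span_apply] using mem i
  rank := rank
  rank_inj := rank_inj

theorem HomBasis.ofFamily_basis (s : SubSuperalgebra g) {B : Type*} (v : B → g)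
    (hv : LinearIndependent ℂ v) (hs : Submodule.span ℂ (Set.range v) = s.sub)
    (parity : B → ZMod 2) (mem : ∀ i, v i ∈ par (parity i)) (rank : B → ℕ)
    (rank_inj : Function.Injective rank) (i : B) :
    ((HomBasis.ofFamily s v hv hs parity mem rank rank_inj).basis i : g) = v i := by
  simp [ofFamily, Module.Basis.span_apply]

/-- A basis of a subspace `U`, extended to a basis of a subspace `T` that contains it. -/
theorem exists_basis_of_le {V : Type*} [AddCommGroup V] [Module ℂ V] [FiniteDimensional ℂ V]
    {U T : Submodule ℂ V} (h : U ≤ T) : ∃ (m n : ℕ) (v : Fin m → V) (u : Fin n → V),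
      LinearIndependent ℂ (Sum.elim v u) ∧ Submodule.span ℂ (Set.range u) = U ∧
      Submodule.span ℂ (Set.range (Sum.elim v u)) = T := by
  obtain ⟨C, hC⟩ := exists_isCompl U
  have hmod : C ⊓ T ⊔ U = T := by
    rw [sup_comm, ← sup_inf_assoc_of_le C h, hC.sup_eq_top, top_inf_eq]
  let bC := Module.finBasis ℂ (C ⊓ T : Submodule ℂ V)
  let bU := Module.finBasis ℂ U
  have hv := bC.linearIndependent.map' (C ⊓ T).subtype (Submodule.ker_subtype _)
  have hu := bU.linearIndependent.map' U.subtype (Submodule.ker_subtype _)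
  have sv : Submodule.span ℂ (Set.range ((C ⊓ T).subtype ∘ bC)) = C ⊓ T := by
    rw [Set.range_comp, Submodule.span_image, bC.span_eq, Submodule.map_subtype_top]
  have su : Submodule.span ℂ (Set.range (U.subtype ∘ bU)) = U := by
    rw [Set.range_comp, Submodule.span_image, bU.span_eq, Submodule.map_subtype_top]
  refine ⟨_, _, (C ⊓ T).subtype ∘ bC, U.subtype ∘ bU, hv.sum_type hu ?_, su, ?_⟩
  · rw [sv, su]
    exact hC.symm.disjoint.mono_left inf_le_left
  · rw [Set.Sum.elim_range, Submodule.span_union, sv, su, hmod]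

/-- The four blocks of letters: a complement of the even part of a parabolic subalgebra `p`, the
even part of `p`, a complement of the odd part of `p`, the odd part of `p`. -/
abbrev Letters (k l m n : ℕ) : Type := (Fin k ⊕ Fin l) ⊕ (Fin m ⊕ Fin n)

/-- The order of the letters: first the even ones outside `p`, then the odd ones outside `p`,
then those of `p`. -/
def letterRank {k l m n : ℕ} : Letters k l m n → ℕ
  | Sum.inl (Sum.inl i) => i
  | Sum.inl (Sum.inr i) => k + m + i
  | Sum.inr (Sum.inl i) => k + i
  | Sum.inr (Sum.inr i) => k + m + l + i

theorem letterRank_injective {k l m n : ℕ} :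
    Function.Injective (letterRank (k := k) (l := l) (m := m) (n := n)) := by
  rintro ((⟨i, hi⟩ | ⟨i, hi⟩) | (⟨i, hi⟩ | ⟨i, hi⟩)) ((⟨j, hj⟩ | ⟨j, hj⟩) | (⟨j, hj⟩ | ⟨j, hj⟩)) h <;>
    simp only [letterRank] at h <;>
    first
    | (exfalso; omega)
    | (obtain rfl : i = j := by omega
       rfl)

/-- The letters of the parabolic subalgebra. -/
def parLetters (k l m n : ℕ) : Set (Letters k l m n) :=
  {i | (∃ j, i = Sum.inl (Sum.inr j)) ∨ ∃ j, i = Sum.inr (Sum.inr j)}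

/-- Compatible homogeneous bases of `g` and of its even part, adapted to a parabolic
subalgebra `p` and its even part. -/
structure Frame (p p₀ : SubSuperalgebra g) (k l m n : ℕ) where
  all : HomBasis (SubSuperalgebra.whole g) (Letters k l m n)
  even : HomBasis (SubSuperalgebra.even g) (Fin k ⊕ Fin l)
  basis_inl : ∀ i, (even.basis i : g) = all.basis (Sum.inl i)
  parity_inl : ∀ i, all.parity (Sum.inl i) = 0
  parity_inr : ∀ i, all.parity (Sum.inr i) = 1
  rank_all : all.rank = letterRank
  rank_even : ∀ i, even.rank i = all.rank (Sum.inl i)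
  adapted : all.Adapted p (parLetters k l m n)
  adapted_even : even.Adapted p₀ (Set.range Sum.inr)

/-- Every subalgebra `p` has adapted bases; the number of odd letters outside `p` is the
dimension of the odd part of `g / p`. -/
theorem exists_frame [FiniteDimensional ℂ g] (p : SubSuperalgebra g) :
    ∃ k l m n : ℕ, Nonempty (Frame p (p.inter (SubSuperalgebra.even g)) k l m n) ∧
      Module.finrank ℂ ((par (g := g) 1).map p.sub.mkQ) = m := by
  obtain ⟨k, l, y, q, hyq, hq, hy⟩ := exists_basis_of_le (U := p.sub ⊓ par 0) (T := par 0)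
    inf_le_right
  obtain ⟨m, n, x, r, hxr, hr, hx⟩ := exists_basis_of_le (U := p.sub ⊓ par 1) (T := par 1)
    inf_le_right
  have hdisj : Disjoint (par (g := g) 0) (par 1) :=
    par_internal.submodule_iSupIndep.pairwiseDisjoint (by decide : (0 : ZMod 2) ≠ 1)
  have htop : (par (g := g) 0) ⊔ par 1 = ⊤ := by
    rw [← par_internal.submodule_iSup_eq_top]
    refine le_antisymm (sup_le (le_iSup _ _) (le_iSup _ _)) (iSup_le fun i => ?_)
    rcases zmod_two_cases i with rfl | rfl
    · exact le_sup_left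
    · exact le_sup_right
  have hpp : p.sub ⊓ par 0 ⊔ p.sub ⊓ par 1 = p.sub := by
    refine le_antisymm (sup_le inf_le_left inf_le_left) (p.graded.trans (iSup_le fun i => ?_))
    rcases zmod_two_cases i with rfl | rfl
    · exact le_sup_left
    · exact le_sup_right
  let v : Letters k l m n → g := Sum.elim (Sum.elim y q) (Sum.elim x r)
  have hv : LinearIndependent ℂ v := hyq.sum_type hxr (by rwa [hy, hx])
  have hspan : Submodule.span ℂ (Set.range v) = (SubSuperalgebra.whole g).sub := by
    rw [Set.Sum.elim_range, Submodule.span_union, hy, hx, htop]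
    rfl
  have hy0 : ∀ i, Sum.elim y q i ∈ par (g := g) 0 := fun i => by
    rw [← hy]
    exact Submodule.subset_span ⟨i, rfl⟩
  have hx1 : ∀ i, Sum.elim x r i ∈ par (g := g) 1 := fun i => by
    rw [← hx]
    exact Submodule.subset_span ⟨i, rfl⟩
  let all := HomBasis.ofFamily (SubSuperalgebra.whole g) v hv hspan
    (Sum.elim (fun _ => 0) fun _ => 1) (by rintro (i | i); exacts [hy0 i, hx1 i])
    letterRank letterRank_injective
  let even := HomBasis.ofFamily (SubSuperalgebra.even g) (Sum.elim y q) hyq hy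
    (fun _ => 0) hy0 (fun i => letterRank (m := m) (n := n) (Sum.inl i))
    (fun i j h => Sum.inl_injective (letterRank_injective h))
  have hall : ∀ i, (all.basis i : g) = v i := HomBasis.ofFamily_basis _ _ _ _ _ _ _ _
  have heven : ∀ i, (even.basis i : g) = Sum.elim y q i :=
    HomBasis.ofFamily_basis _ _ _ _ _ _ _ _
  refine ⟨k, l, m, n, ⟨⟨all, even, fun i => ?_, fun i => rfl, fun i => rfl, rfl, fun i => rfl,
    ⟨le_top, ?_, ?_⟩, ⟨inf_le_right, ?_, ?_⟩⟩⟩, ?_⟩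
  · rw [hall, heven]
    rfl
  · simp only [hall]
    have h1 : v '' parLetters k l m n = Set.range q ∪ Set.range r := by
      ext z
      constructor
      · rintro ⟨_, ⟨j, rfl⟩ | ⟨j, rfl⟩, rfl⟩
        · exact Or.inl ⟨j, rfl⟩
        · exact Or.inr ⟨j, rfl⟩
      · rintro (⟨j, rfl⟩ | ⟨j, rfl⟩)
        · exact ⟨_, Or.inl ⟨j, rfl⟩, rfl⟩
        · exact ⟨_, Or.inr ⟨j, rfl⟩, rfl⟩
    rw [h1, Submodule.span_union, hq, hr, hpp]
  · intro i hi j hj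
    change letterRank i < letterRank j
    rcases i with (i | i) | (i | i)
    · rcases hj with ⟨j, rfl⟩ | ⟨j, rfl⟩ <;> simp only [letterRank] <;> omega
    · exact absurd (Or.inl ⟨i, rfl⟩) hi
    · rcases hj with ⟨j, rfl⟩ | ⟨j, rfl⟩ <;> simp only [letterRank] <;> omega
    · exact absurd (Or.inr ⟨i, rfl⟩) hi
  · simp only [heven]
    rw [← Set.range_comp]
    exact hq
  · intro i hi j hj
    obtain ⟨j, rfl⟩ := hj
    rcases i with i | i
    · change letterRank (l := l) (m := m) (n := n) (Sum.inl (Sum.inl i)) <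
        letterRank (m := m) (n := n) (Sum.inl (Sum.inr j))
      simp only [letterRank]
      omega
    · exact absurd ⟨i, rfl⟩ hi
  · have h1 : Module.finrank ℂ (par (g := g) 1) = m + n := by
      rw [← hx, finrank_span_eq_card hxr]
      simp
    have hr' : LinearIndependent ℂ r := by
      have := hxr.comp Sum.inr Sum.inr_injective
      exact this
    have h2 : Module.finrank ℂ (p.sub ⊓ par 1 : Submodule ℂ g) = n := by
      rw [← hr, finrank_span_eq_card hr']
      simp
    have h3 := (p.sub.mkQ.domRestrict (par 1)).finrank_range_add_finrank_ker
    rw [LinearMap.range_domRestrict, h1] at h3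
    have h4 : Module.finrank ℂ (LinearMap.ker (p.sub.mkQ.domRestrict (par 1))) = n := by
      rw [← h2, LinearMap.ker_domRestrict, Submodule.ker_mkQ, inf_comm,
        ← Submodule.map_comap_subtype, Submodule.finrank_map_subtype_eq]
    omega

end Frames

/-! ### Induced modules over the even part -/

section EvenStructure

variable {g : Type*} [AddCommGroup g] [Module ℂ g] [LieSuperalgebra g]

/-- The span of the products of normal words outside a subalgebra with elements of a subspace
of a module. -/
def outerSpan {s : SubSuperalgebra g} {B : Type*} (b : HomBasis s B) (T : Set B)
    {M : Type*} [AddCommGroup M] [Module ℂ M] (σ : SuperRep s M) (N : Submodule ℂ M) :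
    Submodule ℂ M :=
  Submodule.span ℂ {z | ∃ (m : b.Outer T) (n : M), n ∈ N ∧ z = σ.envHom (b.mono m.1) n}

section OuterSpan

variable {s : SubSuperalgebra g} {B : Type*} {b : HomBasis s B} {T : Set B}
    {M : Type*} [AddCommGroup M] [Module ℂ M] {σ : SuperRep s M}

theorem outerSpan_mono {N N' : Submodule ℂ M} (h : N ≤ N') :
    outerSpan b T σ N ≤ outerSpan b T σ N' :=
  Submodule.span_mono fun _ ⟨m, n, hn, hz⟩ => ⟨m, n, h hn, hz⟩

theorem le_outerSpan (N : Submodule ℂ M) : N ≤ outerSpan b T σ N := fun n hn =>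
  Submodule.subset_span ⟨⟨[], List.isChain_nil, by simp⟩, n, hn, by simp⟩

theorem outerSpan_le {N K : Submodule ℂ M} (hK : σ.IsStable K) (h : N ≤ K) :
    outerSpan b T σ N ≤ K := by
  refine Submodule.span_le.2 ?_
  rintro _ ⟨m, n, hn, rfl⟩
  exact hK.envHom_mem _ (h hn)

theorem outerSpan_sup (N N' : Submodule ℂ M) :
    outerSpan b T σ (N ⊔ N') = outerSpan b T σ N ⊔ outerSpan b T σ N' := by
  refine le_antisymm (Submodule.span_le.2 ?_)
    (sup_le (outerSpan_mono le_sup_left) (outerSpan_mono le_sup_right))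
  rintro _ ⟨m, n, hn, rfl⟩
  obtain ⟨a, ha, c, hc, rfl⟩ := Submodule.mem_sup.1 hn
  rw [map_add]
  exact Submodule.add_mem_sup (Submodule.subset_span ⟨m, a, ha, rfl⟩)
    (Submodule.subset_span ⟨m, c, hc, rfl⟩)

theorem outerSpan_bot : outerSpan b T σ ⊥ = ⊥ := by
  rw [eq_bot_iff]
  refine Submodule.span_le.2 ?_
  rintro _ ⟨m, n, hn, rfl⟩
  rw [(Submodule.mem_bot ℂ).1 hn, map_zero]
  exact Submodule.zero_mem _

theorem exists_finsupp_of_mem_outerSpan {N : Submodule ℂ M} {z : M}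
    (hz : z ∈ outerSpan b T σ N) : ∃ f : b.Outer T →₀ M, (∀ m, f m ∈ N) ∧
      (f.sum fun m v => σ.envHom (b.mono m.1) v) = z := by
  classical
  induction hz using Submodule.span_induction with
  | mem z hz =>
    obtain ⟨m, n, hn, rfl⟩ := hz
    refine ⟨Finsupp.single m n, fun m' => ?_, by simp⟩
    rw [Finsupp.single_apply]
    split_ifs
    · exact hn
    · exact N.zero_mem
  | zero => exact ⟨0, fun _ => N.zero_mem, by simp⟩
  | add y z _ _ hy hz =>
    obtain ⟨f, hf, rfl⟩ := hy
    obtain ⟨f', hf', rfl⟩ := hz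
    refine ⟨f + f', fun m => N.add_mem (hf m) (hf' m), ?_⟩
    rw [Finsupp.sum_add_index (by simp) (by simp)]
  | smul c z _ hz =>
    obtain ⟨f, hf, rfl⟩ := hz
    refine ⟨c • f, fun m => N.smul_mem c (hf m), ?_⟩
    rw [Finsupp.sum_smul_index' (by simp), Finsupp.smul_sum]
    simp

end OuterSpan

section Whole

variable {M : Type*} [AddCommGroup M] [Module ℂ M] (σ : SuperRep (SubSuperalgebra.whole g) M)

/-- The action of the elements of `g` in a `g`-module. -/
def SuperRep.wholeAct : g →ₗ[ℂ] Module.End ℂ M :=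
  σ.act ∘ₗ LinearMap.codRestrict (SubSuperalgebra.whole g).sub LinearMap.id fun _ => trivial

theorem SuperRep.act_eq_wholeAct (x : (SubSuperalgebra.whole g).sub) :
    σ.act x = σ.wholeAct (x : g) := rfl

theorem SuperRep.res_act_eq_wholeAct (s : SubSuperalgebra g)
    (h : s.sub ≤ (SubSuperalgebra.whole g).sub) (x : s.sub) :
    (σ.res h).act x = σ.wholeAct (x : g) := rfl

theorem SuperRep.wholeAct_wholeAct {i j : ZMod 2} {x y : g} (hx : x ∈ par i) (hy : y ∈ par j)
    (v : M) : σ.wholeAct x (σ.wholeAct y v) = superSign i j • σ.wholeAct y (σ.wholeAct x v) +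
      σ.wholeAct (br x y) v :=
  σ.act_act ⟨x, trivial⟩ ⟨y, trivial⟩ hx hy v

end Whole

variable {p p₀ : SubSuperalgebra g} {k l m n : ℕ} (Φ : Frame p p₀ k l m n)
  {W : Type*} [AddCommGroup W] [Module ℂ W] (ρ : SuperRep p W)

namespace Frame

/-- The induced module `U(g) ⊗_{U(p)} W`. -/
abbrev Mod : Type _ := Ind Φ.adapted.le ρ

/-- The action of `g` on the induced module. -/
abbrev rep : SuperRep (SubSuperalgebra.whole g) (Φ.Mod ρ) := indRep Φ.adapted.le ρ

/-- The action of the even part of `g` on the induced module. -/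
abbrev rep₀ : SuperRep (SubSuperalgebra.even g) (Φ.Mod ρ) := (Φ.rep ρ).res (GradedDatum.le_whole _)

/-- The vector of the induced module given by a word in the odd letters outside `p` and a
vector of `W`. -/
def oddVec (w : List (Fin m)) (v : W) : Φ.Mod ρ :=
  (Φ.rep ρ).envHom (Φ.all.mono (w.map fun i => Sum.inr (Sum.inl i))) (indOf Φ.adapted.le ρ v)

/-- The span of the vectors given by products of at most `j` distinct odd letters, in increasing
order, and vectors of `W`. -/
def ext (j : ℕ) : Submodule ℂ (Φ.Mod ρ) :=
  Submodule.span ℂ {z | ∃ (S : Finset (Fin m)) (v : W), S.card ≤ j ∧ z = Φ.oddVec ρ S.sort v}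

/-- The span of all products of at most `j` odd elements of `g` and vectors of `W`. -/
def oddFil : ℕ → Submodule ℂ (Φ.Mod ρ)
  | 0 => LinearMap.range (indOf Φ.adapted.le ρ)
  | j + 1 => oddFil j ⊔ Submodule.span ℂ
      {z | ∃ (x : g) (n : Φ.Mod ρ), x ∈ par 1 ∧ n ∈ oddFil j ∧ z = (Φ.rep ρ).wholeAct x n}

/-- The submodule over the even part generated by `oddFil j`. -/
def evFil (j : ℕ) : Submodule ℂ (Φ.Mod ρ) := (Φ.rep₀ ρ).gen (Φ.oddFil ρ j)

/-- The filtration `evFil` shifted by one, starting from zero. -/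
def evFilPred : ℕ → Submodule ℂ (Φ.Mod ρ)
  | 0 => ⊥
  | j + 1 => Φ.evFil ρ j

variable {Φ ρ}

theorem oddFil_le_succ (j : ℕ) : Φ.oddFil ρ j ≤ Φ.oddFil ρ (j + 1) := le_sup_left

theorem oddFil_mono : Monotone (Φ.oddFil ρ) := monotone_nat_of_le_succ oddFil_le_succ

theorem evFil_mono : Monotone (Φ.evFil ρ) := fun _ _ h => (Φ.rep₀ ρ).gen_mono (oddFil_mono h)

theorem oddFil_le_evFil (j : ℕ) : Φ.oddFil ρ j ≤ Φ.evFil ρ j := (Φ.rep₀ ρ).le_gen _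

theorem evFil_stable (j : ℕ) : (Φ.rep₀ ρ).IsStable (Φ.evFil ρ j) := (Φ.rep₀ ρ).gen_stable _

theorem act_odd_mem_oddFil {j : ℕ} {x : g} (hx : x ∈ par 1)
    {v : Φ.Mod ρ} (hv : v ∈ Φ.oddFil ρ j) : (Φ.rep ρ).wholeAct x v ∈ Φ.oddFil ρ (j + 1) :=
  Submodule.mem_sup_right (Submodule.subset_span ⟨x, v, hx, hv, rfl⟩)

theorem act_even_mem_evFil {j : ℕ} {x : g} (hx : x ∈ par 0)
    {v : Φ.Mod ρ} (hv : v ∈ Φ.evFil ρ j) : (Φ.rep ρ).wholeAct x v ∈ Φ.evFil ρ j := by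
  have hx' : x ∈ (SubSuperalgebra.even g).sub := hx
  exact evFil_stable j ⟨x, hx'⟩ v hv

/-- Moving an element of the even part of `p` past the odd factors of a product produces only
products with as many odd factors. -/
theorem oddFil_stable (hp₀ : p₀.sub ≤ p.sub ⊓ par 0) (j : ℕ) (x : g)
    (hx : x ∈ p₀.sub) {v : Φ.Mod ρ} (hv : v ∈ Φ.oddFil ρ j) :
    (Φ.rep ρ).wholeAct x v ∈ Φ.oddFil ρ j := by
  induction j generalizing x v with
  | zero =>
    obtain ⟨w, rfl⟩ := hv
    refine ⟨ρ.act ⟨x, (hp₀ hx).1⟩ w, ?_⟩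
    rw [indOf_act]
    rfl
  | succ j ih =>
    obtain ⟨a, ha, c, hc, rfl⟩ := Submodule.mem_sup.1 hv
    rw [map_add]
    refine Submodule.add_mem _ (oddFil_le_succ j (ih x hx ha)) ?_
    clear ha hv
    induction hc using Submodule.span_induction with
    | mem z hz =>
      obtain ⟨y, u, hy, hu, rfl⟩ := hz
      rw [(Φ.rep ρ).wholeAct_wholeAct (hp₀ hx).2 hy, superSign_zero_left, one_smul]
      refine Submodule.add_mem _ (act_odd_mem_oddFil hy (ih x hx hu)) (act_odd_mem_oddFil ?_ hu)
      simpa using br_mem (hp₀ hx).2 hy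
    | zero => simp
    | add y z _ _ hy hz => rw [map_add]; exact Submodule.add_mem _ hy hz
    | smul c z _ hz => rw [map_smul]; exact Submodule.smul_mem _ c hz

/-- An odd element supercommutes with the even part up to odd elements, so it raises the degree
by at most one. -/
theorem act_odd_mem_evFil {j : ℕ} {x : g} (hx : x ∈ par 1)
    {v : Φ.Mod ρ} (hv : v ∈ Φ.evFil ρ j) : (Φ.rep ρ).wholeAct x v ∈ Φ.evFil ρ (j + 1) := by
  let K : Submodule ℂ (Φ.Mod ρ) :=
    { carrier := {v | v ∈ Φ.evFil ρ (j + 1) ∧ ∀ x : g,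
        x ∈ par 1 → (Φ.rep ρ).wholeAct x v ∈ Φ.evFil ρ (j + 1)}
      add_mem' := fun ha hc => ⟨Submodule.add_mem _ ha.1 hc.1, fun x hx => by
        rw [map_add]
        exact Submodule.add_mem _ (ha.2 x hx) (hc.2 x hx)⟩
      zero_mem' := ⟨Submodule.zero_mem _, fun x _ => by rw [map_zero]; exact Submodule.zero_mem _⟩
      smul_mem' := fun c v hv => ⟨Submodule.smul_mem _ c hv.1, fun x hx => by
        rw [map_smul]
        exact Submodule.smul_mem _ c (hv.2 x hx)⟩ }
  have hK : (Φ.rep₀ ρ).IsStable K := by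
    intro y v hv
    refine ⟨evFil_stable _ y v hv.1, fun x hx => ?_⟩
    have hy : (y : g) ∈ par 0 := y.2
    rw [SuperRep.res_act_eq_wholeAct, (Φ.rep ρ).wholeAct_wholeAct hx hy, superSign_zero_right,
      one_smul]
    refine Submodule.add_mem _ (evFil_stable _ y _ (hv.2 x hx)) (hv.2 _ ?_)
    simpa using br_mem hx hy
  have h1 : Φ.evFil ρ j ≤ K := SuperRep.gen_le hK fun v hv =>
    ⟨oddFil_le_evFil _ (oddFil_le_succ j hv), fun x hx =>
      oddFil_le_evFil _ (act_odd_mem_oddFil hx hv)⟩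
  exact (h1 hv).2 x hx

/-- The filtration `evFil` is exhaustive. -/
theorem exists_mem_evFil (v : Φ.Mod ρ) : ∃ j, v ∈ Φ.evFil ρ j := by
  let K : Submodule ℂ (Φ.Mod ρ) := ⨆ j, Φ.evFil ρ j
  have hdir : Directed (· ≤ ·) (Φ.evFil ρ) := evFil_mono.directed_le
  have hmem : ∀ v, v ∈ K ↔ ∃ j, v ∈ Φ.evFil ρ j := fun v => Submodule.mem_iSup_of_directed _ hdir
  have hK : (Φ.rep ρ).IsStable K := by
    intro x v hv
    obtain ⟨j, hj⟩ := (hmem v).1 hv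
    rw [SuperRep.act_eq_wholeAct]
    generalize (x : g) = x
    have hx : x ∈ ⨆ i, par (g := g) i := by
      rw [par_internal.submodule_iSup_eq_top]
      trivial
    rw [hmem]
    refine ⟨j + 1, ?_⟩
    induction hx using Submodule.iSup_induction' with
    | mem i x hx =>
      rcases zmod_two_cases i with rfl | rfl
      · exact evFil_mono (Nat.le_succ j) (act_even_mem_evFil hx hj)
      · exact act_odd_mem_evFil hx hj
    | zero => simp
    | add x y _ _ hx hy =>
      rw [map_add, LinearMap.add_apply]
      exact Submodule.add_mem _ hx hy
  have h1 := SuperRep.gen_le (N := LinearMap.range (indOf Φ.adapted.le ρ)) hK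
    ((oddFil_le_evFil 0).trans (le_iSup (Φ.evFil ρ) 0))
  rw [ind_gen_range] at h1
  exact (hmem v).1 (h1 trivial)

@[simp] theorem oddVec_nil (v : W) : Φ.oddVec ρ [] v = indOf Φ.adapted.le ρ v := by
  simp [oddVec]

@[simp] theorem oddVec_cons (i : Fin m) (w : List (Fin m)) (v : W) : Φ.oddVec ρ (i :: w) v =
    (Φ.rep ρ).wholeAct (Φ.all.basis (Sum.inr (Sum.inl i))) (Φ.oddVec ρ w v) := by
  simp [oddVec, SuperRep.act_eq_wholeAct]

theorem odd_letter (i : Fin m ⊕ Fin n) : (Φ.all.basis (Sum.inr i) : g) ∈ par 1 := by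
  rw [← Φ.parity_inr i]
  exact Φ.all.mem _

theorem oddVec_mem_oddFil (w : List (Fin m)) (v : W) : Φ.oddVec ρ w v ∈ Φ.oddFil ρ w.length := by
  induction w with
  | nil => exact ⟨v, (oddVec_nil v).symm⟩
  | cons i w ih =>
    rw [oddVec_cons]
    exact act_odd_mem_oddFil (odd_letter _) ih

/-- An odd element of `p` does not raise the degree: moved past the odd letters it produces even
elements, and it finally acts on `W`. -/
theorem act_odd_oddVec_mem (x : g) (hx : x ∈ par 1)
    (hxp : x ∈ p.sub) (w : List (Fin m)) (v : W) :
    (Φ.rep ρ).wholeAct x (Φ.oddVec ρ w v) ∈ Φ.evFil ρ w.length := by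
  induction w with
  | nil =>
    refine oddFil_le_evFil 0 ⟨ρ.act ⟨x, hxp⟩ v, ?_⟩
    rw [indOf_act, oddVec_nil]
    rfl
  | cons i w ih =>
    rw [oddVec_cons, (Φ.rep ρ).wholeAct_wholeAct hx (odd_letter _)]
    refine Submodule.add_mem _ (Submodule.smul_mem _ _ (act_odd_mem_evFil (odd_letter _) ih)) ?_
    refine act_even_mem_evFil ?_ (oddFil_le_evFil _ (oddFil_le_succ _ (oddVec_mem_oddFil w v)))
    simpa [CharTwo.add_self_eq_zero] using br_mem hx (odd_letter (Φ := Φ) (Sum.inl i))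

end Frame

end EvenStructure

/-! ### Freeness over the even part -/

section EvenStructure

variable {g : Type*} [AddCommGroup g] [Module ℂ g] [LieSuperalgebra g]

variable {p p₀ : SubSuperalgebra g} {k l m n : ℕ} {Φ : Frame p p₀ k l m n}
  {W : Type*} [AddCommGroup W] [Module ℂ W] {ρ : SuperRep p W}

namespace Frame

theorem oddVec_append (u w : List (Fin m)) (v : W) : Φ.oddVec ρ (u ++ w) v =
    (Φ.rep ρ).envHom (Φ.all.mono (u.map fun i => Sum.inr (Sum.inl i))) (Φ.oddVec ρ w v) := by
  simp [oddVec, HomBasis.mono_append]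

theorem oddWord_mem_evFil (u : List (Fin m)) {j : ℕ} {z : Φ.Mod ρ} (hz : z ∈ Φ.evFil ρ j) :
    (Φ.rep ρ).envHom (Φ.all.mono (u.map fun i => Sum.inr (Sum.inl i))) z ∈
      Φ.evFil ρ (j + u.length) := by
  induction u with
  | nil => simpa using hz
  | cons i u ih =>
    rw [List.map_cons, HomBasis.mono_cons, map_mul, Module.End.mul_apply, SuperRep.envHom_ι,
      SuperRep.act_eq_wholeAct]
    exact act_odd_mem_evFil (odd_letter _) ih

theorem ext_mono : Monotone (Φ.ext ρ) := fun _ _ h =>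
  Submodule.span_mono fun _ ⟨S, v, hS, hz⟩ => ⟨S, v, hS.trans h, hz⟩

theorem ext_le (j : ℕ) : Φ.ext ρ j ≤ Φ.ext ρ m :=
  Submodule.span_mono fun _ ⟨S, v, _, hz⟩ => ⟨S, v, by simpa using S.card_le_univ, hz⟩

theorem ext_le_oddFil (j : ℕ) : Φ.ext ρ j ≤ Φ.oddFil ρ j := by
  refine Submodule.span_le.2 ?_
  rintro _ ⟨S, v, hS, rfl⟩
  refine oddFil_mono ?_ (oddVec_mem_oddFil _ v)
  simpa using hS

theorem good_odd_iff (i j : Fin m) :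
    Φ.all.Good (Sum.inr (Sum.inl i)) (Sum.inr (Sum.inl j)) ↔ i < j := by
  rw [HomBasis.Good, Φ.rank_all, Φ.parity_inr]
  simp [letterRank]

theorem evFil_le_pred {i j : ℕ} (h : i < j) : Φ.evFil ρ i ≤ Φ.evFilPred ρ j := by
  cases j with
  | zero => omega
  | succ j => exact evFil_mono (Nat.le_of_lt_succ h)

theorem evFilPred_le (j : ℕ) : Φ.evFilPred ρ j ≤ Φ.evFil ρ j := by
  cases j with
  | zero => exact bot_le
  | succ j => exact evFil_mono (Nat.le_succ j)

/-- Straightening of a word in the odd letters outside `p`, modulo products with fewer odd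
factors. -/
theorem oddVec_mem (w : List (Fin m)) (v : W) :
    Φ.oddVec ρ w v ∈ Φ.ext ρ w.length ⊔ Φ.evFilPred ρ w.length := by
  induction w using (InvImage.wf (fun w : List (Fin m) => w.map fun i => Sum.inr (Sum.inl i))
    Φ.all.below_wf).induction with
  | _ w ih =>
  by_cases hw : w.IsChain (· < ·)
  · have h1 : w.Pairwise (· < ·) := hw.pairwise
    have h2 : w.toFinset.sort = w :=
      (List.toFinset_sort (r := (· ≤ ·)) h1.nodup).2 (h1.imp le_of_lt)
    refine Submodule.mem_sup_left (Submodule.subset_span ⟨w.toFinset, v, ?_, by rw [h2]⟩)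
    exact List.toFinset_card_le w
  · rw [List.isChain_iff_forall_rel_of_append_cons_cons] at hw
    push Not at hw
    obtain ⟨i, j, u, x, rfl, hij⟩ := hw
    have hbr : (Φ.rep ρ).envHom (Φ.all.mono (u.map fun i => Sum.inr (Sum.inl i)))
        ((Φ.rep ρ).wholeAct (br (Φ.all.basis (Sum.inr (Sum.inl i)) : g)
          (Φ.all.basis (Sum.inr (Sum.inl j)) : g)) (Φ.oddVec ρ x v)) ∈
        Φ.evFilPred ρ (u ++ i :: j :: x).length := by
      refine evFil_le_pred ?_ (oddWord_mem_evFil u (act_even_mem_evFil ?_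
        (oddFil_le_evFil _ (oddVec_mem_oddFil x v))))
      · simp
        omega
      · simpa [CharTwo.add_self_eq_zero] using
          br_mem (odd_letter (Φ := Φ) (Sum.inl i)) (odd_letter (Φ := Φ) (Sum.inl j))
    have h1 : Φ.oddVec ρ (u ++ i :: j :: x) v = -Φ.oddVec ρ (u ++ j :: i :: x) v +
        (Φ.rep ρ).envHom (Φ.all.mono (u.map fun i => Sum.inr (Sum.inl i)))
          ((Φ.rep ρ).wholeAct (br (Φ.all.basis (Sum.inr (Sum.inl i)) : g)
            (Φ.all.basis (Sum.inr (Sum.inl j)) : g)) (Φ.oddVec ρ x v)) := by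
      rw [oddVec_append, oddVec_append, oddVec_cons, oddVec_cons, oddVec_cons, oddVec_cons,
        (Φ.rep ρ).wholeAct_wholeAct (odd_letter _) (odd_letter _), superSign_one_one, map_add]
      simp
    rcases hij.lt_or_eq with h | rfl
    · rw [h1]
      refine Submodule.add_mem _ (Submodule.neg_mem _ ?_) (Submodule.mem_sup_right hbr)
      have h2 : Φ.all.Below ((u ++ j :: i :: x).map fun i => Sum.inr (Sum.inl i))
          ((u ++ i :: j :: x).map fun i => Sum.inr (Sum.inl i)) := by
        simp only [List.map_append, List.map_cons]
        refine Φ.all.below_swap _ _ ?_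
        rw [Φ.rank_all]
        simpa [letterRank] using h
      have h3 := ih _ h2
      simpa using h3
    · have h2 : Φ.oddVec ρ (u ++ j :: j :: x) v = (1 / 2 : ℂ) •
          (Φ.rep ρ).envHom (Φ.all.mono (u.map fun i => Sum.inr (Sum.inl i)))
            ((Φ.rep ρ).wholeAct (br (Φ.all.basis (Sum.inr (Sum.inl j)) : g)
              (Φ.all.basis (Sum.inr (Sum.inl j)) : g)) (Φ.oddVec ρ x v)) := by
        linear_combination (norm := module) (1 / 2 : ℂ) • h1
      rw [h2]
      exact Submodule.smul_mem _ _ (Submodule.mem_sup_right hbr)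

/-- The odd part of `g` is spanned by the odd letters outside `p` and the odd part of `p`. -/
theorem odd_mem_sup {x : g} (hx : x ∈ par 1) :
    x ∈ Submodule.span ℂ (Set.range fun i => (Φ.all.basis (Sum.inr (Sum.inl i)) : g)) ⊔
      (p.sub ⊓ par 1) := by
  have h1 := Φ.all.mem_span_of_par (z := ⟨x, trivial⟩) hx
  have h2 := Submodule.mem_map_of_mem (f := (SubSuperalgebra.whole g).sub.subtype) h1
  rw [Submodule.map_span] at h2
  refine Submodule.span_le.2 ?_ h2
  rintro _ ⟨_, ⟨i, hi, rfl⟩, rfl⟩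
  rcases i with i | i | i
  · have h3 : Φ.all.parity (Sum.inl i) = 1 := hi
    rw [Φ.parity_inl] at h3
    exact absurd h3 (by decide)
  · exact Submodule.mem_sup_left (Submodule.subset_span ⟨i, rfl⟩)
  · exact Submodule.mem_sup_right ⟨Φ.adapted.mem_sub (Or.inr ⟨i, rfl⟩), odd_letter _⟩

/-- Products of `j` odd elements of `g` and vectors of `W` are, up to products with fewer odd
factors over the even part, combinations of increasing products of odd letters outside `p`. -/
theorem oddFil_le (j : ℕ) : Φ.oddFil ρ j ≤ Φ.ext ρ j ⊔ Φ.evFilPred ρ j := by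
  induction j with
  | zero =>
    rintro _ ⟨v, rfl⟩
    refine Submodule.mem_sup_left (Submodule.subset_span ⟨∅, v, by simp, ?_⟩)
    rw [Finset.sort_empty, oddVec_nil]
  | succ j ih =>
    have h1 : Φ.evFil ρ j = Φ.evFilPred ρ (j + 1) := rfl
    refine sup_le (ih.trans (sup_le_sup (ext_mono (Nat.le_succ j)) ?_)) (Submodule.span_le.2 ?_)
    · exact (evFilPred_le j).trans h1.le
    rintro _ ⟨x, z, hx, hz, rfl⟩
    obtain ⟨e, he, z', hz', rfl⟩ := Submodule.mem_sup.1 (ih hz)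
    rw [map_add]
    refine Submodule.add_mem _ ?_ (Submodule.mem_sup_right ?_)
    · clear hz hz'
      obtain ⟨y, hy, q, hq, rfl⟩ := Submodule.mem_sup.1 (odd_mem_sup (Φ := Φ) hx)
      rw [map_add, LinearMap.add_apply]
      induction he using Submodule.span_induction with
      | mem e he =>
        obtain ⟨S, v, hS, rfl⟩ := he
        refine Submodule.add_mem _ ?_ (Submodule.mem_sup_right ?_)
        · clear hx
          induction hy using Submodule.span_induction with
          | mem y hy =>
            obtain ⟨i, rfl⟩ := hy
            have h2 := oddVec_mem (Φ := Φ) (ρ := ρ) (i :: S.sort) v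
            rw [oddVec_cons] at h2
            have h3 : (i :: S.sort).length ≤ j + 1 := by simpa using hS
            refine sup_le_sup (ext_mono h3) ?_ h2
            simpa [evFilPred] using evFil_mono hS
          | zero => simp
          | add a c _ _ ha hc => rw [map_add, LinearMap.add_apply]; exact Submodule.add_mem _ ha hc
          | smul r a _ ha => rw [map_smul, LinearMap.smul_apply]; exact Submodule.smul_mem _ r ha
        · refine evFil_mono ?_ (act_odd_oddVec_mem q hq.2 hq.1 _ v)
          simpa using hS
      | zero => simp
      | add a c _ _ ha hc =>
        rw [map_add, map_add, add_add_add_comm]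
        exact Submodule.add_mem _ ha hc
      | smul r a _ ha =>
        rw [map_smul, map_smul, ← smul_add]
        exact Submodule.smul_mem _ r ha
    · cases j with
      | zero =>
        rw [(Submodule.mem_bot ℂ).1 hz', map_zero]
        exact Submodule.zero_mem _
      | succ j => exact act_odd_mem_evFil hx hz'

section Even

variable (hp₀ : p₀.sub = p.sub ⊓ par 0)

include hp₀ in
/-- The module generated over the even part by the products with at most `j` odd factors is spanned
by the even letters outside `p`, applied to `ext`. -/
theorem evFil_eq (j : ℕ) : Φ.evFil ρ j =
    outerSpan Φ.even (Set.range Sum.inr) (Φ.rep₀ ρ) (Φ.ext ρ j) := by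
  have key : ∀ j, Φ.evFil ρ j ≤
      outerSpan Φ.even (Set.range Sum.inr) (Φ.rep₀ ρ) (Φ.ext ρ j) ⊔ Φ.evFilPred ρ j := by
    intro j
    have hst : ((Φ.rep₀ ρ).res Φ.adapted_even.le).IsStable (Φ.oddFil ρ j) := fun x v hv =>
      oddFil_stable hp₀.le j x x.2 hv
    rw [evFil, HomBasis.gen_eq_span Φ.adapted_even (Φ.rep₀ ρ) hst]
    refine (outerSpan_mono (oddFil_le j)).trans ?_
    rw [outerSpan_sup]
    refine sup_le_sup le_rfl ?_
    cases j with
    | zero => exact outerSpan_bot.le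
    | succ j => exact outerSpan_le (evFil_stable j) le_rfl
  refine le_antisymm ?_ (outerSpan_le (evFil_stable j) ((ext_le_oddFil j).trans
    (oddFil_le_evFil j)))
  induction j with
  | zero => exact (key 0).trans (sup_le le_rfl bot_le)
  | succ j ih =>
    exact (key (j + 1)).trans (sup_le le_rfl (ih.trans (outerSpan_mono (ext_mono (Nat.le_succ j)))))

include hp₀ in
/-- The induced module is generated by `ext` over the even letters outside `p`. -/
theorem outerSpan_ext : outerSpan Φ.even (Set.range Sum.inr) (Φ.rep₀ ρ) (Φ.ext ρ m) = ⊤ := by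
  rw [eq_top_iff]
  rintro z -
  obtain ⟨j, hj⟩ := exists_mem_evFil z
  rw [evFil_eq hp₀] at hj
  exact outerSpan_mono (ext_le j) hj

include hp₀ in
/-- The part of `ext` of degree `j` is stable under the even part of `p`, modulo lower degrees. -/
theorem act_mem_ext_sup (j : ℕ) (x : p₀.sub) {z : Φ.Mod ρ} (hz : z ∈ Φ.ext ρ j) :
    (Φ.rep ρ).wholeAct (x : g) z ∈ Φ.ext ρ j ⊔ Φ.evFilPred ρ j :=
  oddFil_le j (oddFil_stable hp₀.le j x x.2 (ext_le_oddFil j hz))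

end Even

/-- The linear map onto `ext` given by the increasing products of distinct odd letters. -/
def extMap (Φ : Frame p p₀ k l m n) (ρ : SuperRep p W) :
    (Finset (Fin m) →₀ W) →ₗ[ℂ] Φ.Mod ρ :=
  Finsupp.lsum ℂ fun S => (Φ.rep ρ).envHom
    (Φ.all.mono (S.sort.map fun i => Sum.inr (Sum.inl i))) ∘ₗ indOf Φ.adapted.le ρ

theorem extMap_apply (f : Finset (Fin m) →₀ W) :
    extMap Φ ρ f = f.sum fun S v => Φ.oddVec ρ S.sort v := rfl

theorem range_extMap : LinearMap.range (extMap Φ ρ) = Φ.ext ρ m := by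
  refine le_antisymm ?_ (Submodule.span_le.2 ?_)
  · rintro _ ⟨f, rfl⟩
    rw [extMap_apply]
    exact Submodule.sum_mem _ fun S _ => Submodule.subset_span
      ⟨S, _, by simpa using S.card_le_univ, rfl⟩
  · rintro _ ⟨S, v, _, rfl⟩
    exact ⟨Finsupp.single S v, by simp [extMap_apply, oddVec]⟩

theorem rep₀_mono (w : List (Fin k ⊕ Fin l)) (z : Φ.Mod ρ) :
    (Φ.rep₀ ρ).envHom (Φ.even.mono w) z = (Φ.rep ρ).envHom (Φ.all.mono (w.map Sum.inl)) z := by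
  induction w with
  | nil => simp
  | cons i w ih =>
    rw [List.map_cons, HomBasis.mono_cons, HomBasis.mono_cons, map_mul, map_mul,
      Module.End.mul_apply, Module.End.mul_apply, ih, SuperRep.envHom_ι, SuperRep.envHom_ι,
      SuperRep.res_act_eq_wholeAct, SuperRep.act_eq_wholeAct, Φ.basis_inl]

/-- The normal word formed by an even word and a set of odd letters. -/
def joinWord (Φ : Frame p p₀ k l m n) (y : Φ.even.Outer (Set.range Sum.inr) × Finset (Fin m)) :
    Φ.all.Outer (parLetters k l m n) := by
  refine ⟨y.1.1.map Sum.inl ++ y.2.sort.map fun i => Sum.inr (Sum.inl i), ?_, ?_⟩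
  · refine List.isChain_append.2 ⟨?_, ?_, ?_⟩
    · rw [List.isChain_map]
      refine y.1.2.1.imp fun i j hij => ?_
      rcases hij with h | ⟨rfl, -⟩
      · refine Or.inl ?_
        rwa [Φ.rank_even, Φ.rank_even] at h
      · exact Or.inr ⟨rfl, Φ.parity_inl i⟩
    · rw [List.isChain_map]
      have h1 : y.2.sort.Pairwise (· < ·) := y.2.sortedLT_sort.pairwise
      exact h1.isChain.imp fun i j hij => good_odd_iff i j |>.2 hij
    · intro a ha c hc
      have ha' := List.mem_of_mem_getLast? ha
      have hc' := List.mem_of_mem_head? hc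
      rw [List.mem_map] at ha' hc'
      obtain ⟨i, hi, rfl⟩ := ha'
      obtain ⟨j, _, rfl⟩ := hc'
      refine Or.inl ?_
      rw [Φ.rank_all]
      rcases i with i | i
      · simp only [letterRank]
        omega
      · exact absurd ⟨i, rfl⟩ (y.1.2.2 _ hi)
  · intro i hi
    rcases List.mem_append.1 hi with hi | hi <;> rw [List.mem_map] at hi
    · obtain ⟨j, hj, rfl⟩ := hi
      rintro (⟨a, ha⟩ | ⟨a, ha⟩)
      · rw [Sum.inl.injEq] at ha
        exact y.1.2.2 j hj ⟨a, ha.symm⟩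
      · cases ha
    · obtain ⟨j, hj, rfl⟩ := hi
      rintro (⟨a, ha⟩ | ⟨a, ha⟩) <;> cases ha

theorem joinWord_injective : Function.Injective (joinWord Φ) := by
  rintro ⟨⟨y, hy⟩, S⟩ ⟨⟨y', hy'⟩, S'⟩ h
  have h1 : y.map Sum.inl ++ S.sort.map (fun i => (Sum.inr (Sum.inl i) : Letters k l m n)) =
      y'.map Sum.inl ++ S'.sort.map (fun i => (Sum.inr (Sum.inl i) : Letters k l m n)) :=
    congrArg Subtype.val h
  have h2 := congrArg (List.filterMap fun i : Letters k l m n => i.getLeft?) h1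
  have h3 := congrArg (List.filterMap fun i : Letters k l m n => i.getRight?) h1
  have h4 : S.sort = S'.sort := by
    have h5 : Function.Injective fun i : Fin m => (Sum.inl i : Fin m ⊕ Fin n) :=
      Sum.inl_injective
    apply List.map_injective_iff.2 h5
    simpa [List.filterMap_append, List.filterMap_map, Function.comp_def] using h3
  have h5 : y = y' := by
    simpa [List.filterMap_append, List.filterMap_map, Function.comp_def] using h2
  have h6 : S = S' := by
    rw [← S.sort_toFinset (· ≤ ·), h4, Finset.sort_toFinset]
  subst h5 h6
  rfl

/-- The even letters outside `p` act freely on `ext`: this is the Poincaré–Birkhoff–Witt theorem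
for the normal words of `joinWord`. -/
theorem extMap_independent (H : Φ.even.Outer (Set.range Sum.inr) →₀ (Finset (Fin m) →₀ W))
    (hH : (H.sum fun y f => (Φ.rep₀ ρ).envHom (Φ.even.mono y.1) (extMap Φ ρ f)) = 0) : H = 0 := by
  have h1 := HomBasis.ind_independent Φ.adapted ρ (H.uncurry.mapDomain (joinWord Φ)) (by
    rw [Finsupp.sum_mapDomain_index (by simp) (by simp), ← hH]
    refine (Finsupp.sum_uncurry_index H fun a v => (indRep Φ.adapted.le ρ).envHom
      (Φ.all.mono (joinWord Φ a).1) (indOf Φ.adapted.le ρ v)).trans ?_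
    refine Finsupp.sum_congr fun y _ => ?_
    rw [extMap_apply, Finsupp.sum, Finsupp.sum, map_sum]
    refine Finset.sum_congr rfl fun S _ => ?_
    rw [rep₀_mono, oddVec, ← Module.End.mul_apply, ← map_mul, ← HomBasis.mono_append]
    rfl)
  have h2 : H.uncurry = 0 :=
    Finsupp.mapDomain_injective joinWord_injective (h1.trans Finsupp.mapDomain_zero.symm)
  rw [← Finsupp.curry_uncurry H, h2]
  ext
  rfl

theorem extMap_injective : Function.Injective (extMap Φ ρ) := by
  rw [← LinearMap.ker_eq_bot, LinearMap.ker_eq_bot']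
  intro f hf
  have h1 := extMap_independent (Φ := Φ) (ρ := ρ)
    (Finsupp.single ⟨[], Φ.even.normal_nil, by simp⟩ f) (by simp [hf])
  simpa using h1

/-- `ext` has the size of the exterior algebra of the odd part of `g / p`, tensored with `W`. -/
theorem finrank_ext [FiniteDimensional ℂ W] :
    Module.finrank ℂ (Φ.ext ρ m) = 2 ^ m * Module.finrank ℂ W := by
  rw [← range_extMap, LinearMap.finrank_range_of_inj extMap_injective,
    (Finsupp.linearEquivFunOnFinite ℂ W _).finrank_eq, Module.finrank_pi_fintype]
  simp

theorem finite_ext [FiniteDimensional ℂ W] : FiniteDimensional ℂ (Φ.ext ρ m) := by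
  rw [← range_extMap]
  infer_instance

/-- The induced module is free over the even letters outside `p`, with `ext` as the space of
generators: coefficients with respect to normal words are unique. -/
theorem mem_of_sum_mem {N : Submodule ℂ (Φ.Mod ρ)} (hN : N ≤ Φ.ext ρ m)
    (f : Φ.even.Outer (Set.range Sum.inr) →₀ Φ.Mod ρ) (hf : ∀ y, f y ∈ Φ.ext ρ m)
    (hsum : (f.sum fun y v => (Φ.rep₀ ρ).envHom (Φ.even.mono y.1) v) ∈
      outerSpan Φ.even (Set.range Sum.inr) (Φ.rep₀ ρ) N) (y) : f y ∈ N := by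
  obtain ⟨f', hf', hsum'⟩ := exists_finsupp_of_mem_outerSpan hsum
  obtain ⟨G, hG⟩ := (extMap Φ ρ).exists_leftInverse_of_injective
    (LinearMap.ker_eq_bot.2 extMap_injective)
  have hG' : ∀ z ∈ Φ.ext ρ m, extMap Φ ρ (G z) = z := by
    intro z hz
    rw [← range_extMap] at hz
    obtain ⟨a, rfl⟩ := hz
    rw [← LinearMap.comp_apply G, hG, LinearMap.id_apply]
  have h1 := extMap_independent (Φ := Φ) (ρ := ρ) ((f - f').mapRange G (map_zero G)) (by
    rw [Finsupp.sum_mapRange_index (by simp)]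
    have h2 : ((f - f').sum fun y v => (Φ.rep₀ ρ).envHom (Φ.even.mono y.1) v) = 0 := by
      rw [Finsupp.sum_sub_index (by simp), hsum', sub_self]
    rw [← h2]
    refine Finsupp.sum_congr fun y _ => ?_
    rw [Finsupp.sub_apply, hG' _ (Submodule.sub_mem _ (hf y) (hN (hf' y)))])
  have h2 := DFunLike.congr_fun h1 y
  rw [Finsupp.mapRange_apply, Finsupp.zero_apply] at h2
  have h3 := hG' _ (Submodule.sub_mem _ (hf y) (hN (hf' y)))
  rw [← Finsupp.sub_apply, h2, map_zero, Finsupp.sub_apply, eq_comm, sub_eq_zero] at h3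
  rw [h3]
  exact hf' y

end Frame

end EvenStructure

/-! ### Joint eigenspaces -/

section JointEigenspaces

variable {ι V : Type*} [AddCommGroup V] [Module ℂ V]

/-- The joint eigenspace of a family of endomorphisms, for a family of eigenvalues. -/
def jointEigenspace (T : ι → Module.End ℂ V) (α : ι → ℂ) : Submodule ℂ V where
  carrier := {v | ∀ i, T i v = α i • v}
  add_mem' hx hy i := by simp [hx i, hy i]
  zero_mem' i := by simp
  smul_mem' c x hx i := by simp [hx i, smul_comm c]

variable {T : ι → Module.End ℂ V}

theorem jointEigenspace_independent : iSupIndep (jointEigenspace T) := by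
  classical
  rw [iSupIndep_iff_finsetSum_eq_zero_imp_eq_zero]
  intro s
  induction s using Finset.induction_on with
  | empty => simp
  | insert β s hβ ih =>
    intro f hf hsum α hα
    -- subtracting `β i` times the relation from its image under `T i` removes the `β`-component
    have h1 : ∀ γ ∈ s, f γ = 0 := by
      intro γ hγ
      obtain ⟨i, hi⟩ : ∃ i, γ i ≠ β i := by
        by_contra! h
        rw [funext h] at hγ
        exact hβ hγ
      have h2 := ih (fun δ => (δ i - β i) • f δ)
        (fun δ hδ => Submodule.smul_mem _ _ (hf δ (Finset.mem_insert_of_mem hδ))) (by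
          have h3 : (T i) (∑ δ ∈ insert β s, f δ) - β i • ∑ δ ∈ insert β s, f δ = 0 := by
            rw [hsum, map_zero, smul_zero, sub_zero]
          rw [map_sum, Finset.smul_sum, ← Finset.sum_sub_distrib, Finset.sum_insert hβ,
            hf β (Finset.mem_insert_self _ _) i, sub_self, zero_add] at h3
          rw [← h3]
          refine Finset.sum_congr rfl fun δ hδ => ?_
          rw [hf δ (Finset.mem_insert_of_mem hδ) i, sub_smul]) γ hγ
      exact (smul_eq_zero.1 h2).resolve_left (sub_ne_zero.2 hi)
    rw [Finset.sum_insert hβ, Finset.sum_eq_zero h1, add_zero] at hsum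
    rcases Finset.mem_insert.1 hα with rfl | hα
    · exact hsum
    · exact h1 α hα

/-- The components of a vector of a stable subspace lie in the subspace. -/
theorem jointEigenspace_component {κ : Type*} {w : κ → ι → ℂ} (hw : Function.Injective w)
    {N : Submodule ℂ V} (hN : ∀ i, ∀ v ∈ N, T i v ∈ N)
    (s : Finset κ) (f : κ → V) (hf : ∀ α ∈ s, f α ∈ jointEigenspace T (w α))
    (hsum : ∑ α ∈ s, f α ∈ N) (α) (hα : α ∈ s) : f α ∈ N := by
  have h1 := (iSupIndep_iff_finsetSum_eq_zero_imp_eq_zero _).1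
    ((jointEigenspace_independent (T := fun i => N.mapQ N (T i) (hN i))).comp hw) s
    (fun α => N.mkQ (f α)) (fun α hα i => by
      rw [Submodule.mkQ_apply, Submodule.mapQ_apply, hf α hα i]; rfl) (by
      rw [← map_sum, Submodule.mkQ_apply, Submodule.Quotient.mk_eq_zero]
      exact hsum) α hα
  rwa [Submodule.mkQ_apply, Submodule.Quotient.mk_eq_zero] at h1

/-- A stable subspace of a space spanned by joint eigenvectors is spanned by joint eigenvectors. -/
theorem le_iSup_inf_jointEigenspace {κ : Type*} {w : κ → ι → ℂ} (hw : Function.Injective w)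
    (hT : ⨆ α, jointEigenspace T (w α) = ⊤) {N : Submodule ℂ V}
    (hN : ∀ i, ∀ v ∈ N, T i v ∈ N) : N ≤ ⨆ α, N ⊓ jointEigenspace T (w α) := by
  intro v hv
  have hv' : v ∈ ⨆ α, jointEigenspace T (w α) := hT ▸ trivial
  obtain ⟨f, hf, rfl⟩ := (Submodule.mem_iSup_iff_exists_finsupp _ v).1 hv'
  refine Submodule.sum_mem _ fun α hα => Submodule.mem_iSup_of_mem α ⟨?_, hf α⟩
  exact jointEigenspace_component hw hN f.support f (fun α _ => hf α) hv α hα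

theorem finite_jointEigenspace_ne_bot [FiniteDimensional ℂ V] :
    {α | jointEigenspace T α ≠ ⊥}.Finite :=
  WellFoundedGT.finite_ne_bot_of_iSupIndep jointEigenspace_independent

attribute [local instance] LieRing.ofAssociativeRing

/-- Lie's theorem: a solvable Lie algebra that acts on a nonzero finite-dimensional space has a
common eigenvector. -/
theorem exists_common_eigenvector {H : Type*} [LieRing H] [LieAlgebra ℂ H]
    [FiniteDimensional ℂ H] [LieAlgebra.IsSolvable H] [FiniteDimensional ℂ V] [Nontrivial V]
    (φ : H →ₗ[ℂ] Module.End ℂ V) (hφ : ∀ x y, φ ⁅x, y⁆ = φ x * φ y - φ y * φ x) :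
    ∃ (χ : Module.Dual ℂ H) (v : V), v ≠ 0 ∧ ∀ x, φ x v = χ x • v := by
  let φ' : H →ₗ⁅ℂ⁆ Module.End ℂ V := { φ with map_lie' := fun {x y} => hφ x y }
  let _ : LieRingModule H V := LieRingModule.compLieHom V φ'
  let _ : LieModule ℂ H V := LieModule.compLieHom V φ'
  obtain ⟨χ, hχ⟩ := LieModule.exists_nontrivial_weightSpace_of_isSolvable ℂ H V
  obtain ⟨v, hv⟩ := exists_ne (0 : LieModule.weightSpace V χ)
  refine ⟨χ, v, fun h => hv (Subtype.ext h), fun x => ?_⟩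
  exact (LieModule.mem_weightSpace _ _).1 v.2 x

/-- The eigenvalue of a primitive vector of a finite-dimensional `sl₂`-module is a natural
number. -/
theorem exists_nat_eigenvalue [FiniteDimensional ℂ V] {H E F : Module.End ℂ V}
    (hEF : E * F - F * E = H) (hHE : H * E - E * H = (2 : ℂ) • E)
    (hHF : H * F - F * H = -((2 : ℂ) • F)) {v : V} (hv : v ≠ 0) (hE : E v = 0) {c : ℂ}
    (hH : H v = c • v) : ∃ n : ℕ, c = n := by
  by_cases h0 : H = 0
  · refine ⟨0, ?_⟩
    rw [h0, LinearMap.zero_apply, eq_comm] at hH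
    simpa using (smul_eq_zero.1 hH).resolve_right hv
  · have t : IsSl2Triple H E F :=
      { h_ne_zero := h0
        lie_e_f := hEF
        lie_h_e_nsmul := by
          rw [Ring.lie_def, hHE, two_smul, two_smul]
        lie_h_f_nsmul := by
          rw [Ring.lie_def, hHF, two_smul, two_smul] }
    have P : t.HasPrimitiveVectorWith v c := ⟨hv, hH, hE⟩
    exact P.exists_nat

end JointEigenspaces

/-! ### Weights and roots -/

section Roots

variable {g : Type*} [AddCommGroup g] [Module ℂ g] [LieSuperalgebra g]

namespace LieSuperalgebra

theorem br_even_jacobi {i : ZMod 2} {x y : g} (hx : x ∈ par 0) (hy : y ∈ par i) (z : g) :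
    br x (br y z) = br (br x y) z + br y (br x z) := by
  rw [br_jacobi hx hy, superSign_zero_left, one_smul]

end LieSuperalgebra

namespace GradedDatum

variable (D : GradedDatum g)

/-- The adjoint action of `h₀` on `g`. -/
def hAct (h : D.h₀) : Module.End ℂ g := br ((h : Even g) : g)

theorem h₀_even (h : D.h₀) : ((h : Even g) : g) ∈ par 0 := (h : Even g).2

theorem iSupIndep_wtSpace : iSupIndep (wtSpace D.h₀) :=
  (jointEigenspace_independent (T := D.hAct)).comp
    (DFunLike.coe_injective (F := Module.Dual ℂ D.h₀))

/-- The even elements of weight zero lie in the Cartan subalgebra, which is its own normalizer. -/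
theorem mem_h₀_of_mem_wtSpace_zero {x : g} (hx : x ∈ wtSpace D.h₀ 0) (hx' : x ∈ par 0) :
    (⟨x, hx'⟩ : Even g) ∈ D.h₀ := by
  rw [← D.cartan.self_normalizing, LieSubalgebra.mem_normalizer_iff']
  intro y hy
  have h1 : ⁅y, (⟨x, hx'⟩ : Even g)⁆ = 0 := Subtype.ext ((hx ⟨y, hy⟩).trans (by simp))
  rw [h1]
  exact D.h₀.zero_mem

theorem gr_stable (i : ℤ) (h : D.h₀) (v : g) (hv : v ∈ D.gr i) :
    br ((h : Even g) : g) v ∈ D.gr i := by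
  simpa using D.gr_br (D.h₀_deg h) hv

theorem iSup_gr_inf_par_le {κ : Type*} (c : κ → ℤ) :
    (⨆ i, D.gr (c i)) ⊓ par 0 ≤ ⨆ i, D.gr (c i) ⊓ par 0 := by
  rintro x ⟨hx, hx'⟩
  rw [← gradedProj_same par_internal hx']
  clear hx'
  induction hx using Submodule.iSup_induction' with
  | mem i x hx =>
    exact Submodule.mem_iSup_of_mem i ⟨(D.gr_graded _).proj_mem par_internal 0 hx,
      gradedProj_mem par_internal 0 x⟩
  | zero => simp
  | add v w _ _ hv hw => rw [map_add]; exact Submodule.add_mem _ hv hw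

/-- The part of degree `i` and weight `α` of the even part of `g`. -/
def evenPart (i : ℤ) (α : Module.Dual ℂ D.h₀) : Submodule ℂ g :=
  (D.gr i ⊓ par 0) ⊓ wtSpace D.h₀ α

section

variable [FiniteDimensional ℂ g]

/-- The weight spaces span `g`. An invariant complement of their sum, which exists by semisimplicity,
would contain a weight vector by Lie's theorem if it were nonzero. -/
theorem iSup_wtSpace : ⨆ α, wtSpace D.h₀ α = ⊤ := by
  have hst : ∀ h : D.h₀, ∀ w ∈ ⨆ α, wtSpace D.h₀ α,
      br ((h : Even g) : g) w ∈ ⨆ α, wtSpace D.h₀ α := by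
    intro h w hw
    induction hw using Submodule.iSup_induction' with
    | mem α w hw =>
      rw [hw h]
      exact Submodule.smul_mem _ _ (Submodule.mem_iSup_of_mem α hw)
    | zero => simp
    | add v w _ _ hv hw => rw [map_add]; exact Submodule.add_mem _ hv hw
  obtain ⟨W', hW', hst'⟩ := D.semisimple _ hst
  by_cases hbot : W' = ⊥
  · rw [hbot] at hW'
    exact eq_top_of_isCompl_bot hW'
  exfalso
  have : Nontrivial W' := (Submodule.nontrivial_iff_ne_bot).2 hbot
  have := D.cartan.nilpotent
  obtain ⟨χ, v, hv, hχ⟩ := exists_common_eigenvector (V := W')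
    ({ toFun := fun h => (D.hAct h).restrict (hst' h)
       map_add' := fun a b => by ext; simp [hAct]
       map_smul' := fun c a => by ext; simp [hAct] } : D.h₀ →ₗ[ℂ] Module.End ℂ W') (by
    intro a b
    ext v
    have h1 := br_even_jacobi (D.h₀_even a) (D.h₀_even b) v
    simp only [LinearMap.coe_mk, AddHom.coe_mk, LinearMap.coe_restrict_apply, LinearMap.sub_apply,
      Module.End.mul_apply, Submodule.coe_sub, hAct]
    rw [h1, add_sub_cancel_right]
    rfl)
  have h1 : (v : g) ∈ wtSpace D.h₀ χ := fun h => congrArg Subtype.val (hχ h)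
  have h2 := hW'.disjoint.le_bot (show (v : g) ∈ _ ⊓ W' from ⟨Submodule.mem_iSup_of_mem χ h1, v.2⟩)
  exact hv (Subtype.ext h2)

theorem le_iSup_inf_wtSpace {N : Submodule ℂ g}
    (hN : ∀ h : D.h₀, ∀ v ∈ N, br ((h : Even g) : g) v ∈ N) : N ≤ ⨆ α, N ⊓ wtSpace D.h₀ α :=
  le_iSup_inf_jointEigenspace (T := D.hAct) (w := fun α : Module.Dual ℂ D.h₀ => (α : D.h₀ → ℂ))
    DFunLike.coe_injective D.iSup_wtSpace hN

/-- The Cartan subalgebra is abelian: its elements act on it both semisimply and nilpotently. -/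
theorem h₀_le_wtSpace_zero (h' : D.h₀) : ((h' : Even g) : g) ∈ wtSpace D.h₀ 0 := by
  let N : Submodule ℂ g := D.h₀.toSubmodule.map (par (g := g) 0).subtype
  have hN : ∀ h : D.h₀, ∀ v ∈ N, br ((h : Even g) : g) v ∈ N := by
    rintro h _ ⟨v, hv, rfl⟩
    exact ⟨⁅(h : Even g), v⁆, D.h₀.lie_mem h.2 hv, rfl⟩
  have := D.cartan.nilpotent
  suffices h : N ≤ wtSpace D.h₀ 0 from h ⟨h', h'.2, rfl⟩
  refine (D.le_iSup_inf_wtSpace hN).trans (iSup_le fun α => ?_)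
  rintro _ ⟨⟨y, hy, rfl⟩, hyα⟩
  by_cases hy0 : y = 0
  · simp [hy0]
  suffices hα : α = 0 by rwa [← hα]
  ext h
  obtain ⟨k, hk⟩ := LieModule.isNilpotent_toEnd_of_isNilpotent (R := ℂ) (L := D.h₀) (M := D.h₀) h
  have h1 : ∀ k : ℕ, (((LieModule.toEnd ℂ D.h₀ D.h₀ h ^ k) ⟨y, hy⟩ : D.h₀) : Even g) =
      (α h) ^ k • y := by
    intro k
    induction k with
    | zero => simp
    | succ k ih =>
      rw [pow_succ', Module.End.mul_apply, LieModule.toEnd_apply_apply, LieSubalgebra.coe_bracket,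
        ih, lie_smul, pow_succ, mul_smul]
      congr 1
      exact Subtype.ext (hyα h)
  have h2 := h1 k
  rw [hk, LinearMap.zero_apply] at h2
  have h3 := (smul_eq_zero.1 h2.symm).resolve_right hy0
  exact IsReduced.eq_zero _ ⟨k, h3⟩

theorem gr_inf_par_le (i : ℤ) : D.gr i ⊓ par 0 ≤ ⨆ α, D.evenPart i α :=
  D.le_iSup_inf_wtSpace fun h v hv =>
    ⟨D.gr_stable i h v hv.1, by simpa using br_mem (D.h₀_even h) hv.2⟩

theorem even_le : par (g := g) 0 ≤ ⨆ i, ⨆ α, D.evenPart i α := by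
  intro x hx
  have h1 : x ∈ (⨆ i, D.gr i) ⊓ par 0 := ⟨D.gr_internal.submodule_iSup_eq_top ▸ trivial, hx⟩
  exact iSup_mono (fun i => D.gr_inf_par_le i) (D.iSup_gr_inf_par_le (fun i => i) h1)

/-- The adjoint action of an even element that commutes with `x` and `y` and equals their bracket
has no nonzero eigenvalue: on an eigenspace it is a commutator, so has trace zero. -/
theorem eq_zero_of_br_commute {x y : g} (hx : x ∈ par 0) (hy : y ∈ par 0)
    (hzx : br (br x y) x = 0) (hzy : br (br x y) y = 0) {c : ℂ} {v : g} (hv : v ≠ 0)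
    (hc : br (br x y) v = c • v) : c = 0 := by
  have hz : br x y ∈ par 0 := by simpa using br_mem hx hy
  let E := Module.End.eigenspace (br (br x y)) c
  have hE : ∀ a ∈ par (g := g) 0, br (br x y) a = 0 → ∀ u ∈ E, br a u ∈ E := by
    intro a ha haz u hu
    rw [Module.End.mem_eigenspace_iff] at hu ⊢
    rw [br_even_jacobi hz ha, haz, hu]
    simp
  let A : Module.End ℂ E := (br x).restrict (hE x hx hzx)
  let B : Module.End ℂ E := (br y).restrict (hE y hy hzy)
  have h1 : A * B - B * A = c • LinearMap.id := by
    ext u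
    have hu := Module.End.mem_eigenspace_iff.1 u.2
    have h2 := br_even_jacobi hx hy (u : g)
    rw [hu] at h2
    change br x (br y u) - br y (br x u) = c • (u : g)
    rw [h2, add_sub_cancel_right]
  have h2 := congrArg (LinearMap.trace ℂ E) h1
  rw [map_sub, LinearMap.trace_mul_comm, sub_self, map_smul, LinearMap.trace_id, smul_eq_mul,
    eq_comm, mul_eq_zero] at h2
  refine h2.resolve_right ?_
  have h3 : Nontrivial E := ⟨⟨v, Module.End.mem_eigenspace_iff.2 hc⟩, 0, fun h =>
    hv (congrArg Subtype.val h)⟩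
  exact_mod_cast Module.finrank_pos.ne'

/-- A nonzero even root vector is part of an `sl₂`-triple, whose members are homogeneous for the
`ℤ`-grading. A root vector of opposite weight that pairs nontrivially with it under the Killing form
exists because the radical of a reductive Lie algebra is its center; the root does not vanish on
the bracket of the two by `eq_zero_of_br_commute`. -/
theorem exists_sl2 {α : Module.Dual ℂ D.h₀} (hα : α ≠ 0) {i : ℤ} {x : g}
    (hx : x ∈ D.evenPart i α) (hx0 : x ≠ 0) :
    ∃ y ∈ D.evenPart (-i) (-α), ∃ h : D.h₀, br x y = ((h : Even g) : g) ∧ α h = 2 := by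
  obtain ⟨⟨hxi, hx'⟩, hxα⟩ := hx
  let X : Even g := ⟨x, hx'⟩
  let κ := killingForm ℂ (Even g)
  have hinv : ∀ a b c : Even g, κ ⁅a, b⁆ c = κ a ⁅b, c⁆ :=
    LieModule.traceForm_apply_lie_apply ℂ (Even g) (Even g)
  obtain ⟨h', hh'⟩ : ∃ h', α h' ≠ 0 := by
    by_contra! h
    exact hα (LinearMap.ext h)
  -- the kernel of the Killing form lies in the radical, that is, in the center
  have hX : ¬ ∀ Y, κ X Y = 0 := by
    intro h
    have h1 : X ∈ LieIdeal.killingCompl ℂ (Even g) ⊤ := by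
      rw [LieIdeal.mem_killingCompl]
      intro Y _
      rw [LieModule.traceForm_comm]
      exact h Y
    have h2 := LieAlgebra.killingCompl_top_le_radical ℂ (Even g) h1
    rw [D.reductive.radical_eq_center] at h2
    have h3 := congrArg Subtype.val (h2 h')
    exact hx0 ((smul_eq_zero.1 ((hxα h').symm.trans h3)).resolve_left hh')
  obtain ⟨j, β, y, hy, hy', hκ⟩ : ∃ (j : ℤ) (β : Module.Dual ℂ D.h₀) (y : g)
      (_ : y ∈ D.evenPart j β) (hy' : y ∈ par 0), κ X ⟨y, hy'⟩ ≠ 0 := by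
    by_contra! h
    refine hX fun Y => ?_
    have h1 : par (g := g) 0 ≤ (LinearMap.ker (κ X)).map (par (g := g) 0).subtype :=
      D.even_le.trans (iSup_le fun j => iSup_le fun β y hy =>
        ⟨⟨y, hy.1.2⟩, h j β y hy hy.1.2, rfl⟩)
    obtain ⟨Y', hY', hYY'⟩ := h1 Y.2
    rw [← Subtype.ext hYY']
    exact hY'
  let Y : Even g := ⟨y, hy'⟩
  have hβ : β = -α := by
    ext h
    have h1 : ⁅(h : Even g), X⁆ = α h • X := Subtype.ext (hxα h)
    have h2 : ⁅(h : Even g), Y⁆ = β h • Y := Subtype.ext (hy.2 h)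
    have h3 := hinv X h Y
    rw [h2, ← lie_skew, h1, map_neg, LinearMap.neg_apply, map_smul, map_smul, LinearMap.smul_apply,
      smul_eq_mul, smul_eq_mul] at h3
    have h4 : (β h + α h) * κ X Y = 0 := by linear_combination -h3
    rw [LinearMap.neg_apply]
    exact eq_neg_of_add_eq_zero_left ((mul_eq_zero.1 h4).resolve_right hκ)
  subst hβ
  have hz : br x y ∈ wtSpace D.h₀ 0 := by simpa using D.wt_br hxα hy.2
  have hz' : br x y ∈ par 0 := by simpa using br_mem hx' hy'
  let z : D.h₀ := ⟨⟨br x y, hz'⟩, D.mem_h₀_of_mem_wtSpace_zero hz hz'⟩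
  have hzc : κ ⁅X, Y⁆ h' ≠ 0 := by
    have h2 : ⁅(h' : Even g), Y⁆ = -α h' • Y := Subtype.ext (hy.2 h')
    rw [hinv, ← lie_skew, h2, neg_smul, neg_neg, map_smul]
    exact mul_ne_zero hh' hκ
  -- otherwise `[x, y]` would be central in the even part
  have hαz : α z ≠ 0 := by
    intro h0
    have h1 : br (br x y) x = 0 := by rw [show br (br x y) x = _ from hxα z, h0, zero_smul]
    have h2 : br (br x y) y = 0 := by
      rw [show br (br x y) y = _ from hy.2 z, LinearMap.neg_apply, h0, neg_zero, zero_smul]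
    have h3 : ∀ v, br (br x y) v = 0 := by
      intro v
      have hv : v ∈ ⨆ γ, wtSpace D.h₀ γ := D.iSup_wtSpace ▸ trivial
      induction hv using Submodule.iSup_induction' with
      | mem γ v hv =>
        have h4 : br (br x y) v = γ z • v := hv z
        by_cases hv0 : v = 0
        · rw [hv0, map_zero]
        · rw [h4, eq_zero_of_br_commute hx' hy' h1 h2 hv0 h4, zero_smul]
      | zero => simp
      | add v w _ _ hv hw => rw [map_add, hv, hw, add_zero]
    have h4 : LieAlgebra.ad ℂ (Even g) ⁅X, Y⁆ = 0 := LinearMap.ext fun v => Subtype.ext (h3 v)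
    refine hzc ?_
    rw [killingForm_apply_apply, h4, LinearMap.zero_comp, map_zero]
  have hij : j = -i := by
    by_contra hij
    have h1 : i + j ≠ 0 := by omega
    have h2 : br x y = 0 :=
      (D.gr_internal.submodule_iSupIndep.pairwiseDisjoint h1).le_bot
        ⟨D.gr_br hxi hy.1.1, D.h₀_deg z⟩
    have h3 : z = 0 := Subtype.ext (Subtype.ext h2)
    rw [h3, map_zero] at hαz
    exact hαz rfl
  subst hij
  refine ⟨(2 / α z) • y, Submodule.smul_mem _ _ hy, (2 / α z) • z, ?_, ?_⟩
  · rw [map_smul]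
    rfl
  · rw [map_smul, smul_eq_mul, div_mul_cancel₀ _ hαz]

end

end GradedDatum

end Roots

/-! ### Positivity of sums of even positive roots -/

section Positivity

variable {g : Type*} [AddCommGroup g] [Module ℂ g] [LieSuperalgebra g]

namespace GradedDatum

variable (D : GradedDatum g)

/-- The positive roots of the even part of `g`. -/
def evenPos : Set (Module.Dual ℂ D.h₀) := {α | α ∈ D.pos ∧ wtSpace D.h₀ α ⊓ par 0 ≠ ⊥}

variable {D}

theorem zero_notMem_neg : (0 : Module.Dual ℂ D.h₀) ∉ D.neg := by
  intro h
  have h1 : (0 : Module.Dual ℂ D.h₀) ∈ rootSet D.h₀ := by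
    rw [D.root_eq]
    exact Or.inr h
  exact h1.1 rfl

theorem ne_zero_of_mem_pos {α : Module.Dual ℂ D.h₀} (h : α ∈ D.pos) : α ≠ 0 := fun h0 =>
  D.zero_notMem_pos (h0 ▸ h)

theorem nonneg_of_mem {i : ℤ} {x : g} (hx : x ∈ D.gr i) (hx0 : x ≠ 0)
    (hx' : x ∈ ⨆ i : {i : ℤ // 0 ≤ i}, D.gr i) : 0 ≤ i := by
  by_contra hi
  refine hx0 ((D.gr_internal.submodule_iSupIndep i).le_bot ⟨hx, ?_⟩)
  exact iSup_le (fun j : {i : ℤ // 0 ≤ i} => le_iSup₂_of_le (f := fun j (_ : j ≠ i) => D.gr j)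
    (j : ℤ) (fun h => hi (h ▸ j.2)) le_rfl) hx'

theorem br_ne_zero_of_coroot {α : Module.Dual ℂ D.h₀} {z : g} {h : D.h₀}
    (hz : z = ((h : Even g) : g)) (hα : α h = 2) : z ≠ 0 := by
  intro h0
  have h1 : h = 0 := Subtype.ext (Subtype.ext (hz.symm.trans h0))
  rw [h1, map_zero] at hα
  exact two_ne_zero hα.symm

variable [FiniteDimensional ℂ g]

theorem exists_evenPart_ne_zero {α : Module.Dual ℂ D.h₀} (h : wtSpace D.h₀ α ⊓ par 0 ≠ ⊥) :
    ∃ (i : ℤ) (x : g), x ∈ D.evenPart i α ∧ x ≠ 0 := by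
  by_contra! h0
  refine h (eq_bot_iff.2 fun x hx => (D.iSupIndep_wtSpace α).le_bot ⟨hx.1, ?_⟩)
  suffices h1 : ⨆ i, ⨆ β, D.evenPart i β ≤ ⨆ β, ⨆ (_ : β ≠ α), wtSpace D.h₀ β from
    h1 (D.even_le hx.2)
  refine iSup_le fun i => iSup_le fun β => ?_
  by_cases hβ : β = α
  · subst hβ
    intro y hy
    rw [h0 i y hy]
    exact Submodule.zero_mem _
  · exact inf_le_right.trans (le_iSup₂_of_le (f := fun β (_ : β ≠ α) => wtSpace D.h₀ β) β hβ le_rfl)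

/-- If `α` is a positive even root with `sl₂`-triple `(x, y, h)` and `α + β` is not an even weight,
then the root vectors of an even root `β` are primitive vectors. -/
theorem exists_nat_of_add_eq_bot {i : ℤ} {α β : Module.Dual ℂ D.h₀} {x y : g} {h : D.h₀}
    (hx : x ∈ D.evenPart i α) (hy : y ∈ D.evenPart (-i) (-α))
    (hxy : br x y = ((h : Even g) : g)) (hα : α h = 2)
    (hβ : wtSpace D.h₀ β ⊓ par 0 ≠ ⊥) (hαβ : wtSpace D.h₀ (α + β) ⊓ par 0 = ⊥) :
    ∃ n : ℕ, β h = n := by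
  obtain ⟨v, hv, hv0⟩ := Submodule.exists_mem_ne_zero_of_ne_bot hβ
  refine exists_nat_eigenvalue (H := br ((h : Even g) : g)) (E := br x) (F := br y) ?_ ?_ ?_ hv0
    ?_ (hv.1 h)
  · ext z
    have h1 := br_even_jacobi hx.1.2 hy.1.2 z
    rw [hxy] at h1
    exact sub_eq_iff_eq_add.2 h1
  · ext z
    have h1 := br_even_jacobi (D.h₀_even h) hx.1.2 z
    rw [hx.2 h, hα] at h1
    refine sub_eq_iff_eq_add.2 (h1.trans ?_)
    rw [map_smul]
    rfl
  · ext z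
    have h1 := br_even_jacobi (D.h₀_even h) hy.1.2 z
    rw [hy.2 h, LinearMap.neg_apply, hα] at h1
    refine sub_eq_iff_eq_add.2 (h1.trans ?_)
    rw [map_smul, neg_smul]
    rfl
  · have h1 : br x v ∈ wtSpace D.h₀ (α + β) ⊓ par 0 :=
      ⟨D.wt_br hx.2 hv.1, by simpa using br_mem hx.1.2 hv.2⟩
    rwa [hαβ] at h1

/-- A nonempty sum of positive even roots is not zero. If no two summands add up to an even root,
then the coroot of one summand has the value `2` on it and natural numbers as values on the others. -/
theorem sum_ne_zero (s : Multiset (Module.Dual ℂ D.h₀)) (hs : s ≠ 0)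
    (hpos : ∀ α ∈ s, α ∈ D.evenPos) : s.sum ≠ 0 := by
  induction hn : s.card using Nat.strong_induction_on generalizing s with
  | _ n ih =>
    obtain ⟨α, hα⟩ := Multiset.exists_mem_of_ne_zero hs
    obtain ⟨t, rfl⟩ := Multiset.exists_cons_of_mem hα
    by_cases h : ∃ β ∈ t, wtSpace D.h₀ (α + β) ⊓ par 0 ≠ ⊥
    · -- two summands whose sum is an even root are replaced by their sum
      obtain ⟨β, hβ, hαβ⟩ := h
      obtain ⟨u, rfl⟩ := Multiset.exists_cons_of_mem hβ
      have h1 := ih (u.card + 1) (by simp only [Multiset.card_cons] at hn; omega)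
        ((α + β) ::ₘ u) (Multiset.cons_ne_zero) (by
          intro γ hγ
          rcases Multiset.mem_cons.1 hγ with rfl | hγ
          · refine ⟨(D.pos_add α (hpos α hα).1 β (hpos β (Multiset.mem_cons_of_mem hβ)).1).resolve_right
              fun h0 => hαβ ?_, hαβ⟩
            rw [h0, bot_inf_eq]
          · exact hpos γ (Multiset.mem_cons_of_mem (Multiset.mem_cons_of_mem hγ)))
        (by simp)
      simpa [add_assoc] using h1
    · push Not at h
      obtain ⟨i, x, hx, hx0⟩ := exists_evenPart_ne_zero (hpos α hα).2
      obtain ⟨y, hy, k, hxy, hk⟩ := D.exists_sl2 (ne_zero_of_mem_pos (hpos α hα).1) hx hx0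
      have h1 : ∀ u : Multiset (Module.Dual ℂ D.h₀), u ≤ t → ∃ n : ℕ, u.sum k = n := by
        intro u
        induction u using Multiset.induction_on with
        | empty => exact fun _ => ⟨0, by simp⟩
        | cons β u ihu =>
          intro hu
          obtain ⟨n, hn⟩ := ihu ((Multiset.le_cons_self u β).trans hu)
          have hβ := Multiset.subset_of_le hu (Multiset.mem_cons_self β u)
          obtain ⟨m, hm⟩ := exists_nat_of_add_eq_bot hx hy hxy hk
            (hpos β (Multiset.mem_cons_of_mem hβ)).2 (h β hβ)
          exact ⟨m + n, by simp [hm, hn]⟩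
      obtain ⟨n, hn⟩ := h1 t le_rfl
      intro h0
      have h2 := LinearMap.congr_fun h0 k
      rw [Multiset.sum_cons, LinearMap.add_apply, hk, hn, LinearMap.zero_apply] at h2
      have h3 : ((2 + n : ℕ) : ℂ) = 0 := by exact_mod_cast h2
      rw [Nat.cast_eq_zero] at h3
      omega

/-- The negative of a negative even root is a positive even root, and the negative even root
vectors have degree at most zero. -/
theorem neg_mem_evenPos {α : Module.Dual ℂ D.h₀} (hα : α ∈ D.neg) {i : ℤ} {x : g}
    (hx : x ∈ D.evenPart i α) (hx0 : x ≠ 0) : -α ∈ D.evenPos ∧ i ≤ 0 := by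
  have hα0 : α ≠ 0 := fun h0 => zero_notMem_neg (h0 ▸ hα)
  obtain ⟨y, hy, h, hxy, hh⟩ := D.exists_sl2 hα0 hx hx0
  have hxy0 := br_ne_zero_of_coroot hxy hh
  have hy0 : y ≠ 0 := fun h0 => hxy0 (by rw [h0, map_zero])
  have hbot : wtSpace D.h₀ (-α) ⊓ par 0 ≠ ⊥ := fun h0 =>
    hy0 ((Submodule.mem_bot ℂ).1 (h0 ▸ ⟨hy.2, hy.1.2⟩))
  have hroot : -α ∈ D.pos ∪ D.neg := by
    rw [← D.root_eq]
    refine ⟨neg_ne_zero.2 hα0, fun h0 => hbot ?_⟩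
    rw [h0, bot_inf_eq]
  have hpos : -α ∈ D.pos := by
    refine hroot.resolve_right fun hneg => ?_
    have h1 := D.neg_add α hα (-α) hneg
    rw [add_neg_cancel] at h1
    rcases h1 with h1 | h1
    · exact zero_notMem_neg h1
    · refine hxy0 ((Submodule.mem_bot ℂ).1 (h1 ▸ ?_))
      rw [hxy]
      exact D.h₀_le_wtSpace_zero h
  refine ⟨⟨hpos, hbot⟩, ?_⟩
  have h1 := nonneg_of_mem hy.1.1 hy0 (D.pos_deg _ hpos ⟨hy.2, hy.1.2⟩)
  omega

/-- The weights of `p₀`: root vectors for negative roots, and elements of the Cartan subalgebra,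
have degree zero. -/
theorem evenPart_cases {α : Module.Dual ℂ D.h₀} {i : ℤ} (hi : 0 ≤ i) {x : g}
    (hx : x ∈ D.evenPart i α) (hx0 : x ≠ 0) :
    (α = 0 ∧ i = 0) ∨ α ∈ D.evenPos ∨ (-α ∈ D.evenPos ∧ i = 0) := by
  by_cases hα : α = 0
  · refine Or.inl ⟨hα, ?_⟩
    subst hα
    by_contra h0
    have h1 := D.h₀_deg ⟨⟨x, hx.1.2⟩, D.mem_h₀_of_mem_wtSpace_zero hx.2 hx.1.2⟩
    exact hx0 ((D.gr_internal.submodule_iSupIndep.pairwiseDisjoint h0).le_bot ⟨hx.1.1, h1⟩)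
  right
  have hbot : wtSpace D.h₀ α ⊓ par 0 ≠ ⊥ := fun h0 =>
    hx0 ((Submodule.mem_bot ℂ).1 (h0 ▸ ⟨hx.2, hx.1.2⟩))
  have hroot : α ∈ D.pos ∪ D.neg := by
    rw [← D.root_eq]
    refine ⟨hα, fun h0 => hbot ?_⟩
    rw [h0, bot_inf_eq]
  rcases hroot with h1 | h1
  · exact Or.inl ⟨h1, hbot⟩
  · have h2 := neg_mem_evenPos h1 hx hx0
    exact Or.inr ⟨h2.1, le_antisymm h2.2 hi⟩

end GradedDatum

end Positivity

/-! ### Highest weight modules -/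

section HighestWeight

/-- If the sum of a vector of one weight and of vectors of other weights lies in a stable
subspace, so does the first of them. -/
theorem jointEigenspace_mem_of_add_mem {ι V κ : Type*} [AddCommGroup V] [Module ℂ V]
    {T : ι → Module.End ℂ V} {w : κ → ι → ℂ} (hw : Function.Injective w)
    {N : Submodule ℂ V} (hN : ∀ i, ∀ v ∈ N, T i v ∈ N) {α : κ} {u u' : V}
    (hu : u ∈ jointEigenspace T (w α))
    (hu' : u' ∈ ⨆ β, ⨆ (_ : β ≠ α), jointEigenspace T (w β)) (h : u + u' ∈ N) : u ∈ N := by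
  have hmap : ∀ γ : ι → ℂ, (jointEigenspace T γ).map N.mkQ ≤
      jointEigenspace (fun i => N.mapQ N (T i) (hN i)) γ := by
    rintro γ _ ⟨v, hv, rfl⟩ i
    rw [Submodule.mkQ_apply, Submodule.mapQ_apply, hv i]
    rfl
  rw [← Submodule.Quotient.mk_eq_zero] at h ⊢
  refine ((jointEigenspace_independent (T := fun i => N.mapQ N (T i) (hN i))).comp hw α).le_bot
    ⟨hmap _ ⟨u, hu, rfl⟩, ?_⟩
  have h1 : N.mkQ u = -N.mkQ u' := eq_neg_of_add_eq_zero_left h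
  rw [← Submodule.mkQ_apply, h1]
  refine Submodule.neg_mem _ ?_
  have h2 := Submodule.mem_map_of_mem (f := N.mkQ) hu'
  simp only [Submodule.map_iSup] at h2
  exact iSup_mono (fun β => iSup_mono fun _ => hmap _) h2

variable {g : Type*} [AddCommGroup g] [Module ℂ g] [LieSuperalgebra g]

namespace GradedDatum

variable (D : GradedDatum g) {M : Type*} [AddCommGroup M] [Module ℂ M]

/-- The vectors of weight `μ` in a module over a subalgebra that contains `h₀`. -/
def modWt {s : SubSuperalgebra g} (hs : ∀ h : D.h₀, ((h : Even g) : g) ∈ s.sub) (σ : SuperRep s M)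
    (μ : Module.Dual ℂ D.h₀) : Submodule ℂ M :=
  jointEigenspace (fun h : D.h₀ => σ.act ⟨_, hs h⟩) μ

/-- A vector of weight `μ` is a highest weight vector if it is killed by the root vectors for the
positive roots. -/
def IsHighest {s : SubSuperalgebra g} (hs : ∀ h : D.h₀, ((h : Even g) : g) ∈ s.sub)
    (σ : SuperRep s M) (μ : Module.Dual ℂ D.h₀) (v : M) : Prop :=
  v ∈ D.modWt hs σ μ ∧ ∀ α ∈ D.pos, ∀ x : s.sub, (x : g) ∈ wtSpace D.h₀ α → σ.act x v = 0

theorem h₀_mem_l₀ (h : D.h₀) : ((h : Even g) : g) ∈ D.l₀.sub := ⟨D.h₀_deg h, (h : Even g).2⟩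

theorem l₀_le_p₀ : D.l₀.sub ≤ D.p₀.sub := fun _ hx =>
  ⟨(le_iSup (fun i : {i : ℤ // 0 ≤ i} => D.gr i) ⟨0, le_rfl⟩) hx.1, hx.2⟩

theorem h₀_mem_p₀ (h : D.h₀) : ((h : Even g) : g) ∈ D.p₀.sub := D.l₀_le_p₀ (D.h₀_mem_l₀ h)

variable {D}

section Action

variable {s : SubSuperalgebra g} {hs : ∀ h : D.h₀, ((h : Even g) : g) ∈ s.sub} {σ : SuperRep s M}

theorem act_mem_modWt {α μ : Module.Dual ℂ D.h₀} {x : s.sub} (hx : (x : g) ∈ par 0)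
    (hxα : (x : g) ∈ wtSpace D.h₀ α) {v : M} (hv : v ∈ D.modWt hs σ μ) :
    σ.act x v ∈ D.modWt hs σ (μ + α) := by
  intro h
  have h1 := σ.act_act ⟨_, hs h⟩ x (D.h₀_even h) hx v
  have h2 : (⟨br ((h : Even g) : g) (x : g), s.closed (hs h) x.2⟩ : s.sub) = α h • x :=
    Subtype.ext (hxα h)
  rw [superSign_zero_left, one_smul, hv h] at h1
  refine h1.trans ?_
  simp only [h2, map_smul, LinearMap.smul_apply, LinearMap.add_apply, add_smul]

end Action

section Lowering

variable (D) in
/-- The filtration of an `l₀`-module by the number of negative root vectors applied to a given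
vector. -/
def lowFil (τ : SuperRep D.l₀ M) (v : M) : ℕ → Submodule ℂ M
  | 0 => ℂ ∙ v
  | k + 1 => lowFil τ v k ⊔ Submodule.span ℂ {z | ∃ (y : D.l₀.sub) (β : Module.Dual ℂ D.h₀)
      (w : M), -β ∈ D.evenPos ∧ (y : g) ∈ wtSpace D.h₀ β ∧ w ∈ lowFil τ v k ∧ z = τ.act y w}

variable {τ : SuperRep D.l₀ M} {μ : Module.Dual ℂ D.h₀} {v : M}

theorem lowFil_le_succ (k : ℕ) : D.lowFil τ v k ≤ D.lowFil τ v (k + 1) := le_sup_left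

/-- If the elements of weight zero and the positive root vectors preserve the `k`-th step of
`lowFil`, then all of `l₀` maps it to the next step. -/
theorem act_mem_lowFil_succ [FiniteDimensional ℂ g] {k : ℕ}
    (h : ∀ α, α = 0 ∨ α ∈ D.pos → ∀ x : D.l₀.sub, (x : g) ∈ wtSpace D.h₀ α →
      ∀ w ∈ D.lowFil τ v k, τ.act x w ∈ D.lowFil τ v k)
    (x : D.l₀.sub) (w : M) (hw : w ∈ D.lowFil τ v k) : τ.act x w ∈ D.lowFil τ v (k + 1) := by
  let K : Submodule ℂ D.l₀.sub :=
    { carrier := {x | τ.act x w ∈ D.lowFil τ v (k + 1)}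
      add_mem' := fun ha hb => by
        rw [Set.mem_ofPred_eq, map_add]
        exact Submodule.add_mem _ ha hb
      zero_mem' := by simp
      smul_mem' := fun c a ha => by
        rw [Set.mem_ofPred_eq, map_smul]
        exact Submodule.smul_mem _ c ha }
  suffices hK : D.l₀.sub ≤ K.map D.l₀.sub.subtype by
    obtain ⟨x', hx', hxx'⟩ := hK x.2
    rw [← Subtype.ext hxx']
    exact hx'
  refine (D.gr_inf_par_le 0).trans (iSup_le fun α y hy => ?_)
  refine ⟨⟨y, hy.1⟩, ?_, rfl⟩
  by_cases hy0 : y = 0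
  · subst hy0
    exact K.zero_mem
  rcases evenPart_cases le_rfl hy hy0 with h1 | h1 | h1
  · exact lowFil_le_succ k (h α (Or.inl h1.1) _ hy.2 w hw)
  · exact lowFil_le_succ k (h α (Or.inr h1.1) _ hy.2 w hw)
  · exact Submodule.mem_sup_right (Submodule.subset_span ⟨_, α, w, h1.1, hy.2, hw, rfl⟩)

/-- For a highest weight vector, the elements of weight zero and the positive root vectors preserve
every step of `lowFil`. -/
theorem act_mem_lowFil [FiniteDimensional ℂ g] (hv : D.IsHighest D.h₀_mem_l₀ τ μ v) (k : ℕ) :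
    ∀ α, α = 0 ∨ α ∈ D.pos → ∀ x : D.l₀.sub, (x : g) ∈ wtSpace D.h₀ α →
      ∀ w ∈ D.lowFil τ v k, τ.act x w ∈ D.lowFil τ v k := by
  induction k with
  | zero =>
    intro α hα x hx w hw
    obtain ⟨c, rfl⟩ := Submodule.mem_span_singleton.1 hw
    rw [map_smul]
    refine Submodule.smul_mem _ c ?_
    rcases hα with rfl | hα
    · exact Submodule.mem_span_singleton.2
        ⟨_, (hv.1 ⟨_, D.mem_h₀_of_mem_wtSpace_zero hx x.2.2⟩).symm⟩
    · rw [hv.2 α hα x hx]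
      exact Submodule.zero_mem _
  | succ k ih =>
    intro α hα x hx w hw
    obtain ⟨a, ha, b, hb, rfl⟩ := Submodule.mem_sup.1 hw
    rw [map_add]
    refine Submodule.add_mem _ (lowFil_le_succ k (ih α hα x hx a ha)) ?_
    clear ha hw
    induction hb using Submodule.span_induction with
    | mem z hz =>
      obtain ⟨y, β, u, hβ, hy, hu, rfl⟩ := hz
      rw [τ.act_act x y x.2.2 y.2.2, superSign_zero_left, one_smul]
      refine Submodule.add_mem _ ?_ (act_mem_lowFil_succ ih _ u hu)
      exact Submodule.mem_sup_right
        (Submodule.subset_span ⟨y, β, _, hβ, hy, ih α hα x hx u hu, rfl⟩)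
    | zero => simp
    | add y z _ _ hy hz => rw [map_add]; exact Submodule.add_mem _ hy hz
    | smul c z _ hz => rw [map_smul]; exact Submodule.smul_mem _ c hz

/-- The weights of `lowFil`, other than that of the generator itself, are smaller than the highest
weight by a nonempty sum of positive even roots. -/
theorem lowFil_le (hv : v ∈ D.modWt D.h₀_mem_l₀ τ μ) (k : ℕ) :
    D.lowFil τ v k ≤ (ℂ ∙ v) ⊔ ⨆ t : {t : Multiset (Module.Dual ℂ D.h₀) //
      t ≠ 0 ∧ ∀ α ∈ t, α ∈ D.evenPos}, D.modWt D.h₀_mem_l₀ τ (μ - t.1.sum) := by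
  induction k with
  | zero => exact le_sup_left
  | succ k ih =>
    refine sup_le ih (Submodule.span_le.2 ?_)
    rintro _ ⟨y, β, w, hβ, hy, hw, rfl⟩
    obtain ⟨a, ha, b, hb, rfl⟩ := Submodule.mem_sup.1 (ih hw)
    refine Submodule.mem_sup_right ?_
    rw [map_add]
    refine Submodule.add_mem _ ?_ ?_
    · obtain ⟨c, rfl⟩ := Submodule.mem_span_singleton.1 ha
      rw [map_smul]
      refine Submodule.smul_mem _ c (Submodule.mem_iSup_of_mem ⟨{-β}, by simp, by simpa⟩ ?_)
      simpa using act_mem_modWt y.2.2 hy hv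
    · clear hw ha
      induction hb using Submodule.iSup_induction' with
      | mem t b hb =>
        refine Submodule.mem_iSup_of_mem ⟨-β ::ₘ t.1, by simp, fun α hα => ?_⟩ ?_
        · rcases Multiset.mem_cons.1 hα with rfl | hα
          · exact hβ
          · exact t.2.2 α hα
        · have h1 := act_mem_modWt y.2.2 hy hb
          have h2 : μ - (-β ::ₘ t.1).sum = μ - t.1.sum + β := by
            rw [Multiset.sum_cons]
            abel
          rw [h2]
          exact h1
      | zero => simp
      | add b c _ _ hb hc => rw [map_add]; exact Submodule.add_mem _ hb hc

/-- In a module generated by a highest weight vector, the highest weight space is spanned by that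
vector. -/
theorem top_le_of_isHighest [FiniteDimensional ℂ g] (hv : D.IsHighest D.h₀_mem_l₀ τ μ v)
    (hgen : τ.gen (ℂ ∙ v) = ⊤) :
    ⊤ ≤ (ℂ ∙ v) ⊔ ⨆ ν, ⨆ (_ : ν ≠ μ), D.modWt D.h₀_mem_l₀ τ ν := by
  have hmono : Monotone (D.lowFil τ v) := monotone_nat_of_le_succ lowFil_le_succ
  have hmem : ∀ w, w ∈ ⨆ k, D.lowFil τ v k ↔ ∃ k, w ∈ D.lowFil τ v k := fun w =>
    Submodule.mem_iSup_of_directed _ hmono.directed_le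
  have hst : τ.IsStable (⨆ k, D.lowFil τ v k) := by
    intro x w hw
    obtain ⟨k, hk⟩ := (hmem w).1 hw
    exact (hmem _).2 ⟨k + 1, act_mem_lowFil_succ (act_mem_lowFil hv k) x w hk⟩
  rw [← hgen]
  refine (SuperRep.gen_le hst (le_iSup (D.lowFil τ v) 0)).trans (iSup_le fun k => ?_)
  refine (lowFil_le hv.1 k).trans (sup_le_sup_left (iSup_le fun t => ?_) _)
  refine le_iSup₂_of_le (f := fun ν (_ : ν ≠ μ) => D.modWt D.h₀_mem_l₀ τ ν) (μ - t.1.sum) ?_ le_rfl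
  rw [Ne, sub_eq_self]
  exact sum_ne_zero t.1 t.2.1 t.2.2

end Lowering

end GradedDatum

end HighestWeight

/-! ### Finite-dimensional simple modules over `p₀` -/

section SimpleModules

variable {g : Type*} [AddCommGroup g] [Module ℂ g] [LieSuperalgebra g]

namespace GradedDatum

variable {D : GradedDatum g} {M N : Type*} [AddCommGroup M] [Module ℂ M]
  [AddCommGroup N] [Module ℂ N]

theorem map_modWt_le {s : SubSuperalgebra g} {hs : ∀ h : D.h₀, ((h : Even g) : g) ∈ s.sub}
    {σ : SuperRep s M} {τ : SuperRep s N} {f : M →ₗ[ℂ] N}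
    (hf : ∀ x v, f (σ.act x v) = τ.act x (f v)) (μ : Module.Dual ℂ D.h₀) :
    (D.modWt hs σ μ).map f ≤ D.modWt hs τ μ := by
  rintro _ ⟨v, hv, rfl⟩ h
  exact (hf _ v).symm.trans ((congrArg f (hv h)).trans (map_smul f _ _))

variable [FiniteDimensional ℂ g]

/-- A simple `l₀`-module with a highest weight vector is the simple quotient of the Verma module:
the kernel of the map from the Verma module is the largest proper submodule, since a submodule
that is not contained in it contains the generator as a weight component. -/
theorem LSrep_iso {σ : SuperRep D.l₀ N} {μ : Module.Dual ℂ D.h₀} {v : N} (hv0 : v ≠ 0)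
    (hv : D.IsHighest D.h₀_mem_l₀ σ μ v)
    (hsimple : ∀ K : Submodule ℂ N, σ.IsStable K → K = ⊥ ∨ K = ⊤) : (D.LSrep μ).Iso σ := by
  let _ : Module (Env D.l₀) N := Module.compHom N σ.envHom.toRingHom
  have hsmul : ∀ (u : Env D.l₀) (n : N), u • n = σ.envHom u n := fun _ _ => rfl
  have : IsScalarTower ℂ (Env D.l₀) N := ⟨fun c u n => by
    rw [hsmul, hsmul, map_smul, LinearMap.smul_apply]⟩
  have htop : ∀ K : Submodule (Env D.l₀) N, K ≠ ⊥ → K = ⊤ := by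
    intro K hK
    have hst : σ.IsStable (K.restrictScalars ℂ) := fun x n hn => by
      have h1 := K.smul_mem (Env.ι D.l₀ x) hn
      rwa [hsmul, SuperRep.envHom_ι] at h1
    rcases hsimple _ hst with h1 | h1
    · exact absurd ((Submodule.restrictScalars_eq_bot_iff _ _ _).1 h1) hK
    · exact (Submodule.restrictScalars_eq_top_iff _ _ _).1 h1
  let φ : D.Verma μ →ₗ[Env D.l₀] N := Submodule.liftQ _
    (LinearMap.toSpanSingleton (Env D.l₀) N v) (Submodule.span_le.2 (by
      rintro _ (⟨x, ⟨α, hα, hx⟩, rfl⟩ | ⟨h, rfl⟩)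
      · rw [SetLike.mem_coe, LinearMap.mem_ker, LinearMap.toSpanSingleton_apply, hsmul,
          SuperRep.envHom_ι, hv.2 α hα x hx]
      · rw [SetLike.mem_coe, LinearMap.mem_ker, LinearMap.toSpanSingleton_apply, hsmul, map_sub,
          SuperRep.envHom_ι, AlgHom.commutes, LinearMap.sub_apply, Module.algebraMap_end_apply,
          sub_eq_zero]
        exact hv.1 h))
  let v₀ : D.Verma μ := Submodule.Quotient.mk 1
  have hφ : φ v₀ = v := one_smul (Env D.l₀) v
  let τ : SuperRep D.l₀ (D.Verma μ) := SuperRep.ofEnv D.l₀ _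
  have hφτ : ∀ x z, φ (τ.act x z) = σ.act x (φ z) := fun x z => by
    rw [← SuperRep.envHom_ι σ, ← hsmul, ← map_smul]
    rfl
  have hmk : ∀ u : Env D.l₀, u • v₀ = Submodule.Quotient.mk u := fun u =>
    congrArg Submodule.Quotient.mk (mul_one u)
  have hrel : ∀ u : Env D.l₀, u ∈ {u | ∃ x : D.l₀.sub, (∃ α ∈ D.pos, (x : g) ∈ wtSpace D.h₀ α) ∧
      u = Env.ι D.l₀ x} ∪ {u | ∃ h : D.h₀, u = Env.ι D.l₀ ⟨((h : Even g) : g), D.h₀_mem_l₀ h⟩ -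
        algebraMap ℂ (Env D.l₀) (μ h)} → u • v₀ = 0 := fun u hu =>
    (hmk u).trans ((Submodule.Quotient.mk_eq_zero _).2 (Submodule.subset_span hu))
  have hv₀ : D.IsHighest D.h₀_mem_l₀ τ μ v₀ := by
    constructor
    · intro h
      have h1 : Env.ι D.l₀ ⟨((h : Even g) : g), D.h₀_mem_l₀ h⟩ • v₀ =
          algebraMap ℂ (Env D.l₀) (μ h) • v₀ := by
        rw [← sub_eq_zero, ← sub_smul]
        exact hrel _ (Or.inr ⟨h, rfl⟩)
      rw [algebraMap_smul] at h1
      exact h1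
    · exact fun α hα x hx => hrel _ (Or.inl ⟨x, ⟨α, hα, hx⟩, rfl⟩)
  have hgen : τ.gen (ℂ ∙ v₀) = ⊤ := by
    rw [eq_top_iff]
    intro z _
    obtain ⟨u, rfl⟩ := Submodule.Quotient.mk_surjective _ z
    refine Submodule.subset_span ⟨u, v₀, Submodule.mem_span_singleton_self _, ?_⟩
    rw [SuperRep.ofEnv_envHom, hmk]
  have hker : sSup {P : Submodule (Env D.l₀) (D.Verma μ) | P ≠ ⊤} = LinearMap.ker φ := by
    refine le_antisymm (sSup_le fun P hP => ?_) (le_sSup fun h => hv0 ?_)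
    · by_contra hP'
      refine hP ?_
      have h1 : P.map φ = ⊤ := htop _ fun h0 => hP' (LinearMap.le_ker_iff_map.2 h0)
      obtain ⟨p, hp, hpv⟩ : v ∈ P.map φ := h1 ▸ trivial
      obtain ⟨a, ha, w, hw, rfl⟩ :=
        Submodule.mem_sup.1 (top_le_of_isHighest hv₀ hgen (Submodule.mem_top (x := p)))
      obtain ⟨c, rfl⟩ := Submodule.mem_span_singleton.1 ha
      have h2 : (c - 1) • v = 0 := by
        refine (Submodule.mem_bot ℂ).1 (jointEigenspace_mem_of_add_mem
          (T := fun h : D.h₀ => σ.act ⟨_, D.h₀_mem_l₀ h⟩)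
          (w := fun α : Module.Dual ℂ D.h₀ => (α : D.h₀ → ℂ)) DFunLike.coe_injective (N := ⊥)
          (by simp) (α := μ) (u := (c - 1) • v) (u' := φ w) ?_ ?_ ?_)
        · exact Submodule.smul_mem _ _ hv.1
        · have h3 := Submodule.mem_map_of_mem (f := φ.restrictScalars ℂ) hw
          simp only [Submodule.map_iSup] at h3
          exact iSup_mono (fun β => iSup_mono fun _ =>
            map_modWt_le (f := φ.restrictScalars ℂ) hφτ β) h3
        · have h4 : φ (c • v₀) = c • v :=
            (LinearMap.map_smul (φ.restrictScalars ℂ) c v₀).trans (congrArg _ hφ)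
          rw [map_add, h4] at hpv
          rw [Submodule.mem_bot, sub_smul, one_smul, sub_add_eq_add_sub, hpv, sub_self]
      have hc : c = 1 := sub_eq_zero.1 ((smul_eq_zero.1 h2).resolve_right hv0)
      subst hc
      have h3 : v₀ ∈ P.restrictScalars ℂ := by
        refine jointEigenspace_mem_of_add_mem
          (T := fun h : D.h₀ => τ.act ⟨_, D.h₀_mem_l₀ h⟩)
          (w := fun α : Module.Dual ℂ D.h₀ => (α : D.h₀ → ℂ)) DFunLike.coe_injective
          (fun h z hz => P.smul_mem _ hz) (α := μ) (u' := w) hv₀.1 hw ?_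
        rwa [one_smul] at hp
      rw [eq_top_iff]
      intro z _
      obtain ⟨u, rfl⟩ := Submodule.Quotient.mk_surjective _ z
      have h4 := P.smul_mem u h3
      rwa [hmk] at h4
    · rw [← hφ]
      exact (h ▸ trivial : v₀ ∈ LinearMap.ker φ)
  have hsurj : Function.Surjective φ := by
    rw [← LinearMap.range_eq_top]
    exact htop _ fun h0 => hv0 ((Submodule.mem_bot (Env D.l₀)).1 (h0 ▸ ⟨v₀, hφ⟩))
  let e : D.LS μ ≃ₗ[Env D.l₀] N :=
    (Submodule.quotEquivOfEq _ _ hker).trans (φ.quotKerEquivOfSurjective hsurj)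
  refine ⟨e.restrictScalars ℂ, fun x z => ?_⟩
  have h1 := e.map_smul (Env.ι D.l₀ x) z
  rw [hsmul, SuperRep.envHom_ι] at h1
  exact h1

/-- A nonzero finite-dimensional `p₀`-module has a highest weight vector. -/
theorem exists_isHighest [FiniteDimensional ℂ N] [Nontrivial N] (σ : SuperRep D.p₀ N) :
    ∃ (μ : Module.Dual ℂ D.h₀) (v : N), v ≠ 0 ∧ D.IsHighest D.h₀_mem_p₀ σ μ v := by
  have hfin : {ν : Module.Dual ℂ D.h₀ | D.modWt D.h₀_mem_p₀ σ ν ≠ ⊥}.Finite :=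
    (finite_jointEigenspace_ne_bot (T := fun h : D.h₀ => σ.act ⟨_, D.h₀_mem_p₀ h⟩)).preimage
      (f := fun ν : Module.Dual ℂ D.h₀ => (ν : D.h₀ → ℂ)) DFunLike.coe_injective.injOn
  let X := {ν : Module.Dual ℂ D.h₀ // D.modWt D.h₀_mem_p₀ σ ν ≠ ⊥}
  have : Finite X := hfin
  have := D.cartan.nilpotent
  obtain ⟨χ, v, hv, hχ⟩ := exists_common_eigenvector (V := N)
    (σ.act ∘ₗ ({ toFun := fun h => ⟨_, D.h₀_mem_p₀ h⟩
                 map_add' := fun _ _ => rfl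
                 map_smul' := fun _ _ => rfl } : D.h₀ →ₗ[ℂ] D.p₀.sub)) (by
    intro a b
    have h1 := σ.act_br ⟨_, D.h₀_mem_p₀ a⟩ ⟨_, D.h₀_mem_p₀ b⟩ (D.h₀_even a) (D.h₀_even b)
    rw [superSign_zero_left, one_smul] at h1
    exact h1)
  have : Nonempty X := ⟨χ, fun h0 => hv ((Submodule.mem_bot ℂ).1 (h0 ▸ hχ))⟩
  -- a weight that is maximal for the order given by adding positive even roots
  let r : X → X → Prop := fun ν ν' => ∃ s : Multiset (Module.Dual ℂ D.h₀), s ≠ 0 ∧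
    (∀ α ∈ s, α ∈ D.evenPos) ∧ ν.1 = ν'.1 + s.sum
  have : IsTrans X r := ⟨by
    rintro a b c ⟨s, hs, hs', h1⟩ ⟨t, ht, ht', h2⟩
    refine ⟨s + t, by simp [hs], fun α hα => ?_, ?_⟩
    · exact (Multiset.mem_add.1 hα).elim (hs' α) (ht' α)
    · rw [h1, h2, Multiset.sum_add]
      abel⟩
  have : Std.Irrefl r := ⟨by
    rintro a ⟨s, hs, hs', h1⟩
    exact sum_ne_zero s hs hs' (left_eq_add.1 h1)⟩
  obtain ⟨⟨μ, hμ⟩, -, hmax⟩ := (Finite.wellFounded_of_trans_of_irrefl r).has_min Set.univ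
    Set.univ_nonempty
  obtain ⟨u, hu, hu0⟩ := Submodule.exists_mem_ne_zero_of_ne_bot hμ
  refine ⟨μ, u, hu0, hu, fun α hα x hx => ?_⟩
  by_contra h0
  have h1 := act_mem_modWt x.2.2 hx hu
  refine hmax ⟨μ + α, fun h2 => h0 ((Submodule.mem_bot ℂ).1 (h2 ▸ h1))⟩ trivial
    ⟨{α}, by simp, ?_, by simp⟩
  intro β hβ
  rw [Multiset.mem_singleton.1 hβ]
  refine ⟨hα, fun h2 => h0 ?_⟩
  have h3 : (x : g) = 0 := (Submodule.mem_bot ℂ).1 (h2 ▸ ⟨hx, x.2.2⟩)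
  rw [show x = 0 from Subtype.ext h3, map_zero, LinearMap.zero_apply]

/-- The components of positive degree annihilate a simple `p₀`-module with a highest weight
vector: the vectors that they annihilate form a submodule that contains the given vector. -/
theorem act_eq_zero_of_pos {σ : SuperRep D.p₀ N} {μ : Module.Dual ℂ D.h₀} {v : N} (hv0 : v ≠ 0)
    (hv : D.IsHighest D.h₀_mem_p₀ σ μ v)
    (hsimple : ∀ K : Submodule ℂ N, σ.IsStable K → K = ⊥ ∨ K = ⊤) {i : ℤ} (hi : 0 < i)
    (x : D.p₀.sub) (hx : (x : g) ∈ D.gr i) : σ.act x = 0 := by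
  let K : Submodule ℂ N :=
    { carrier := {w | ∀ i : ℤ, 0 < i → ∀ x : D.p₀.sub, (x : g) ∈ D.gr i → σ.act x w = 0}
      add_mem' := fun ha hb i hi x hx => by rw [map_add, ha i hi x hx, hb i hi x hx, add_zero]
      zero_mem' := fun i hi x hx => map_zero _
      smul_mem' := fun c a ha i hi x hx => by rw [map_smul, ha i hi x hx, smul_zero] }
  have hdeg : ∀ i : {i : ℤ // 0 ≤ i}, D.gr i ⊓ par 0 ≤ D.p₀.sub := fun i z hz =>
    ⟨le_iSup (fun i : {i : ℤ // 0 ≤ i} => D.gr i) i hz.1, hz.2⟩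
  have hK : σ.IsStable K := by
    intro y w hw i hi x hx
    let Y : Submodule ℂ D.p₀.sub :=
      { carrier := {y | σ.act x (σ.act y w) = 0}
        add_mem' := fun {a b} ha hb => by
          rw [Set.mem_ofPred_eq] at *
          rw [map_add, LinearMap.add_apply, map_add, ha, hb, add_zero]
        zero_mem' := by simp
        smul_mem' := fun c a ha => by
          rw [Set.mem_ofPred_eq] at *
          rw [map_smul, LinearMap.smul_apply, map_smul, ha, smul_zero] }
    suffices hY : D.p₀.sub ≤ Y.map D.p₀.sub.subtype by
      obtain ⟨y', hy', hyy'⟩ := hY y.2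
      rw [← Subtype.ext hyy']
      exact hy'
    refine fun z hz => (iSup_le fun j => ?_ : ⨆ j : {i : ℤ // 0 ≤ i}, D.gr j ⊓ par 0 ≤ _)
      (D.iSup_gr_inf_par_le (fun i : {i : ℤ // 0 ≤ i} => (i : ℤ)) hz)
    intro z hz
    refine ⟨⟨z, hdeg j hz⟩, ?_, rfl⟩
    change σ.act x (σ.act ⟨z, hdeg j hz⟩ w) = 0
    rw [σ.act_act x _ x.2.2 hz.2, hw i hi x hx, map_zero, smul_zero, zero_add]
    exact hw (i + j) (by have := j.2; omega) _ (D.gr_br hx hz.1)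
  have hvK : v ∈ K := by
    intro i hi x hx
    let X : Submodule ℂ D.p₀.sub :=
      { carrier := {y | σ.act y v = 0}
        add_mem' := fun {a b} ha hb => by
          rw [Set.mem_ofPred_eq] at *
          rw [map_add, LinearMap.add_apply, ha, hb, add_zero]
        zero_mem' := by simp
        smul_mem' := fun c a ha => by
          rw [Set.mem_ofPred_eq] at *
          rw [map_smul, LinearMap.smul_apply, ha, smul_zero] }
    suffices hX : D.gr i ⊓ par 0 ≤ X.map D.p₀.sub.subtype by
      obtain ⟨x', hx', hxx'⟩ := hX ⟨hx, x.2.2⟩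
      rw [← Subtype.ext hxx']
      exact hx'
    refine (D.gr_inf_par_le i).trans (iSup_le fun α y hy => ?_)
    refine ⟨⟨y, hdeg ⟨i, hi.le⟩ hy.1⟩, ?_, rfl⟩
    by_cases hy0 : y = 0
    · subst hy0
      exact X.zero_mem
    rcases evenPart_cases hi.le hy hy0 with h1 | h1 | h1
    · exact absurd h1.2 hi.ne'
    · exact hv.2 α h1.1 _ hy.2
    · exact absurd h1.2 hi.ne'
  rcases hsimple K hK with h1 | h1
  · exact absurd ((Submodule.mem_bot ℂ).1 (h1 ▸ hvK)) hv0
  · ext w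
    exact (h1 ▸ trivial : w ∈ K) i hi x hx

/-- A highest weight vector is a primitive vector for the `sl₂`-triple of each positive root of
`l₀`. -/
theorem dominant_of_isHighest [FiniteDimensional ℂ N] {σ : SuperRep D.p₀ N}
    {μ : Module.Dual ℂ D.h₀} {v : N} (hv0 : v ≠ 0) (hv : D.IsHighest D.h₀_mem_p₀ σ μ v) :
    μ ∈ D.dominant := by
  rintro α ⟨⟨hα, hα'⟩, -⟩
  obtain ⟨x, hx, hx0⟩ := Submodule.exists_mem_ne_zero_of_ne_bot hα'
  have hx' : x ∈ D.evenPart 0 α := ⟨hx.2, hx.1⟩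
  obtain ⟨y, hy, h, hxy, hh⟩ := D.exists_sl2 (ne_zero_of_mem_pos hα) hx' hx0
  rw [neg_zero] at hy
  refine ⟨h, ⟨Submodule.subset_span ⟨x, ⟨hx.1, hx.2.2⟩, y, ⟨hy.2, hy.1.2⟩, hxy.symm⟩, hh⟩, ?_⟩
  let X : D.p₀.sub := ⟨x, D.l₀_le_p₀ hx.2⟩
  let Y : D.p₀.sub := ⟨y, D.l₀_le_p₀ hy.1⟩
  let H : D.p₀.sub := ⟨_, D.h₀_mem_p₀ h⟩
  have hbr : ∀ {a b c : D.p₀.sub}, br (a : g) (b : g) = c →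
      σ.act a * σ.act b - σ.act b * σ.act a = σ.act c := by
    intro a b c habc
    have h1 := σ.act_br a b a.2.2 b.2.2
    rw [superSign_zero_left, one_smul] at h1
    rw [← h1]
    exact congrArg σ.act (Subtype.ext habc)
  refine exists_nat_eigenvalue (H := σ.act H) (E := σ.act X) (F := σ.act Y) (hbr hxy) ?_ ?_ hv0
    (hv.2 α hα X hx.1) (hv.1 h)
  · rw [hbr (c := (2 : ℂ) • X), map_smul]
    exact (hx.1 h).trans (by rw [hh]; rfl)
  · rw [hbr (c := -((2 : ℂ) • Y)), map_neg, map_smul]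
    exact (hy.2 h).trans (by rw [LinearMap.neg_apply, hh, neg_smul]; rfl)

/-- The finite-dimensional simple `p₀`-modules are the modules `L̂_S(μ)`, with `μ` dominant. -/
theorem exists_dominant_iso [FiniteDimensional ℂ N] [Nontrivial N] (σ : SuperRep D.p₀ N)
    (hsimple : ∀ K : Submodule ℂ N, σ.IsStable K → K = ⊥ ∨ K = ⊤) :
    ∃ μ ∈ D.dominant, (D.inflate₀ (D.LSrep μ)).Iso σ := by
  obtain ⟨μ, v, hv0, hv⟩ := exists_isHighest σ
  refine ⟨μ, dominant_of_isHighest hv0 hv, ?_⟩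
  -- the action of `p₀` factors through the projection to `l₀`
  have hproj : ∀ x : D.p₀.sub, σ.act x = (σ.res D.l₀_le_p₀).act
      ⟨D.proj₀ x, ⟨D.proj₀_mem_l x, D.proj₀_par x.2.2⟩⟩ := by
    intro x
    let X : Submodule ℂ D.p₀.sub :=
      { carrier := {x | σ.act x = (σ.res D.l₀_le_p₀).act
          ⟨D.proj₀ x, ⟨D.proj₀_mem_l x, D.proj₀_par x.2.2⟩⟩}
        add_mem' := fun {a b} ha hb => by
          rw [Set.mem_ofPred_eq] at *
          rw [map_add, ha, hb, ← map_add]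
          exact congrArg _ (Subtype.ext (map_add D.proj₀ _ _).symm)
        zero_mem' := by
          rw [Set.mem_ofPred_eq, map_zero, eq_comm]
          exact (congrArg _ (Subtype.ext (map_zero D.proj₀))).trans (map_zero _)
        smul_mem' := fun c a ha => by
          rw [Set.mem_ofPred_eq] at *
          rw [map_smul, ha, ← map_smul]
          exact congrArg _ (Subtype.ext (map_smul D.proj₀ _ _).symm) }
    suffices hX : D.p₀.sub ≤ X.map D.p₀.sub.subtype by
      obtain ⟨x', hx', hxx'⟩ := hX x.2
      rw [← Subtype.ext hxx']
      exact hx'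
    refine fun z hz => (iSup_le fun j => ?_ : ⨆ j : {i : ℤ // 0 ≤ i}, D.gr j ⊓ par 0 ≤ _)
      (D.iSup_gr_inf_par_le (fun i : {i : ℤ // 0 ≤ i} => (i : ℤ)) hz)
    intro z hz
    refine ⟨⟨z, le_iSup (fun i : {i : ℤ // 0 ≤ i} => D.gr i) j hz.1, hz.2⟩, ?_, rfl⟩
    rw [SetLike.mem_coe]
    change σ.act _ = σ.act _
    by_cases hj : (j : ℤ) = 0
    · have h1 := hz.1
      rw [hj] at h1
      exact congrArg _ (Subtype.ext (gradedProj_same D.gr_internal h1).symm)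
    · rw [act_eq_zero_of_pos hv0 hv hsimple (lt_of_le_of_ne j.2 (Ne.symm hj)) _ hz.1, eq_comm]
      refine (congrArg _ (Subtype.ext ?_)).trans (map_zero _)
      exact gradedProj_ne D.gr_internal hj hz.1
  obtain ⟨e, he⟩ := LSrep_iso (σ := σ.res D.l₀_le_p₀) hv0 ⟨hv.1, fun α hα x hx => hv.2 α hα _ hx⟩
    fun K hK => hsimple K fun x w hw => by
      rw [hproj]
      exact hK _ w hw
  exact ⟨e, fun x z => (he _ z).trans (by rw [hproj]; rfl)⟩

end GradedDatum

end SimpleModules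

/-! ### Filtrations of induced modules by parabolic Verma modules -/

section Filtration

variable {g : Type*} [AddCommGroup g] [Module ℂ g] [LieSuperalgebra g]

namespace SuperRep

variable {s : SubSuperalgebra g} {M V : Type*} [AddCommGroup M] [Module ℂ M]
  [AddCommGroup V] [Module ℂ V]

/-- A nonzero finite-dimensional submodule contains a simple submodule. -/
theorem exists_simple_le (σ : SuperRep s M) (A : Submodule ℂ M) [FiniteDimensional ℂ A]
    (hA : σ.IsStable A) (hA0 : A ≠ ⊥) : ∃ K ≤ A, K ≠ ⊥ ∧ σ.IsStable K ∧
      ∀ K' ≤ K, σ.IsStable K' → K' = ⊥ ∨ K' = K := by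
  induction hn : Module.finrank ℂ A using Nat.strong_induction_on generalizing A with
  | _ n ih =>
    by_cases h : ∀ K' ≤ A, σ.IsStable K' → K' = ⊥ ∨ K' = A
    · exact ⟨A, le_rfl, hA0, hA, h⟩
    · push Not at h
      obtain ⟨K', hK', hst, h0, hne⟩ := h
      have hlt := Submodule.finrank_lt_finrank_of_lt (lt_of_le_of_ne hK' hne)
      have : FiniteDimensional ℂ K' := Submodule.finiteDimensional_of_le hK'
      obtain ⟨K, hK, h1⟩ := ih _ (hn ▸ hlt) K' hst h0 rfl
      exact ⟨K, hK.trans hK', h1⟩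

theorem subquot_iso_congr {σ : SuperRep s M} {ρ : SuperRep s V} {A A' B B' : Submodule ℂ M}
    (hAA' : A = A') (hBB' : B = B') {hA : σ.IsStable A} {hB : σ.IsStable B}
    {hA' : σ.IsStable A'} {hB' : σ.IsStable B'} (h : (σ.subquot A B hA hB).Iso ρ) :
    (σ.subquot A' B' hA' hB').Iso ρ := by
  subst hAA' hBB'
  exact h

theorem quotRep_envHom_mk (σ : SuperRep s M) {N : Submodule ℂ M} (hN : σ.IsStable N) (u : Env s)
    (z : M) : (σ.quotRep N hN).envHom u (N.mkQ z) = N.mkQ (σ.envHom u z) :=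
  (envHom_comm (f := N.mkQ) (fun _ _ => rfl) u z).symm

end SuperRep

theorem map_outerSpan {s : SubSuperalgebra g} {B : Type*} {b : HomBasis s B} {T : Set B}
    {M M' : Type*} [AddCommGroup M] [Module ℂ M] [AddCommGroup M'] [Module ℂ M']
    {σ : SuperRep s M} {σ' : SuperRep s M'} {f : M →ₗ[ℂ] M'}
    (hf : ∀ x v, f (σ.act x v) = σ'.act x (f v)) (N : Submodule ℂ M) :
    (outerSpan b T σ N).map f = outerSpan b T σ' (N.map f) := by
  rw [outerSpan, Submodule.map_span]
  refine le_antisymm (Submodule.span_le.2 ?_) (Submodule.span_le.2 ?_)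
  · rintro _ ⟨_, ⟨m, n, hn, rfl⟩, rfl⟩
    rw [SuperRep.envHom_comm hf]
    exact Submodule.subset_span ⟨m, _, ⟨n, hn, rfl⟩, rfl⟩
  · rintro _ ⟨m, _, ⟨n, hn, rfl⟩, rfl⟩
    exact Submodule.subset_span ⟨_, ⟨m, n, hn, rfl⟩, SuperRep.envHom_comm hf _ _⟩

/-- The elements of an induced module, as sums of products of normal words with vectors. -/
theorem exists_finsupp_ind {s t : SubSuperalgebra g} {B : Type*} {b : HomBasis s B} {T : Set B}
    (hT : b.Adapted t T) {V : Type*} [AddCommGroup V] [Module ℂ V] (ρ : SuperRep t V)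
    (z : Ind hT.le ρ) : ∃ f : b.Outer T →₀ V,
      (f.sum fun y v => (indRep hT.le ρ).envHom (b.mono y.1) (indOf hT.le ρ v)) = z := by
  let L : (b.Outer T →₀ V) →ₗ[ℂ] Ind hT.le ρ :=
    Finsupp.lsum ℂ fun y => (indRep hT.le ρ).envHom (b.mono y.1) ∘ₗ indOf hT.le ρ
  suffices h : (⊤ : Submodule ℂ (Ind hT.le ρ)) ≤ LinearMap.range L from h (Submodule.mem_top (x := z))
  have hst : ((indRep hT.le ρ).res hT.le).IsStable (LinearMap.range (indOf hT.le ρ)) := by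
    rintro x _ ⟨v, rfl⟩
    exact ⟨ρ.act x v, indOf_act hT.le ρ x v⟩
  rw [← ind_gen_range, HomBasis.gen_eq_span hT _ hst]
  refine Submodule.span_le.2 ?_
  rintro _ ⟨y, _, ⟨v, rfl⟩, rfl⟩
  exact ⟨Finsupp.single y v, by simp [L]⟩

namespace Frame

variable {p p₀ : SubSuperalgebra g} {k l m n : ℕ} {Φ : Frame p p₀ k l m n}
  {W : Type*} [AddCommGroup W] [Module ℂ W] {ρ : SuperRep p W}

variable (Φ ρ) in
/-- The products of the even letters outside `p` with the vectors of a subspace. -/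
abbrev evSpan (N : Submodule ℂ (Φ.Mod ρ)) : Submodule ℂ (Φ.Mod ρ) :=
  outerSpan Φ.even (Set.range Sum.inr) (Φ.rep₀ ρ) N

/-- Freeness over the even letters outside `p` makes `N` recoverable from `evSpan N`. -/
theorem mem_of_mem_evSpan {N : Submodule ℂ (Φ.Mod ρ)} (hN : N ≤ Φ.ext ρ m) {z : Φ.Mod ρ}
    (hz : z ∈ Φ.ext ρ m) (hz' : z ∈ Φ.evSpan ρ N) : z ∈ N := by
  classical
  have h1 := mem_of_sum_mem hN (Finsupp.single ⟨[], Φ.even.normal_nil, by simp⟩ z) (fun y => by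
    rw [Finsupp.single_apply]
    split_ifs
    · exact hz
    · exact Submodule.zero_mem _) (by simpa using hz') ⟨[], Φ.even.normal_nil, by simp⟩
  simpa using h1

theorem evSpan_lt {N N' : Submodule ℂ (Φ.Mod ρ)} (hN' : N' ≤ Φ.ext ρ m) (h : N < N') :
    Φ.evSpan ρ N < Φ.evSpan ρ N' :=
  lt_of_le_not_ge (outerSpan_mono h.le) fun h1 => h.not_ge fun _ hz =>
    mem_of_mem_evSpan (h.le.trans hN') (hN' hz) (h1 (le_outerSpan _ hz))

section Step

variable {N N' : Submodule ℂ (Φ.Mod ρ)} (hle : N ≤ N') (hN' : N' ≤ Φ.ext ρ m)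
  (hst : (Φ.rep₀ ρ).IsStable (Φ.evSpan ρ N)) {V : Type*} [AddCommGroup V] [Module ℂ V]
  {σ : SuperRep p₀ V} {f : V →ₗ[ℂ] Φ.Mod ρ ⧸ Φ.evSpan ρ N} (hf : Function.Injective f)
  (hf' : ∀ x v, f (σ.act x v) = (((Φ.rep₀ ρ).quotRep _ hst).res Φ.adapted_even.le).act x (f v))
  (hrange : LinearMap.range f = N'.map (Φ.evSpan ρ N).mkQ)

include hf' hrange in
/-- In the quotient by `evSpan N`, where the image of `N'` is `p₀`-stable, the image of `evSpan N'`
is the submodule over the even part generated by it. -/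
theorem map_evSpan_eq_gen : (Φ.evSpan ρ N').map (Φ.evSpan ρ N).mkQ =
    ((Φ.rep₀ ρ).quotRep _ hst).gen (LinearMap.range f) := by
  rw [HomBasis.gen_eq_span Φ.adapted_even]
  · rw [map_outerSpan (σ' := (Φ.rep₀ ρ).quotRep _ hst) (fun _ _ => rfl), hrange]
    rfl
  · rintro x _ ⟨v, rfl⟩
    exact ⟨σ.act x v, hf' x v⟩

include hle hf' hrange in
/-- The next step of the filtration is a submodule over the even part. -/
theorem evSpan_stable : (Φ.rep₀ ρ).IsStable (Φ.evSpan ρ N') := by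
  intro x z hz
  have h1 : (Φ.evSpan ρ N).mkQ ((Φ.rep₀ ρ).act x z) ∈ (Φ.evSpan ρ N').map (Φ.evSpan ρ N).mkQ := by
    rw [map_evSpan_eq_gen hst hf' hrange]
    refine SuperRep.gen_stable _ _ x ((Φ.evSpan ρ N).mkQ z) ?_
    rw [← map_evSpan_eq_gen hst hf' hrange]
    exact Submodule.mem_map_of_mem hz
  obtain ⟨z', hz', h2⟩ := h1
  rw [← sub_eq_zero, ← map_sub, Submodule.mkQ_apply, Submodule.Quotient.mk_eq_zero] at h2
  have h3 := Submodule.sub_mem _ hz' (outerSpan_mono hle h2)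
  rwa [sub_sub_cancel] at h3

include hle hN' hf hrange in
theorem finrank_eq_add [FiniteDimensional ℂ W] :
    Module.finrank ℂ N' = Module.finrank ℂ N + Module.finrank ℂ V := by
  have := finite_ext (Φ := Φ) (ρ := ρ)
  have : FiniteDimensional ℂ N' := Submodule.finiteDimensional_of_le hN'
  let q : N' →ₗ[ℂ] Φ.Mod ρ ⧸ Φ.evSpan ρ N := (Φ.evSpan ρ N).mkQ ∘ₗ N'.subtype
  have hker : LinearMap.ker q = N.submoduleOf N' := by
    ext z
    rw [LinearMap.mem_ker, LinearMap.comp_apply, Submodule.mkQ_apply,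
      Submodule.Quotient.mk_eq_zero]
    exact ⟨mem_of_mem_evSpan (hle.trans hN') (hN' z.2), fun h => le_outerSpan _ h⟩
  have h1 := q.finrank_range_add_finrank_ker
  rw [hker, (Submodule.submoduleOfEquivOfLe hle).finrank_eq, LinearMap.range_comp,
    Submodule.range_subtype, ← hrange, LinearMap.finrank_range_of_inj hf] at h1
  omega

include hle hN' hf hf' hrange in
/-- A step of the filtration: a `p₀`-submodule of the quotient by `evSpan N` generates a module
that is induced from it. -/
theorem subquot_iso (hst' : (Φ.rep₀ ρ).IsStable (Φ.evSpan ρ N')) :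
    ((Φ.rep₀ ρ).subquot (Φ.evSpan ρ N) (Φ.evSpan ρ N') hst hst').Iso
      (indRep Φ.adapted_even.le σ) := by
  obtain ⟨F, hF, hF'⟩ := exists_indLift Φ.adapted_even.le σ ((Φ.rep₀ ρ).quotRep _ hst) f hf'
  have hlift : ∀ v, ∃ z ∈ N', (Φ.evSpan ρ N).mkQ z = f v := fun v => by
    have h1 : f v ∈ N'.map (Φ.evSpan ρ N).mkQ := hrange ▸ ⟨v, rfl⟩
    exact h1
  -- a linear section of the projection of `N'` to `V`
  let q : N' →ₗ[ℂ] Φ.Mod ρ ⧸ Φ.evSpan ρ N := (Φ.evSpan ρ N).mkQ ∘ₗ N'.subtype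
  obtain ⟨r, hr⟩ := Module.projective_lifting_property (q.codRestrict (LinearMap.range f) fun z =>
    hrange ▸ ⟨z, z.2, rfl⟩) f.rangeRestrict (by
      rintro ⟨_, v, rfl⟩
      obtain ⟨z, hz, hzv⟩ := hlift v
      exact ⟨⟨z, hz⟩, Subtype.ext hzv⟩)
  have hr' : ∀ v, (Φ.evSpan ρ N).mkQ (r v : Φ.Mod ρ) = f v := fun v =>
    congrArg Subtype.val (LinearMap.congr_fun hr v)
  have hinj : Function.Injective F := by
    rw [← LinearMap.ker_eq_bot, LinearMap.ker_eq_bot']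
    intro z hz
    obtain ⟨h, rfl⟩ := exists_finsupp_ind Φ.adapted_even σ z
    have h1 := mem_of_sum_mem (hle.trans hN') (h.mapRange (fun v => (r v : Φ.Mod ρ)) (by simp))
      (fun y => hN' (r (h y)).2) (by
        rw [← Submodule.Quotient.mk_eq_zero, ← Submodule.mkQ_apply, ← hz,
          Finsupp.sum_mapRange_index (by simp), Finsupp.sum, Finsupp.sum, map_sum, map_sum]
        refine Finset.sum_congr rfl fun y _ => ?_
        rw [← SuperRep.quotRep_envHom_mk _ hst, hr', SuperRep.envHom_comm hF', hF])
    have h2 : h = 0 := by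
      ext y
      refine hf ?_
      have h3 := h1 y
      rw [Finsupp.mapRange_apply] at h3
      rw [← hr', Finsupp.zero_apply, map_zero]
      exact (Submodule.Quotient.mk_eq_zero _).2 (le_outerSpan _ h3)
    rw [h2, Finsupp.sum_zero_index]
  have hFrange : LinearMap.range F = (Φ.evSpan ρ N').map (Φ.evSpan ρ N).mkQ := by
    rw [map_evSpan_eq_gen hst hf' hrange]
    refine le_antisymm ?_ (SuperRep.gen_le ?_ ?_)
    · rintro _ ⟨z, rfl⟩
      obtain ⟨h, rfl⟩ := exists_finsupp_ind Φ.adapted_even σ z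
      rw [Finsupp.sum, map_sum]
      refine Submodule.sum_mem _ fun y _ => Submodule.subset_span
        ⟨Φ.even.mono y.1, f (h y), ⟨_, rfl⟩, ?_⟩
      rw [SuperRep.envHom_comm hF', hF]
    · rintro x _ ⟨z, rfl⟩
      exact ⟨_, hF' x z⟩
    · rintro _ ⟨v, rfl⟩
      exact ⟨_, hF v⟩
  let π : Φ.evSpan ρ N' →ₗ[ℂ] Φ.Mod ρ ⧸ Φ.evSpan ρ N :=
    (Φ.evSpan ρ N).mkQ ∘ₗ (Φ.evSpan ρ N').subtype
  have hπker : (Φ.evSpan ρ N).submoduleOf (Φ.evSpan ρ N') = LinearMap.ker π := by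
    ext z
    exact (Submodule.Quotient.mk_eq_zero (Φ.evSpan ρ N) (x := (z : Φ.Mod ρ))).symm
  have hπrange : LinearMap.range π = LinearMap.range F := by
    rw [hFrange, LinearMap.range_comp, Submodule.range_subtype]
  let e := (((Submodule.quotEquivOfEq _ _ hπker).trans π.quotKerEquivRange).trans
    (LinearEquiv.ofEq _ _ hπrange)).trans (LinearEquiv.ofInjective F hinj).symm
  have he : ∀ z : Φ.evSpan ρ N', F (e (Submodule.Quotient.mk z)) = π z := by
    intro z
    exact congrArg Subtype.val ((LinearEquiv.ofInjective F hinj).apply_symm_apply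
      (LinearEquiv.ofEq _ _ hπrange (π.quotKerEquivRange (Submodule.Quotient.mk z))))
  refine ⟨e, fun x z => hinj ?_⟩
  obtain ⟨z, rfl⟩ := Submodule.Quotient.mk_surjective _ z
  rw [hF', he]
  exact he _

end Step

end Frame

end Filtration

section Filtration

variable {g : Type*} [AddCommGroup g] [Module ℂ g] [LieSuperalgebra g]

namespace Frame

variable {p p₀ : SubSuperalgebra g} {k l m n : ℕ} {Φ : Frame p p₀ k l m n}
  {W : Type*} [AddCommGroup W] [Module ℂ W] {ρ : SuperRep p W}

/-- If `evSpan N` is a proper submodule over the even part, then the quotient by it contains a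
simple `p₀`-submodule that comes from `ext`. It is found in the lowest degree in which `ext` is
not contained in `N`, where `p₀` acts on the quotient of `ext` by `N`. -/
theorem exists_simple_step [FiniteDimensional ℂ W] (hp₀ : p₀.sub = p.sub ⊓ par 0)
    {N : Submodule ℂ (Φ.Mod ρ)} (hN : N ≤ Φ.ext ρ m) (hne : N ≠ Φ.ext ρ m)
    (hst : (Φ.rep₀ ρ).IsStable (Φ.evSpan ρ N)) :
    ∃ (N' : Submodule ℂ (Φ.Mod ρ)) (K : Submodule ℂ (Φ.Mod ρ ⧸ Φ.evSpan ρ N)),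
      N < N' ∧ N' ≤ Φ.ext ρ m ∧ K = N'.map (Φ.evSpan ρ N).mkQ ∧ K ≠ ⊥ ∧ FiniteDimensional ℂ K ∧
      (((Φ.rep₀ ρ).quotRep _ hst).res Φ.adapted_even.le).IsStable K ∧
      ∀ K' ≤ K, (((Φ.rep₀ ρ).quotRep _ hst).res Φ.adapted_even.le).IsStable K' →
        K' = ⊥ ∨ K' = K := by
  classical
  have hex : ∃ j, ¬ Φ.ext ρ j ≤ N := ⟨m, fun h => hne (le_antisymm hN h)⟩
  let j := Nat.find hex
  have hj : ¬ Φ.ext ρ j ≤ N := Nat.find_spec hex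
  have hpred : Φ.evFilPred ρ j ≤ Φ.evSpan ρ N := by
    rcases hj' : j with - | i
    · exact bot_le
    · have h1 : Φ.ext ρ i ≤ N := by
        by_contra h
        exact Nat.find_min hex (m := i) (by change i < j; omega) h
      exact (evFil_eq hp₀ i).le.trans (outerSpan_mono h1)
  let A := (Φ.ext ρ j).map (Φ.evSpan ρ N).mkQ
  have := finite_ext (Φ := Φ) (ρ := ρ)
  have : FiniteDimensional ℂ (Φ.ext ρ j) := Submodule.finiteDimensional_of_le (ext_le j)
  have hA : (((Φ.rep₀ ρ).quotRep _ hst).res Φ.adapted_even.le).IsStable A := by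
    rintro x _ ⟨z, hz, rfl⟩
    obtain ⟨a, ha, b, hb, hab⟩ := Submodule.mem_sup.1 (act_mem_ext_sup hp₀ j x hz)
    refine ⟨a, ha, ?_⟩
    have h1 : (Φ.evSpan ρ N).mkQ b = 0 := (Submodule.Quotient.mk_eq_zero _).2 (hpred hb)
    rw [← add_zero ((Φ.evSpan ρ N).mkQ a), ← h1, ← map_add, hab]
    rfl
  have hker : ∀ z ∈ Φ.ext ρ m, (Φ.evSpan ρ N).mkQ z = 0 → z ∈ N := fun z hz h =>
    mem_of_mem_evSpan hN hz ((Submodule.Quotient.mk_eq_zero _).1 h)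
  have hA0 : A ≠ ⊥ := fun h => hj fun z hz => hker z (ext_le j hz) (by
    have h1 : (Φ.evSpan ρ N).mkQ z ∈ A := Submodule.mem_map_of_mem hz
    rwa [h, Submodule.mem_bot] at h1)
  obtain ⟨K, hK, hK0, hKst, hKs⟩ := SuperRep.exists_simple_le _ A hA hA0
  have hmk : ∀ z ∈ N, (Φ.evSpan ρ N).mkQ z = 0 := fun z hz =>
    (Submodule.Quotient.mk_eq_zero _).2 (le_outerSpan _ hz)
  refine ⟨(N ⊔ Φ.ext ρ j) ⊓ K.comap (Φ.evSpan ρ N).mkQ, K, ?_,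
    inf_le_left.trans (sup_le hN (ext_le j)), ?_, hK0, Submodule.finiteDimensional_of_le hK,
    hKst, hKs⟩
  · refine lt_of_le_not_ge (le_inf le_sup_left fun z hz => ?_) fun h => hK0 (eq_bot_iff.2 ?_)
    · rw [Submodule.mem_comap, hmk z hz]
      exact K.zero_mem
    · intro y hy
      obtain ⟨z, hz, rfl⟩ := hK hy
      exact hmk z (h ⟨Submodule.mem_sup_right hz, hy⟩)
  · refine le_antisymm (fun y hy => ?_) ?_
    · obtain ⟨z, hz, rfl⟩ := hK hy
      exact ⟨z, ⟨Submodule.mem_sup_right hz, hy⟩, rfl⟩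
    · rintro _ ⟨z, hz, rfl⟩
      exact hz.2

end Frame

namespace GradedDatum

variable [FiniteDimensional ℂ g] {D : GradedDatum g} {k l m n : ℕ}
  {Φ : Frame D.p D.p₀ k l m n} {W : Type*} [AddCommGroup W] [Module ℂ W] [FiniteDimensional ℂ W]
  {ρ : SuperRep D.p W}

/-- The submodules `evSpan N` are joined to the whole induced module by a filtration with
parabolic Verma modules as subquotients. -/
theorem exists_filtration {N : Submodule ℂ (Φ.Mod ρ)} (hN : N ≤ Φ.ext ρ m)
    (hst : (Φ.rep₀ ρ).IsStable (Φ.evSpan ρ N)) :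
    ∃ (r : ℕ) (F : Fin (r + 1) → Submodule ℂ (Φ.Mod ρ)) (μ : Fin r → Module.Dual ℂ D.h₀)
      (hF : ∀ i, (Φ.rep₀ ρ).IsStable (F i)),
      F 0 = Φ.evSpan ρ N ∧ F (Fin.last r) = ⊤ ∧
      (∀ i : Fin r, F i.castSucc < F i.succ) ∧
      (∀ i : Fin r, μ i ∈ D.dominant) ∧
      (∀ i : Fin r, ((Φ.rep₀ ρ).subquot (F i.castSucc) (F i.succ)
        (hF i.castSucc) (hF i.succ)).Iso (D.MSrep (μ i))) ∧
      (∀ i : Fin r, FiniteDimensional ℂ (D.LS (μ i))) ∧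
      Module.finrank ℂ N + ∑ i : Fin r, Module.finrank ℂ (D.LS (μ i)) =
        Module.finrank ℂ (Φ.ext ρ m) := by
  have hfin := Frame.finite_ext (Φ := Φ) (ρ := ρ)
  have hp₀ : D.p₀.sub = D.p.sub ⊓ par 0 := rfl
  induction hd : Module.finrank ℂ (Φ.ext ρ m) - Module.finrank ℂ N using
    Nat.strong_induction_on generalizing N with
  | _ d ih =>
    by_cases hne : N = Φ.ext ρ m
    · refine ⟨0, fun _ => Φ.evSpan ρ N, Fin.elim0, fun _ => hst, rfl, ?_, fun i => i.elim0,
        fun i => i.elim0, fun i => i.elim0, fun i => i.elim0, ?_⟩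
      swap
      · rw [hne, Fin.sum_univ_zero, add_zero]
      rw [hne]
      exact Frame.outerSpan_ext hp₀
    obtain ⟨N', K, hlt, hN', hKN', hK0, hKfin, hKst, hKs⟩ :=
      Frame.exists_simple_step hp₀ hN hne hst
    have : Nontrivial K := Submodule.nontrivial_iff_ne_bot.2 hK0
    obtain ⟨μ₀, hμ₀, e, he⟩ := exists_dominant_iso (SuperRep.subRep _ K hKst) (fun L hL => by
      have h1 := hKs (L.map K.subtype) (Submodule.map_subtype_le K L) (by
        rintro x _ ⟨z, hz, rfl⟩
        exact ⟨_, hL x z hz, rfl⟩)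
      refine h1.imp (fun h => Submodule.map_injective_of_injective K.subtype_injective (by
        rw [h, Submodule.map_bot]))
        fun h => ?_
      refine Submodule.map_injective_of_injective K.subtype_injective ?_
      rw [h, Submodule.map_top, Submodule.range_subtype])
    let f : D.LS μ₀ →ₗ[ℂ] Φ.Mod ρ ⧸ Φ.evSpan ρ N := K.subtype ∘ₗ e.toLinearMap
    have hf : Function.Injective f := K.subtype_injective.comp e.injective
    have hf' : ∀ x v, f ((D.inflate₀ (D.LSrep μ₀)).act x v) =
        (((Φ.rep₀ ρ).quotRep _ hst).res Φ.adapted_even.le).act x (f v) := fun x v =>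
      congrArg K.subtype (he x v)
    have hrange : LinearMap.range f = N'.map (Φ.evSpan ρ N).mkQ := by
      rw [LinearMap.range_comp, LinearEquiv.range, Submodule.map_top, Submodule.range_subtype, hKN']
    have hst' := Frame.evSpan_stable hlt.le hst hf' hrange
    have hdim := Frame.finrank_eq_add hlt.le hN' hf hrange
    have : FiniteDimensional ℂ N' := Submodule.finiteDimensional_of_le hN'
    have hlt' := Submodule.finrank_lt_finrank_of_lt hlt
    have hle' := Submodule.finrank_mono hN'
    obtain ⟨r, F, μ, hF, hF0, hFlast, hFlt, hμ, hiso, hLS, hsum⟩ :=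
      ih _ (by omega) hN' hst' rfl
    let F' : Fin (r + 2) → Submodule ℂ (Φ.Mod ρ) := Fin.cons (Φ.evSpan ρ N) F
    let μ' : Fin (r + 1) → Module.Dual ℂ D.h₀ := Fin.cons μ₀ μ
    have hF' : ∀ i, (Φ.rep₀ ρ).IsStable (F' i) := Fin.cases hst hF
    have h1 : ∀ i : Fin (r + 1), F' i.castSucc < F' i.succ := by
      refine Fin.cases ?_ hFlt
      change Φ.evSpan ρ N < F 0
      rw [hF0]
      exact Frame.evSpan_lt hN' hlt
    have h2 : ∀ i : Fin (r + 1), ((Φ.rep₀ ρ).subquot (F' i.castSucc) (F' i.succ)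
        (hF' i.castSucc) (hF' i.succ)).Iso (D.MSrep (μ' i)) := by
      refine Fin.cases ?_ hiso
      exact SuperRep.subquot_iso_congr (A := Φ.evSpan ρ N) rfl hF0.symm
        (Frame.subquot_iso hlt.le hN' hst hf hf' hrange hst')
    have h3 : ∀ i : Fin (r + 1), FiniteDimensional ℂ (D.LS (μ' i)) :=
      Fin.cases (Module.Finite.equiv e.symm) hLS
    have h4 : ∑ i, Module.finrank ℂ (D.LS (μ' i)) =
        Module.finrank ℂ (D.LS μ₀) + ∑ i, Module.finrank ℂ (D.LS (μ i)) := Fin.sum_univ_succ _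
    exact ⟨r + 1, F', μ', hF', rfl, hFlast, h1, Fin.cases hμ₀ hμ, h2, h3, by omega⟩

end GradedDatum

end Filtration

end

theorem theorem5p2 {g : Type*} [AddCommGroup g] [Module ℂ g] [FiniteDimensional ℂ g]
    [LieSuperalgebra g] (D : GradedDatum g) (lam : Module.Dual ℂ D.h₀)
    {V : Type*} [AddCommGroup V] [Module ℂ V] (𝒱 : ZMod 2 → Submodule ℂ V)
    (ρ : SuperRep D.c V) (hV : D.IsHighestWeightSpace lam 𝒱 ρ)
    (hfin : FiniteDimensional ℂ (D.LT 𝒱 ρ)) (c : ℕ) (hc : D.oddCodim = c) :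
    ∃ (k : ℕ) (F : Fin (k + 1) → Submodule ℂ (D.MT 𝒱 ρ)) (μ : Fin k → Module.Dual ℂ D.h₀)
      (hF : ∀ i, (D.MTrep₀ 𝒱 ρ).IsStable (F i)),
      F 0 = ⊥ ∧ F (Fin.last k) = ⊤ ∧
      (∀ i : Fin k, F i.castSucc < F i.succ) ∧
      (∀ i : Fin k, μ i ∈ D.dominant) ∧
      (∀ i : Fin k, ((D.MTrep₀ 𝒱 ρ).subquot (F i.castSucc) (F i.succ)
        (hF i.castSucc) (hF i.succ)).Iso (D.MSrep (μ i))) ∧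
      (∀ i : Fin k, FiniteDimensional ℂ (D.LS (μ i))) ∧
      ∑ i : Fin k, Module.finrank ℂ (D.LS (μ i)) = 2 ^ c * Module.finrank ℂ (D.LT 𝒱 ρ) := by
  obtain ⟨k, l, m, n, ⟨Φ⟩, hm⟩ := exists_frame D.p
  change Frame D.p D.p₀ k l m n at Φ
  have hmc : m = c := hm.symm.trans hc
  obtain ⟨r, F, μ, hF, hF0, hFlast, hlt, hμ, hiso, hLS, hsum⟩ :=
    GradedDatum.exists_filtration (Φ := Φ) (ρ := D.inflate (D.LTrep 𝒱 ρ)) (N := ⊥) bot_le (by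
      rw [Frame.evSpan, outerSpan_bot]
      rintro x v hv
      rw [(Submodule.mem_bot ℂ).1 hv, map_zero]
      exact Submodule.zero_mem _)
  rw [Frame.evSpan, outerSpan_bot] at hF0
  rw [Frame.finrank_ext, finrank_bot, zero_add, hmc] at hsum
  exact ⟨r, F, μ, hF, hF0, hFlast, hlt, hμ, hiso, hLS, hsum⟩
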